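/- Let $d\ge 1$ and $c_0>0$. Let $\chi:\mathbb R^d\to\mathbb R$ be smooth and radial, supported in the ball $B(0,\frac43)$ and equal to $1$ on $B(0,\frac34)$; put $\varphi(\xi)=\chi(\xi/2)-\chi(\xi)$, $\dot S_j=\chi(2^{-j}D)$ and $\dot\Delta_j=\varphi(2^{-j}D)$ for $j\in\mathbb Z$. Let $\mathcal S'_h$ be the set of tempered distributions $f$ on $\mathbb R^d$ with $\|\dot S_jf\|_{L^\infty}\to0$ as $j\to-\infty$, and let $\|f\|_{\dot B^s_{p,r}}=\bigl\|2^{js}\|\dot\Delta_jf\|_{L^p}\bigr\|_{\ell^r(\mathbb Z)}$; the space $\dot B^s_{p,r}$ consists of the $f\in\mathcal S'_h$ for which this is finite. Let $\Lambda_1$ be the Fourier multiplier with symbol $|\xi|_1=\sum_{i=1}^d|\xi_i|$. For $t\ge0$ write $F=e^{\sqrt{c_0t}\,\Lambda_1}f$ and $G=e^{\sqrt{c_0t}\,\Lambda_1}g$; norms of such objects are computed block by block, $\dot\Delta_je^{\sqrt{c_0t}\Lambda_1}f=e^{\sqrt{c_0t}\Lambda_1}\dot\Delta_jf$, where $v=e^{a\Lambda_1}w$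 with $v\in L^p$ means $w=e^{-a\Lambda_1}v$. Let $$T_fg=\sum_{j\in\mathbb Z}\dot S_{j-1}f\,\dot\Delta_jg,\qquad R(f,g)=\sum_{j\in\mathbb Z}\ \sum_{|j'-j|\le1}\dot\Delta_jf\,\dot\Delta_{j'}g .$$ Let $1<p,p_1,p_2<\infty$ with $\frac1p=\frac1{p_1}+\frac1{p_2}$ and let $1\le r,r_1,r_2\le\infty$. (i) Let $s\in\mathbb R$, and suppose that either $\sigma>0$ and $\frac1r=\frac1{r_1}+\frac1{r_2}$, or $\sigma=0$, $r_1=1$ and $r=r_2$. Then there is a constant $C$ such that for all $t\ge0$ and all $f,g\in\mathcal S'_h$ with $F\in\dot B^{-\sigma}_{p_1,r_1}$ and $G\in\dot B^{s}_{p_2,r_2}$, $$\|e^{\sqrt{c_0t}\,\Lambda_1}T_fg\|_{\dot B^{s-\sigma}_{p,r}}\le C\,\|F\|_{\dot B^{-\sigma}_{p_1,r_1}}\|G\|_{\dot B^{s}_{p_2,r_2}} .$$ (ii) Let $s_1,s_2\in\mathbb R$ with $s_1+s_2>0$ and suppose $\frac1r=\frac1{r_1}+\frac1{r_2}$. Then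 there is a constant $C$ such that for all $t\ge0$ and all $f,g\in\mathcal S'_h$ with $F\in\dot B^{s_1}_{p_1,r_1}$ and $G\in\dot B^{s_2}_{p_2,r_2}$, $$\|e^{\sqrt{c_0t}\,\Lambda_1}R(f,g)\|_{\dot B^{s_1+s_2}_{p,r}}\le C\,\|F\|_{\dot B^{s_1}_{p_1,r_1}}\|G\|_{\dot B^{s_2}_{p_2,r_2}} .$$ In both parts all products in the series are well-defined tempered distributions, and the estimate is understood as follows: for each $k$ the series of the $k$-th dyadic blocks of the terms converges in $\mathcal S'$, and the sums of these series, taken as the dyadic blocks of $T_fg$ (resp. $R(f,g)$), satisfy the bound; moreover, whenever the series defining $T_fg$ (resp. $R(f,g)$) itself converges in $\mathcal S'$, its sum satisfies the bound. -/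

import Mathlib

open MeasureTheory Filter Topology
open scoped ENNReal NNReal SchwartzMap FourierTransform

/-- The Euclidean space `ℝ^d`. -/
abbrev Rd (d : ℕ) : Type := EuclideanSpace ℝ (Fin d)

/-- Complex-valued tempered distributions on `ℝ^d`. -/
abbrev TempDist (d : ℕ) : Type := 𝓢'(Rd d, ℂ)

/-- `χ` is an admissible Littlewood-Paley cut-off: smooth, radial, supported in the ball of
radius `4/3` and equal to `1` on the ball of radius `3/4`. -/
structure IsCutoff {d : ℕ} (χ : Rd d → ℝ) : Prop where
  smooth : ContDiff ℝ ((⊤ : ℕ∞) : WithTop ℕ∞) χ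
  radial : ∀ ξ η : Rd d, ‖ξ‖ = ‖η‖ → χ ξ = χ η
  support : tsupport χ ⊆ Metric.closedBall 0 (4 / 3)
  eq_one : ∀ ξ ∈ Metric.closedBall (0 : Rd d) (3 / 4), χ ξ = 1

noncomputable section

/-- The Fourier multiplier `θ(2^{-j} D)` on tempered distributions. The factor `2π` is there
because Mathlib's Fourier transform uses the character `exp (-2π i x·ξ)`, so that the symbol
`θ(ξ)` for the normalization `exp (-i x·ξ)` becomes `θ(2π ξ)`. -/
def dyadicMultiplier {d : ℕ} (θ : Rd d → ℝ) (j : ℤ) : TempDist d →L[ℂ] TempDist d :=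
  TemperedDistribution.fourierMultiplierCLM ℂ
    (fun ξ : Rd d => ((θ ((2 : ℝ) ^ (-j) • ((2 * Real.pi) • ξ)) : ℝ) : ℂ))

/-- The low frequency cut-off `Ṡ_j = χ(2^{-j} D)`. -/
def lowFreq {d : ℕ} (χ : Rd d → ℝ) (j : ℤ) : TempDist d →L[ℂ] TempDist d :=
  dyadicMultiplier χ j

/-- The dyadic block `Δ̇_j = φ(2^{-j} D)`, where `φ(ξ) = χ(ξ/2) - χ(ξ)`. -/
def dyadicBlock {d : ℕ} (χ : Rd d → ℝ) (j : ℤ) : TempDist d →L[ℂ] TempDist d :=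
  dyadicMultiplier (fun ξ => χ ((2 : ℝ)⁻¹ • ξ) - χ ξ) j

/-- The tempered distribution `u` is (integration against) the function `v`. -/
def IsGivenBy {d : ℕ} (u : TempDist d) (v : Rd d → ℂ) : Prop :=
  ∀ φ : 𝓢(Rd d, ℂ), Integrable (fun x => v x * φ x) ∧ u φ = ∫ x, v x * φ x

/-- The `L^p` norm of a tempered distribution; it is `∞` unless `u` is an `L^p` function. -/
def lpNormDist {d : ℕ} (p : ℝ≥0∞) (u : TempDist d) : ℝ≥0∞ :=
  ⨅ (v : Rd d → ℂ) (_ : MemLp v p) (_ : IsGivenBy u v), eLpNorm v p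

/-- The space `S'_h`: tempered distributions with `‖Ṡ_j f‖_{L^∞} → 0` as `j → -∞`. -/
def SPrimeH {d : ℕ} (χ : Rd d → ℝ) : Set (TempDist d) :=
  {f | Tendsto (fun j : ℤ => lpNormDist ∞ (lowFreq χ j f)) atBot (𝓝 0)}

/-- `e^{-a Λ₁} φ` for a Schwartz function `φ`, where `Λ₁` is the Fourier multiplier with symbol
`|ξ|₁ = ∑ |ξ_i|` (this symbol is even, so the order of the two transforms is immaterial). -/
def expNegLambdaTest {d : ℕ} (a : ℝ) (φ : 𝓢(Rd d, ℂ)) : Rd d → ℂ :=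
  𝓕 (fun ξ : Rd d =>
    ((Real.exp (-a * ∑ i, |2 * Real.pi * ξ i|) : ℝ) : ℂ) * (𝓕⁻ φ : 𝓢(Rd d, ℂ)) ξ)

/-- `w = e^{-a Λ₁} v` in the sense of tempered distributions (the operator is transposed onto the
test function), that is, `v = e^{a Λ₁} w`. Used for `a ≥ 0` and `v` in a Lebesgue space. -/
def IsExpLambda {d : ℕ} (a : ℝ) (w : TempDist d) (v : Rd d → ℂ) : Prop :=
  ∀ φ : 𝓢(Rd d, ℂ), w φ = ∫ x, v x * expNegLambdaTest a φ x

/-- `‖e^{a Λ₁} w‖_{L^p}`; it is `∞` unless `e^{a Λ₁} w` is an `L^p` function. -/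
def expLambdaLpNorm {d : ℕ} (a : ℝ) (p : ℝ≥0∞) (w : TempDist d) : ℝ≥0∞ :=
  ⨅ (v : Rd d → ℂ) (_ : MemLp v p) (_ : IsExpLambda a w v), eLpNorm v p

/-- `‖e^{a Λ₁} u‖_{Ḃ^s_{p,r}}`, for `u` given by its dyadic blocks `B j = Δ̇_j u`: the `ℓ^r(ℤ)`
norm of `2^{js} ‖Δ̇_j e^{a Λ₁} u‖_{L^p} = 2^{js} ‖e^{a Λ₁} Δ̇_j u‖_{L^p}`. -/
def expLambdaBesovNormOfBlocks {d : ℕ} (a s : ℝ) (p r : ℝ≥0∞) (B : ℤ → TempDist d) : ℝ≥0∞ :=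
  eLpNorm (fun j : ℤ => (2 : ℝ≥0∞) ^ ((j : ℝ) * s) * expLambdaLpNorm a p (B j)) r Measure.count

/-- `‖e^{a Λ₁} f‖_{Ḃ^s_{p,r}}` for a tempered distribution `f`. -/
def expLambdaBesovNorm {d : ℕ} (χ : Rd d → ℝ) (a s : ℝ) (p r : ℝ≥0∞) (f : TempDist d) : ℝ≥0∞ :=
  expLambdaBesovNormOfBlocks a s p r (fun j => dyadicBlock χ j f)

/-- The set of `f ∈ S'_h` such that `e^{a Λ₁} f` belongs to `Ḃ^s_{p,r}`. -/
def GevreyBesov {d : ℕ} (χ : Rd d → ℝ) (a s : ℝ) (p r : ℝ≥0∞) : Set (TempDist d) :=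
  {f | f ∈ SPrimeH χ ∧ expLambdaBesovNorm χ a s p r f < ∞}

/-- `w = u₁ u₂` for tempered distributions `u₁`, `u₂` that are functions. -/
def IsProduct {d : ℕ} (u₁ u₂ w : TempDist d) : Prop :=
  ∃ v₁ v₂ : Rd d → ℂ, IsGivenBy u₁ v₁ ∧ IsGivenBy u₂ v₂ ∧ IsGivenBy w (fun x => v₁ x * v₂ x)

/-- `W j = Ṡ_{j-1} f · Δ̇_j g`, the terms of the paraproduct `T_f g`. -/
def IsParaproductTerms {d : ℕ} (χ : Rd d → ℝ) (f g : TempDist d) (W : ℤ → TempDist d) : Prop :=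
  ∀ j, IsProduct (lowFreq χ (j - 1) f) (dyadicBlock χ j g) (W j)

/-- `W j = ∑_{|j' - j| ≤ 1} Δ̇_j f · Δ̇_{j'} g`, the terms of the remainder `R(f, g)`. -/
def IsRemainderTerms {d : ℕ} (χ : Rd d → ℝ) (f g : TempDist d) (W : ℤ → TempDist d) : Prop :=
  ∃ P : ℤ → ℤ → TempDist d,
    (∀ j, ∀ j' ∈ Finset.Icc (j - 1) (j + 1),
      IsProduct (dyadicBlock χ j f) (dyadicBlock χ j' g) (P j j')) ∧
    ∀ j, W j = ∑ j' ∈ Finset.Icc (j - 1) (j + 1), P j j'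

/-- The series `∑_{j ∈ ℤ} W j` converges to `u` in the space of tempered distributions. -/
def SeriesConvergesTo {d : ℕ} (W : ℤ → TempDist d) (u : TempDist d) : Prop :=
  Tendsto (fun N : ℤ × ℤ => ∑ j ∈ Finset.Icc N.1 N.2, W j) (atBot ×ˢ atTop) (𝓝 u)

/-- `B k = Δ̇_k (∑_j W j) = ∑_j Δ̇_k (W j)`, with unconditional convergence in the space of
tempered distributions, for every `k`. The series `∑_j W j` itself need not converge there
(its low frequency part may only converge modulo polynomials). -/
def SeriesHasBlocks {d : ℕ} (χ : Rd d → ℝ) (W B : ℤ → TempDist d) : Prop :=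
  ∀ k, HasSum (fun j => dyadicBlock χ k (W j)) (B k)

/-- The estimate `‖e^{a Λ₁} ∑_j W j‖_{Ḃ^s_{p,r}} ≤ K`: all dyadic blocks of the series converge,
they satisfy the estimate, and so does the sum of the series whenever the series converges in the
space of tempered distributions. -/
def SeriesEstimate {d : ℕ} (χ : Rd d → ℝ) (a s : ℝ) (p r : ℝ≥0∞) (W : ℤ → TempDist d)
    (K : ℝ≥0∞) : Prop :=
  (∃ B : ℤ → TempDist d, SeriesHasBlocks χ W B ∧ expLambdaBesovNormOfBlocks a s p r B ≤ K) ∧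
    ∀ u : TempDist d, SeriesConvergesTo W u → expLambdaBesovNorm χ a s p r u ≤ K

end

/-!
The operator `e^{-aΛ₁}` turns the pointwise product into a bilinear operator `M = M_a` with
`e^{-aΛ₁} u · e^{-aΛ₁} v = e^{-aΛ₁} M(u, v)`, whose symbol is `exp (a (|η + ζ|₁ - |η|₁ - |ζ|₁))`.
The theorem rests on the bound `‖M(u, v)‖_p ≤ K ‖u‖_{p₁} ‖v‖_{p₂}` with `K` independent of `a ≥ 0`
(`exists_twistedProduct`). The symbol is a product over the coordinates, so that one coordinate at a
time can be treated. Once the signs of `η_i`, `ζ_i` and `η_i + ζ_i` are fixed, the factor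
`exp (a (|η_i + ζ_i| - |η_i| - |ζ_i|))` is either `1` or one of `exp (-2a|η_i|)`, `exp (-2a|ζ_i|)`.
The latter are symbols of Poisson averages, which are contractions (`norm_poissonAverage_le`), and
the signs are separated by the Riesz projections `1_{ξ·e > 0}(D)`
(`exists_bilinearMultiplier_direction`).

The Riesz projections are bounded on `L^p` for `1 < p < ∞` by M. Riesz's theorem. For `1 < p ≤ 2`
and a nonnegative function of one variable, the real part of the Cauchy integral `A` is positive on the
upper half plane, so that `A ^ p` is holomorphic there, and the integral of `A ^ p` over the line
vanishes; together with the inequality `|w| ^ p ≤ a (Re w) ^ p - b Re (w ^ p)` on the right half plane this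
bounds `A` by its real part, which is a Poisson integral (`exists_lintegral_cauchyIntegral_le`).
Integration over the lines of direction `e` yields the inequality on `ℝ^d`, and duality the
exponents `p ≥ 2` (`exists_norm_rieszAverage_le`). The projection itself is a strong limit of
integrable averages of translations (`exists_isMultiplier_halfSpace`).

Write now `Δ̇_j f = e^{-aΛ₁} F_j` and `Δ̇_j g = e^{-aΛ₁} G_j`; smooth cut-offs make the spectra of
`F_j` and `G_j` localized in annuli (`exists_localized_blocks`). For `f` in `S'_h` the low frequency
part is the sum of the preceding blocks, so that the terms of the paraproduct are
`e^{-aΛ₁} M(∑_{n ≤ j - 2} F_n, G_j)`, and those of the remainder are `e^{-aΛ₁} M(F_j, G_{j'})` with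
`|j' - j| ≤ 1`. Since `M` adds frequencies as the product does, the former have spectra in annuli of
size `2^j` and the latter in balls of size `2^j`. The blocks of the series are therefore finite
sums, respectively sums over `j ≥ k - 3`, and `seriesEstimate_of_localized` reduces the estimates
to the inequalities of Young, Hölder and Minkowski for sequences; `σ > 0` and `s₁ + s₂ > 0` serve to
sum geometric series.
-/

noncomputable section

/-! ### Spectra and Fourier multipliers on Lebesgue spaces -/

/-- The spectrum of `f` is the integrable function `g`, that is, `f` is the inverse Fourier
transform of `g`. In this way Fourier transforms of elements of `L^p` are avoided for `p > 2`; Schwartz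
functions have a spectrum in this sense and are dense in `L^p` for `p < ∞`. -/
def HasSpectrum {d : ℕ} (f g : Rd d → ℂ) : Prop :=
  Integrable g ∧ f =ᵐ[volume] (𝓕⁻ g : Rd d → ℂ)

/-- The bounded operator `T` on `L^p` multiplies spectra by `m`. For `p < ∞` this determines `T`,
see `IsMultiplier.ext`. -/
def IsMultiplier {d : ℕ} {p : ℝ≥0∞} [Fact (1 ≤ p)]
    (T : Lp ℂ p (volume : Measure (Rd d)) →L[ℂ] Lp ℂ p (volume : Measure (Rd d)))
    (m : Rd d → ℂ) : Prop :=
  ∀ (f : Lp ℂ p (volume : Measure (Rd d))) (g : Rd d → ℂ),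
    HasSpectrum f g → HasSpectrum (T f) (fun ξ => m ξ * g ξ)

section Spectrum

variable {d : ℕ}

lemma continuous_fourierInv {g : Rd d → ℂ} (hg : Integrable g) : Continuous (𝓕⁻ g : Rd d → ℂ) := by
  have h : (𝓕⁻ g : Rd d → ℂ) = fun x => 𝓕 g (-x) := by
    ext x; exact Real.fourierInv_eq_fourier_neg g x
  rw [h]
  exact (VectorFourier.fourierIntegral_continuous Real.continuous_fourierChar
    (by exact continuous_inner) hg).comp continuous_neg

lemma integral_mul_fourierInv {u g : Rd d → ℂ} (hu : Integrable u) (hg : Integrable g) :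
    ∫ x, u x * (𝓕⁻ g : Rd d → ℂ) x = ∫ ξ, (𝓕⁻ u : Rd d → ℂ) ξ * g ξ := by
  have h := VectorFourier.integral_fourierIntegral_smul_eq_flip (L := innerₗ (Rd d))
    Real.continuous_fourierChar continuous_inner hu hg
  have e1 : ∀ v : Rd d → ℂ, (𝓕⁻ v : Rd d → ℂ) =
      fun x => VectorFourier.fourierIntegral Real.fourierChar volume (innerₗ (Rd d)) v (-x) := by
    intro v; ext x; exact Real.fourierInv_eq_fourier_neg v x
  have e2 := VectorFourier.integral_fourierIntegral_smul_eq_flip (L := innerₗ (Rd d))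
    Real.continuous_fourierChar continuous_inner hu hg.comp_neg
  rw [flip_innerₗ] at e2
  simp only [e1]
  rw [← integral_neg_eq_self]
  simp only [neg_neg, smul_eq_mul] at e2 ⊢
  rw [← integral_neg_eq_self (fun x => u (-x) * _)]
  simp only [neg_neg]
  have e3 : ∀ x, VectorFourier.fourierIntegral Real.fourierChar volume (innerₗ (Rd d)) g (-x) =
      VectorFourier.fourierIntegral Real.fourierChar volume (innerₗ (Rd d))
        (fun y => g (-y)) x := by
    intro x
    simp only [VectorFourier.fourierIntegral]
    rw [← integral_neg_eq_self]
    simp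
  simp only [e3]
  rw [← e2, ← integral_neg_eq_self]
  simp

lemma fourierInv_mul_smul {g : Rd d → ℂ} (v x : Rd d) :
    (𝓕⁻ g : Rd d → ℂ) (x - v) =
      (𝓕⁻ (fun ξ => Complex.exp (-(2 * Real.pi * inner ℝ ξ v : ℝ) * Complex.I) * g ξ) :
        Rd d → ℂ) x := by
  rw [Real.fourierInv_eq', Real.fourierInv_eq']
  congr 1; ext ξ
  rw [smul_eq_mul, smul_eq_mul, ← mul_assoc, ← Complex.exp_add]
  congr 2
  rw [inner_sub_right]
  push_cast; ring

lemma hasSpectrum_schwartz {p : ℝ≥0∞} (φ : 𝓢(Rd d, ℂ)) :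
    HasSpectrum (φ.toLp p volume : Lp ℂ p (volume : Measure (Rd d))) (𝓕 φ : 𝓢(Rd d, ℂ)) := by
  refine ⟨(𝓕 φ : 𝓢(Rd d, ℂ)).integrable, ?_⟩
  rw [← SchwartzMap.fourierInv_coe, FourierTransform.fourierInv_fourier_eq]
  exact φ.coeFn_toLp p volume

lemma HasSpectrum.congr_left {f f' g : Rd d → ℂ} (h : HasSpectrum f g) (hf : f' =ᵐ[volume] f) :
    HasSpectrum f' g := ⟨h.1, hf.trans h.2⟩

lemma HasSpectrum.congr_right {f g g' : Rd d → ℂ} (h : HasSpectrum f g) (hg : g' =ᵐ[volume] g) :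
    HasSpectrum f g' := by
  refine ⟨h.1.congr hg.symm, h.2.trans (Eventually.of_forall fun x => ?_)⟩
  exact (Real.fourierInv_congr_ae hg x).symm

lemma HasSpectrum.ae_eq {f f' g : Rd d → ℂ} (h : HasSpectrum f g) (h' : HasSpectrum f' g) :
    f =ᵐ[volume] f' := h.2.trans h'.2.symm

lemma HasSpectrum.add {f f' g g' : Rd d → ℂ} (h : HasSpectrum f g) (h' : HasSpectrum f' g') :
    HasSpectrum (f + f') (fun ξ => g ξ + g' ξ) := by
  refine ⟨h.1.add h'.1, ?_⟩
  filter_upwards [h.2, h'.2] with x hx hx'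
  rw [Pi.add_apply, hx, hx']
  simp only [Real.fourierInv_eq_fourier_neg]
  exact (congrFun (VectorFourier.fourierIntegral_add Real.continuous_fourierChar
    (L := innerₗ (Rd d)) continuous_inner h.1 h'.1) (-x)).symm

lemma HasSpectrum.neg {f g : Rd d → ℂ} (h : HasSpectrum f g) :
    HasSpectrum (-f) (fun ξ => - g ξ) := by
  refine ⟨h.1.neg, ?_⟩
  filter_upwards [h.2] with x hx
  rw [Pi.neg_apply, hx, Real.fourierInv_eq', Real.fourierInv_eq', ← integral_neg]
  simp only [smul_neg]

lemma HasSpectrum.sub {f f' g g' : Rd d → ℂ} (h : HasSpectrum f g) (h' : HasSpectrum f' g') :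
    HasSpectrum (f - f') (fun ξ => g ξ - g' ξ) := by
  simpa only [sub_eq_add_neg] using h.add h'.neg

/-- The spectrum of a product is the convolution of the spectra. -/
lemma HasSpectrum.mul {f f' g g' : Rd d → ℂ} (h : HasSpectrum f g) (h' : HasSpectrum f' g') :
    HasSpectrum (fun x => f x * f' x) (fun ξ => ∫ η, g η * g' (ξ - η)) := by
  refine ⟨h.1.integrable_convolution (ContinuousLinearMap.mul ℂ ℂ) h'.1, ?_⟩
  filter_upwards [h.2, h'.2] with x hx hx'
  rw [hx, hx', Real.fourierInv_eq_fourier_neg, Real.fourierInv_eq_fourier_neg,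
    Real.fourierInv_eq_fourier_neg, ← Real.fourier_mul_convolution_eq h.1 h'.1]
  rfl

lemma HasSpectrum.integral_schwartz_mul {f g : Rd d → ℂ} (h : HasSpectrum f g) (φ : 𝓢(Rd d, ℂ)) :
    ∫ x, φ x * f x = ∫ ξ, (𝓕⁻ φ : 𝓢(Rd d, ℂ)) ξ * g ξ := by
  rw [SchwartzMap.fourierInv_coe, ← integral_mul_fourierInv φ.integrable h.1]
  exact integral_congr_ae (by filter_upwards [h.2] with x hx; rw [hx])

/-- Locally integrable functions with the same integrals against Schwartz functions agree. -/
lemma ae_eq_of_integral_schwartz_mul_eq {f f' : Rd d → ℂ} (hf : LocallyIntegrable f)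
    (hf' : LocallyIntegrable f') (h : ∀ φ : 𝓢(Rd d, ℂ), ∫ x, φ x * f x = ∫ x, φ x * f' x) :
    f =ᵐ[volume] f' := by
  refine ae_eq_of_integral_contDiff_smul_eq hf hf' fun g hg hgc => ?_
  have hg₁ : HasCompactSupport (Complex.ofRealCLM ∘ g) := hgc.comp_left rfl
  have hg₂ : ContDiff ℝ ((⊤ : ℕ∞) : WithTop ℕ∞) (Complex.ofRealCLM ∘ g) := by fun_prop
  simpa using h (hg₁.toSchwartzMap hg₂)

lemma locallyIntegrable_coeFn_Lp {p : ℝ≥0∞} [hp : Fact (1 ≤ p)]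
    (f : Lp ℂ p (volume : Measure (Rd d))) : LocallyIntegrable f :=
  (Lp.memLp f).locallyIntegrable hp.out

/-- The spectrum of an element of `L^p` may be identified by testing against Schwartz functions. -/
lemma hasSpectrum_of_integral {p : ℝ≥0∞} [Fact (1 ≤ p)] {f : Lp ℂ p (volume : Measure (Rd d))}
    {g : Rd d → ℂ} (hg : Integrable g)
    (h : ∀ φ : 𝓢(Rd d, ℂ), ∫ x, φ x * f x = ∫ ξ, (𝓕⁻ φ : 𝓢(Rd d, ℂ)) ξ * g ξ) :
    HasSpectrum f g := by
  refine ⟨hg, ae_eq_of_integral_schwartz_mul_eq (locallyIntegrable_coeFn_Lp f)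
    (continuous_fourierInv hg).locallyIntegrable fun φ => ?_⟩
  rw [h φ, integral_mul_fourierInv φ.integrable hg, SchwartzMap.fourierInv_coe]

/-- Integration against a Schwartz function, as a functional on `L^p`. -/
def schwartzPairing (p : ℝ≥0∞) [Fact (1 ≤ p)] (φ : 𝓢(Rd d, ℂ)) :
    Lp ℂ p (volume : Measure (Rd d)) →L[ℂ] ℂ :=
  haveI := ENNReal.HolderConjugate.inv_one_sub_inv' (Fact.out : 1 ≤ p)
  haveI : Fact (1 ≤ (1 - p⁻¹)⁻¹) := ⟨by simp⟩
  ((ContinuousLinearMap.mul ℂ ℂ).lpPairing volume p (1 - p⁻¹)⁻¹).flip (φ.toLp (1 - p⁻¹)⁻¹)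

lemma schwartzPairing_apply {p : ℝ≥0∞} [Fact (1 ≤ p)] (φ : 𝓢(Rd d, ℂ))
    (f : Lp ℂ p (volume : Measure (Rd d))) : schwartzPairing p φ f = ∫ x, φ x * f x := by
  have := ENNReal.HolderConjugate.inv_one_sub_inv' (Fact.out : 1 ≤ p)
  have : Fact (1 ≤ (1 - p⁻¹)⁻¹) := ⟨by simp⟩
  rw [schwartzPairing, ContinuousLinearMap.flip_apply, ContinuousLinearMap.lpPairing_eq_integral]
  refine integral_congr_ae ?_
  filter_upwards [φ.coeFn_toLp (1 - p⁻¹)⁻¹ volume] with x hx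
  rw [hx]; simp [mul_comm]

lemma dense_schwartz {p : ℝ≥0∞} [Fact (1 ≤ p)] (hp : p ≠ ∞) :
    DenseRange (fun φ : 𝓢(Rd d, ℂ) => (φ.toLp p volume : Lp ℂ p (volume : Measure (Rd d)))) :=
  SchwartzMap.denseRange_toLpCLM hp

end Spectrum

section Multiplier

variable {d : ℕ} {p : ℝ≥0∞} [Fact (1 ≤ p)]
  {T T' : Lp ℂ p (volume : Measure (Rd d)) →L[ℂ] Lp ℂ p (volume : Measure (Rd d))}
  {m m' : Rd d → ℂ}

lemma IsMultiplier.ext (hp : p ≠ ∞) (h : IsMultiplier T m) (h' : IsMultiplier T' m) : T = T' := by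
  refine ContinuousLinearMap.ext fun f => congrFun
    ((dense_schwartz hp).equalizer T.continuous T'.continuous ?_) f
  ext1 φ
  exact Lp.ext ((h _ _ (hasSpectrum_schwartz φ)).ae_eq (h' _ _ (hasSpectrum_schwartz φ)))

lemma IsMultiplier.congr (h : IsMultiplier T m) (hm : m' =ᵐ[volume] m) : IsMultiplier T m' := by
  intro f g hfg
  exact (h f g hfg).congr_right (by filter_upwards [hm] with x hx; rw [hx])

lemma IsMultiplier.comp (h : IsMultiplier T m) (h' : IsMultiplier T' m') :
    IsMultiplier (T ∘L T') (fun ξ => m ξ * m' ξ) := by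
  intro f g hfg
  have := h _ _ (h' f g hfg)
  simp only [← mul_assoc] at this
  exact this

lemma isMultiplier_id : IsMultiplier (ContinuousLinearMap.id ℂ (Lp ℂ p (volume : Measure (Rd d))))
    (fun _ => 1) := by
  intro f g hfg
  simpa using hfg

lemma IsMultiplier.sub (h : IsMultiplier T m) (h' : IsMultiplier T' m') :
    IsMultiplier (T - T') (fun ξ => m ξ - m' ξ) := by
  intro f g hfg
  have := ((h f g hfg).sub (h' f g hfg)).congr_left (Lp.coeFn_sub (T f) (T' f))
  simp only [← sub_mul] at this
  exact this

/-- Operators with symbols commute. -/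
lemma IsMultiplier.comm (hp : p ≠ ∞) (h : IsMultiplier T m) (h' : IsMultiplier T' m')
    (f : Lp ℂ p (volume : Measure (Rd d))) : T (T' f) = T' (T f) := by
  have h1 := h.comp h'
  have h2 := (h'.comp h).congr (m' := fun ξ => m ξ * m' ξ) (by simp [mul_comm])
  exact congrArg (fun S => S f) (h1.ext hp h2)

/-- A strong limit of multipliers whose symbols converge boundedly is a multiplier. -/
lemma IsMultiplier.of_tendsto
    {Tn : ℕ → Lp ℂ p (volume : Measure (Rd d)) →L[ℂ] Lp ℂ p (volume : Measure (Rd d))}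
    {mn : ℕ → Rd d → ℂ} (h : ∀ n, IsMultiplier (Tn n) (mn n))
    (hT : ∀ f, Tendsto (fun n => Tn n f) atTop (𝓝 (T f))) {C : ℝ} (hC : ∀ n ξ, ‖mn n ξ‖ ≤ C)
    (hm : ∀ ξ, Tendsto (fun n => mn n ξ) atTop (𝓝 (m ξ))) :
    IsMultiplier T m := by
  intro f g hfg
  have hC' : ∀ ξ, ‖m ξ‖ ≤ C := fun ξ => le_of_tendsto' (hm ξ).norm (fun n => hC n ξ)
  have hint : ∀ n, Integrable (fun ξ => mn n ξ * g ξ) := fun n => (h n f g hfg).1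
  have hlim : ∀ ξ, Tendsto (fun n => mn n ξ * g ξ) atTop (𝓝 (m ξ * g ξ)) :=
    fun ξ => (hm ξ).mul_const _
  have hI : Integrable (fun ξ => m ξ * g ξ) := by
    refine (hfg.1.norm.const_mul C).mono'
      (aestronglyMeasurable_of_tendsto_ae atTop (fun n => (hint n).aestronglyMeasurable)
        (Eventually.of_forall hlim)) (Eventually.of_forall fun ξ => ?_)
    rw [norm_mul]; gcongr; exact hC' ξ
  refine hasSpectrum_of_integral hI fun φ => ?_
  rw [← schwartzPairing_apply]
  refine tendsto_nhds_unique (((schwartzPairing p φ).continuous.tendsto _).comp (hT f)) ?_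
  have : ∀ n, (⇑(schwartzPairing p φ) ∘ fun n => Tn n f) n
      = ∫ ξ, (𝓕⁻ φ : 𝓢(Rd d, ℂ)) ξ * (mn n ξ * g ξ) := by
    intro n
    rw [Function.comp_apply, schwartzPairing_apply, (h n f g hfg).integral_schwartz_mul]
  simp_rw [funext this]
  obtain ⟨M, hM⟩ : ∃ M, ∀ ξ, ‖(𝓕⁻ φ : 𝓢(Rd d, ℂ)) ξ‖ ≤ M :=
    ⟨_, fun ξ => SchwartzMap.norm_le_seminorm ℝ _ ξ⟩
  refine tendsto_integral_of_dominated_convergence (fun ξ => M * (C * ‖g ξ‖))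
    (fun n => ?_) ?_ (fun n => ?_) ?_
  · exact (𝓕⁻ φ : 𝓢(Rd d, ℂ)).continuous.aestronglyMeasurable.mul (hint n).aestronglyMeasurable
  · exact (hfg.1.norm.const_mul C).const_mul M
  · filter_upwards with ξ
    rw [norm_mul, norm_mul]
    gcongr
    · exact (norm_nonneg _).trans (hM 0)
    · exact hM ξ
    · exact hC n ξ
  · filter_upwards with ξ
    exact (hlim ξ).const_mul _

end Multiplier

/-! ### Averages of translations -/

section Average

variable {d : ℕ} {p : ℝ≥0∞} [Fact (1 ≤ p)] {S : Type*} [MeasurableSpace S] {ν : Measure S}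
  {k : S → ℂ} {τ : S → Rd d}

/-- The translation `f ↦ f(· - v)` on `L^p`. -/
def translateLp (p : ℝ≥0∞) [Fact (1 ≤ p)] (v : Rd d) :
    Lp ℂ p (volume : Measure (Rd d)) →L[ℂ] Lp ℂ p (volume : Measure (Rd d)) :=
  (Lp.compMeasurePreservingₗᵢ ℂ (fun x => x - v)
    (measurePreserving_sub_right volume v)).toContinuousLinearMap

lemma norm_translateLp (v : Rd d) (f : Lp ℂ p (volume : Measure (Rd d))) :
    ‖translateLp p v f‖ = ‖f‖ :=
  (Lp.compMeasurePreservingₗᵢ ℂ (fun x => x - v)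
    (measurePreserving_sub_right volume v)).norm_map f

lemma translateLp_ae (v : Rd d) (f : Lp ℂ p (volume : Measure (Rd d))) :
    translateLp p v f =ᵐ[volume] fun x => f (x - v) :=
  Lp.coeFn_compMeasurePreserving f (measurePreserving_sub_right volume v)

lemma translateLp_zero (f : Lp ℂ p (volume : Measure (Rd d))) : translateLp p 0 f = f := by
  refine Lp.ext ((translateLp_ae 0 f).trans ?_)
  simp

lemma continuous_translateLp (hp : p ≠ ∞) (f : Lp ℂ p (volume : Measure (Rd d))) :
    Continuous fun v => translateLp p v f := by
  let g : C(Rd d, C(Rd d, Rd d)) :=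
    (ContinuousMap.mk (fun a : Rd d × Rd d => a.2 - a.1) (by fun_prop)).curry
  exact (continuous_const (y := f)).compMeasurePreservingLp g.continuous
    (fun v => measurePreserving_sub_right volume v) hp

lemma integrable_smul_translateLp (hp : p ≠ ∞) (hk : Integrable k ν) (hτ : Measurable τ)
    (f : Lp ℂ p (volume : Measure (Rd d))) :
    Integrable (fun s => k s • translateLp p (τ s) f) ν :=
  hk.smul_bdd ‖f‖ ((continuous_translateLp hp f).stronglyMeasurable.comp_measurable
    hτ).aestronglyMeasurable (Eventually.of_forall fun _ => (norm_translateLp _ f).le)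

/-- The average of translations `f ↦ ∫ k(s) f(· - τ(s)) dν(s)` on `L^p`. -/
def translationAverage (hp : p ≠ ∞) (hk : Integrable k ν) (hτ : Measurable τ) :
    Lp ℂ p (volume : Measure (Rd d)) →L[ℂ] Lp ℂ p (volume : Measure (Rd d)) :=
  LinearMap.mkContinuous
    { toFun := fun f => ∫ s, k s • translateLp p (τ s) f ∂ν
      map_add' := fun f g => by
        simp only [map_add, smul_add]
        exact integral_add (integrable_smul_translateLp hp hk hτ f)
          (integrable_smul_translateLp hp hk hτ g)
      map_smul' := fun c f => by
        simp only [map_smul, RingHom.id_apply]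
        rw [← integral_smul]
        simp only [smul_comm c] }
    (∫ s, ‖k s‖ ∂ν) fun f => by
      refine (norm_integral_le_integral_norm _).trans_eq ?_
      simp only [norm_smul, norm_translateLp, integral_mul_const]

lemma translationAverage_apply (hp : p ≠ ∞) (hk : Integrable k ν) (hτ : Measurable τ)
    (f : Lp ℂ p (volume : Measure (Rd d))) :
    translationAverage hp hk hτ f = ∫ s, k s • translateLp p (τ s) f ∂ν := rfl

lemma norm_translationAverage_le (hp : p ≠ ∞) (hk : Integrable k ν) (hτ : Measurable τ)
    (f : Lp ℂ p (volume : Measure (Rd d))) :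
    ‖translationAverage hp hk hτ f‖ ≤ (∫ s, ‖k s‖ ∂ν) * ‖f‖ := by
  refine (norm_integral_le_integral_norm _).trans_eq ?_
  simp only [norm_smul, norm_translateLp, integral_mul_const]

lemma integral_schwartz_mul_translationAverage (hp : p ≠ ∞) (hk : Integrable k ν)
    (hτ : Measurable τ) (f : Lp ℂ p (volume : Measure (Rd d))) (φ : 𝓢(Rd d, ℂ)) :
    ∫ x, φ x * translationAverage hp hk hτ f x
      = ∫ s, k s * (∫ x, φ x * f (x - τ s)) ∂ν := by
  rw [← schwartzPairing_apply, translationAverage_apply,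
    ← ContinuousLinearMap.integral_comp_comm _ (integrable_smul_translateLp hp hk hτ f)]
  congr 1; ext s
  rw [map_smul, schwartzPairing_apply, smul_eq_mul]
  congr 1
  refine integral_congr_ae ?_
  filter_upwards [translateLp_ae (τ s) f] with x hx
  rw [hx]

/-- The average of translations with weight `k` has symbol `∫ k(s) e^{-2πi ξ·τ(s)} dν(s)`. -/
lemma isMultiplier_translationAverage [SFinite ν] (hp : p ≠ ∞) (hk : Integrable k ν)
    (hτ : Measurable τ) :
    IsMultiplier (translationAverage hp hk hτ)
      (fun ξ => ∫ s, k s * Complex.exp (-(2 * Real.pi * inner ℝ ξ (τ s) : ℝ) * Complex.I) ∂ν) := by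
  intro f g hfg
  have hbd : ∀ z : Rd d × S,
      ‖Complex.exp (-(2 * Real.pi * inner ℝ z.1 (τ z.2) : ℝ) * Complex.I)‖ ≤ 1 := fun z => by
    rw [← Complex.ofReal_neg, Complex.norm_exp_ofReal_mul_I]
  have hme : Measurable fun z : Rd d × S =>
      Complex.exp (-(2 * Real.pi * inner ℝ z.1 (τ z.2) : ℝ) * Complex.I) := by
    have : Measurable fun z : Rd d × S => inner ℝ z.1 (τ z.2) :=
      measurable_fst.inner (hτ.comp measurable_snd)
    fun_prop
  have hprod : Integrable (fun z : Rd d × S => (g z.1 * k z.2) *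
      Complex.exp (-(2 * Real.pi * inner ℝ z.1 (τ z.2) : ℝ) * Complex.I)) (volume.prod ν) :=
    (hfg.1.mul_prod hk).mul_bdd hme.aestronglyMeasurable (Eventually.of_forall hbd)
  have hI : Integrable (fun ξ => (∫ s, k s *
      Complex.exp (-(2 * Real.pi * inner ℝ ξ (τ s) : ℝ) * Complex.I) ∂ν) * g ξ) := by
    refine hprod.integral_prod_left.congr (Eventually.of_forall fun ξ => ?_)
    simp only [mul_assoc]
    rw [integral_const_mul, mul_comm]
  refine hasSpectrum_of_integral hI fun φ => ?_
  rw [integral_schwartz_mul_translationAverage]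
  obtain ⟨M, hM⟩ : ∃ M, ∀ ξ, ‖(𝓕⁻ φ : 𝓢(Rd d, ℂ)) ξ‖ ≤ M :=
    ⟨_, fun ξ => SchwartzMap.norm_le_seminorm ℝ _ ξ⟩
  have hprod' : Integrable (fun z : Rd d × S => (𝓕⁻ φ : 𝓢(Rd d, ℂ)) z.1 * ((g z.1 * k z.2) *
      Complex.exp (-(2 * Real.pi * inner ℝ z.1 (τ z.2) : ℝ) * Complex.I))) (volume.prod ν) :=
    hprod.bdd_mul
      ((𝓕⁻ φ : 𝓢(Rd d, ℂ)).continuous.measurable.comp measurable_fst).aestronglyMeasurable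
      (Eventually.of_forall fun z => hM z.1)
  calc ∫ s, k s * (∫ x, φ x * f (x - τ s)) ∂ν
      = ∫ s, (∫ ξ, (𝓕⁻ φ : 𝓢(Rd d, ℂ)) ξ * ((g ξ * k s) *
          Complex.exp (-(2 * Real.pi * inner ℝ ξ (τ s) : ℝ) * Complex.I))) ∂ν := by
        congr 1; ext s
        have h1 : HasSpectrum (fun x => f (x - τ s)) (fun ξ =>
            Complex.exp (-(2 * Real.pi * inner ℝ ξ (τ s) : ℝ) * Complex.I) * g ξ) := by
          refine ⟨hfg.1.bdd_mul
            (hme.comp (measurable_id.prodMk measurable_const)).aestronglyMeasurable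
            (Eventually.of_forall fun ξ => hbd (ξ, s)), ?_⟩
          have := (measurePreserving_sub_right volume (τ s)).quasiMeasurePreserving.ae_eq_comp hfg.2
          filter_upwards [this] with x hx
          rw [← fourierInv_mul_smul]
          exact hx
        rw [h1.integral_schwartz_mul, ← integral_const_mul]
        congr 1; ext ξ; ring
    _ = ∫ ξ, ∫ s, (𝓕⁻ φ : 𝓢(Rd d, ℂ)) ξ * ((g ξ * k s) *
          Complex.exp (-(2 * Real.pi * inner ℝ ξ (τ s) : ℝ) * Complex.I)) ∂ν :=
        (integral_integral_swap hprod').symm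
    _ = _ := by
        congr 1; ext ξ
        simp only [mul_assoc]
        rw [integral_const_mul, integral_const_mul]
        ring

/-- On bounded functions the average of translations is given by the pointwise integral. -/
lemma translationAverage_ae [SFinite ν] (hp : p ≠ ∞) (hk : Integrable k ν) (hτ : Measurable τ)
    {f : Rd d → ℂ} (hf : MemLp f p) (hfm : Measurable f) {M : ℝ} (hM : ∀ x, ‖f x‖ ≤ M) :
    translationAverage hp hk hτ (hf.toLp f) =ᵐ[volume] fun x => ∫ s, k s * f (x - τ s) ∂ν := by
  have hme : Measurable fun z : Rd d × S => f (z.1 - τ z.2) :=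
    hfm.comp (measurable_fst.sub (hτ.comp measurable_snd))
  have hbd : ∀ x, ‖∫ s, k s * f (x - τ s) ∂ν‖ ≤ (∫ s, ‖k s‖ ∂ν) * M := fun x => by
    refine (norm_integral_le_of_norm_le (hk.norm.mul_const M)
      (Eventually.of_forall fun s => ?_)).trans_eq (integral_mul_const _ _)
    rw [norm_mul]; gcongr; exact hM _
  have hsm : AEStronglyMeasurable (fun x => ∫ s, k s * f (x - τ s) ∂ν) volume :=
    AEStronglyMeasurable.integral_prod_right' (f := fun z : Rd d × S => k z.2 * f (z.1 - τ z.2))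
      (hk.aestronglyMeasurable.comp_snd.mul hme.aestronglyMeasurable)
  refine ae_eq_of_integral_schwartz_mul_eq (locallyIntegrable_coeFn_Lp _) ?_ fun φ => ?_
  · exact (memLp_top_of_bound hsm _ (Eventually.of_forall hbd)).locallyIntegrable le_top
  rw [integral_schwartz_mul_translationAverage]
  have hprod : Integrable (fun z : Rd d × S => (φ z.1 * k z.2) * f (z.1 - τ z.2))
      (volume.prod ν) :=
    (φ.integrable.mul_prod hk).mul_bdd hme.aestronglyMeasurable
      (Eventually.of_forall fun z => hM _)
  calc ∫ s, k s * (∫ x, φ x * (hf.toLp f) (x - τ s)) ∂ν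
      = ∫ s, (∫ x, (φ x * k s) * f (x - τ s)) ∂ν := by
        congr 1; ext s
        rw [← integral_const_mul]
        refine integral_congr_ae ?_
        have := (measurePreserving_sub_right volume (τ s)).quasiMeasurePreserving.ae_eq_comp
          hf.coeFn_toLp
        filter_upwards [this] with x hx
        have hx' : (hf.toLp f) (x - τ s) = f (x - τ s) := hx
        rw [hx']; ring
    _ = ∫ x, ∫ s, (φ x * k s) * f (x - τ s) ∂ν := (integral_integral_swap hprod).symm
    _ = _ := by
        congr 1; ext x
        simp only [mul_assoc]
        rw [integral_const_mul]

end Average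

/-! ### Transposition -/

section Transpose

variable {d : ℕ} {p q : ℝ≥0∞} [Fact (1 ≤ p)] [Fact (1 ≤ q)] [ENNReal.HolderConjugate p q]
  {T : Lp ℂ p (volume : Measure (Rd d)) →L[ℂ] Lp ℂ p (volume : Measure (Rd d))}
  {m : Rd d → ℂ}

lemma integral_mul_eq_lpPairing (f : Lp ℂ p (volume : Measure (Rd d)))
    (h : Lp ℂ q (volume : Measure (Rd d))) :
    ∫ x, f x * h x = (ContinuousLinearMap.mul ℂ ℂ).lpPairing volume p q f h := by
  rw [ContinuousLinearMap.lpPairing_eq_integral]; rfl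

/-- The transpose of a multiplier acts on a Schwartz function `φ` by multiplication of `𝓕⁻ φ`. -/
lemma IsMultiplier.integral_mul_schwartz (hp : p ≠ ∞) (hT : IsMultiplier T m) (φ : 𝓢(Rd d, ℂ))
    (hφ : Integrable fun ξ => m ξ * (𝓕⁻ φ : 𝓢(Rd d, ℂ)) ξ)
    (h : Lp ℂ q (volume : Measure (Rd d)))
    (hh : h =ᵐ[volume] (𝓕 fun ξ => m ξ * (𝓕⁻ φ : 𝓢(Rd d, ℂ)) ξ : Rd d → ℂ))
    (v : Lp ℂ p (volume : Measure (Rd d))) :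
    ∫ x, φ x * T v x = ∫ x, v x * h x := by
  rw [integral_mul_eq_lpPairing, ← schwartzPairing_apply]
  have := (dense_schwartz (d := d) hp).equalizer
    ((schwartzPairing p φ).continuous.comp T.continuous)
    (((ContinuousLinearMap.mul ℂ ℂ).lpPairing volume p q).flip h).continuous ?_
  · exact congrFun this v
  ext1 ψ
  simp only [Function.comp_apply, ContinuousLinearMap.flip_apply]
  rw [schwartzPairing_apply, ← integral_mul_eq_lpPairing,
    (hT _ _ (hasSpectrum_schwartz ψ)).integral_schwartz_mul]
  have h1 : ∫ x, (ψ.toLp p volume : Lp ℂ p (volume : Measure (Rd d))) x * h x =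
      ∫ x, ψ x * (𝓕 fun ξ => m ξ * (𝓕⁻ φ : 𝓢(Rd d, ℂ)) ξ : Rd d → ℂ) x := by
    refine integral_congr_ae ?_
    filter_upwards [hh, ψ.coeFn_toLp p (volume : Measure (Rd d))] with x hx hx'
    rw [hx, hx']
  have h2 := VectorFourier.integral_fourierIntegral_smul_eq_flip (L := innerₗ (Rd d))
    Real.continuous_fourierChar continuous_inner (ψ.integrable (μ := volume)) hφ
  rw [flip_innerₗ] at h2
  rw [h1]
  refine Eq.trans ?_ h2
  congr 1; ext ξ
  change _ = (𝓕 (ψ : Rd d → ℂ)) ξ * _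
  rw [← SchwartzMap.fourier_coe]
  ring

/-- The transpose of an operator with symbol `m` has symbol `m(-·)`. -/
lemma IsMultiplier.integral_mul_transpose (hp : p ≠ ∞) (hq : q ≠ ∞) (hT : IsMultiplier T m)
    {T' : Lp ℂ q (volume : Measure (Rd d)) →L[ℂ] Lp ℂ q (volume : Measure (Rd d))}
    (hT' : IsMultiplier T' fun ξ => m (-ξ))
    (v : Lp ℂ p (volume : Measure (Rd d))) (h : Lp ℂ q (volume : Measure (Rd d))) :
    ∫ x, h x * T v x = ∫ x, v x * T' h x := by
  have : ENNReal.HolderConjugate q p := ENNReal.HolderConjugate.symm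
  rw [integral_mul_eq_lpPairing, integral_mul_eq_lpPairing]
  have := (dense_schwartz (d := d) hq).equalizer
    (((ContinuousLinearMap.mul ℂ ℂ).lpPairing volume q p).flip (T v)).continuous
    ((((ContinuousLinearMap.mul ℂ ℂ).lpPairing volume p q) v).continuous.comp T'.continuous) ?_
  · exact congrFun this h
  ext1 φ
  simp only [Function.comp_apply, ContinuousLinearMap.flip_apply]
  rw [← integral_mul_eq_lpPairing, ← integral_mul_eq_lpPairing]
  have h3 := hT' _ _ (hasSpectrum_schwartz φ)
  have e1 : (fun ξ => m ξ * (𝓕⁻ φ : 𝓢(Rd d, ℂ)) ξ) =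
      fun ξ => m (-(-ξ)) * (𝓕 φ : 𝓢(Rd d, ℂ)) (-ξ) := by
    ext ξ; rw [neg_neg, SchwartzMap.fourierInv_coe, Real.fourierInv_eq_fourier_neg]; rfl
  rw [← hT.integral_mul_schwartz hp φ (by rw [e1]; exact h3.1.comp_neg) _ ?_ v]
  · refine integral_congr_ae ?_
    filter_upwards [φ.coeFn_toLp q (volume : Measure (Rd d))] with x hx
    rw [hx]
  · rw [e1]
    filter_upwards [h3.2] with x hx
    rw [hx, Real.fourierInv_eq_fourier_comp_neg]

end Transpose

/-! ### The Cauchy and Poisson kernels -/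

section Kernels

/-- The Cauchy kernel `1 / (2π (y - i s))`, with Fourier transform `1_{ξ > 0} e^{-2π y ξ}`. -/
def cauchyKernel (y s : ℝ) : ℂ := (2 * Real.pi * (y - s * Complex.I))⁻¹

/-- The integrable kernel obtained by removing the low frequencies of the Cauchy kernel. -/
def rieszKernel (y Y s : ℝ) : ℂ := cauchyKernel y s - cauchyKernel Y s

/-- The symbol of `rieszKernel`. -/
def rieszSymbol (y Y ξ : ℝ) : ℂ :=
  if 0 < ξ then Complex.exp (-(2 * Real.pi * y * ξ)) - Complex.exp (-(2 * Real.pi * Y * ξ)) else 0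

/-- The Poisson kernel of the half plane at height `1`. -/
def linePoissonKernel (s : ℝ) : ℂ := (((Real.pi * (1 + s ^ 2))⁻¹ : ℝ) : ℂ)

variable {y Y : ℝ}

lemma cauchyKernel_den_ne (hy : 0 < y) (s : ℝ) : ((y : ℂ) - s * Complex.I) ≠ 0 := by
  intro h
  have := congrArg Complex.re h
  simp at this
  exact hy.ne' this

lemma integrableOn_cexp_mul (hy : 0 < y) (x : ℝ) :
    IntegrableOn (fun ξ : ℝ => Complex.exp ((-(2 * Real.pi * (y - x * Complex.I))) * ξ))
      (Set.Ioi 0) := by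
  refine integrableOn_exp_mul_complex_Ioi ?_ 0
  have := Real.pi_pos
  simp; positivity

lemma setIntegral_Ioi_cexp_mul (hy : 0 < y) (x : ℝ) :
    ∫ ξ in Set.Ioi (0 : ℝ), Complex.exp ((-(2 * Real.pi * (y - x * Complex.I))) * ξ) =
      cauchyKernel y x := by
  rw [integral_exp_mul_complex_Ioi]
  · rw [cauchyKernel]
    simp [neg_div_neg_eq]
  · have := Real.pi_pos
    simp; positivity

lemma continuous_cauchyKernel (hy : 0 < y) : Continuous (cauchyKernel y) := by
  refine Continuous.inv₀ (by fun_prop) fun s => ?_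
  exact mul_ne_zero (mul_ne_zero two_ne_zero (by exact_mod_cast Real.pi_pos.ne'))
    (cauchyKernel_den_ne hy s)

lemma two_mul_re_cauchyKernel (y s : ℝ) :
    2 * (cauchyKernel y s).re = y / (Real.pi * (y ^ 2 + s ^ 2)) := by
  have h : ((2 * Real.pi * (y - s * Complex.I) : ℂ)).re = 2 * Real.pi * y := by simp
  have h' : Complex.normSq (2 * Real.pi * (y - s * Complex.I) : ℂ) =
      (2 * Real.pi) ^ 2 * (y ^ 2 + s ^ 2) := by
    simp [Complex.normSq_apply]; ring
  rw [cauchyKernel, Complex.inv_re, h, h']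
  have := Real.pi_pos.ne'
  by_cases hs : y ^ 2 + s ^ 2 = 0
  · simp [hs]
  · field_simp

lemma rieszKernel_eq (hy : 0 < y) (hY : 0 < Y) (s : ℝ) :
    rieszKernel y Y s =
      (Y - y) / (2 * Real.pi) * ((y - s * Complex.I) * (Y - s * Complex.I))⁻¹ := by
  have h1 := cauchyKernel_den_ne hy s
  have h2 := cauchyKernel_den_ne hY s
  have h3 : (Real.pi : ℂ) ≠ 0 := by exact_mod_cast Real.pi_pos.ne'
  rw [rieszKernel, cauchyKernel, cauchyKernel]
  field_simp
  ring

lemma integrable_inv_sq_add_sq (hy : 0 < y) : Integrable fun s : ℝ => (y ^ 2 + s ^ 2)⁻¹ := by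
  refine (integrable_inv_one_add_sq.const_mul (1 + (y ^ 2)⁻¹)).mono'
    (by fun_prop) (Eventually.of_forall fun s => ?_)
  rw [Real.norm_of_nonneg (by positivity), ← div_eq_mul_inv, le_div_iff₀ (by positivity),
    ← div_eq_inv_mul, div_le_iff₀ (by positivity)]
  have : (y ^ 2)⁻¹ * y ^ 2 = 1 := inv_mul_cancel₀ (by positivity)
  have : 0 ≤ (y ^ 2)⁻¹ * s ^ 2 := by positivity
  nlinarith [sq_nonneg y]

lemma norm_sub_mul_I (y s : ℝ) : ‖(y : ℂ) - s * Complex.I‖ = √(y ^ 2 + s ^ 2) := by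
  rw [Complex.norm_def, Complex.normSq_apply]; simp; ring_nf

lemma integrable_rieszKernel (hy : 0 < y) (hyY : y ≤ Y) : Integrable (rieszKernel y Y) := by
  have hY := hy.trans_le hyY
  refine ((integrable_inv_sq_add_sq hy).const_mul ((Y - y) / (2 * Real.pi))).mono'
    ((continuous_cauchyKernel hy).sub (continuous_cauchyKernel hY)).aestronglyMeasurable
    (Eventually.of_forall fun s => ?_)
  have hpi := Real.pi_pos
  rw [rieszKernel_eq hy hY, norm_mul, norm_inv, norm_mul, norm_sub_mul_I, norm_sub_mul_I]
  have h1 : ‖((Y : ℂ) - y) / (2 * Real.pi)‖ = (Y - y) / (2 * Real.pi) := by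
    rw [norm_div, ← Complex.ofReal_sub, Complex.norm_real, Real.norm_of_nonneg (by linarith)]
    simp [abs_of_pos hpi]
  rw [h1]
  refine mul_le_mul_of_nonneg_left (inv_anti₀ (by positivity) ?_)
    (div_nonneg (by linarith) (by positivity))
  · calc y ^ 2 + s ^ 2 = √(y ^ 2 + s ^ 2) * √(y ^ 2 + s ^ 2) :=
          (Real.mul_self_sqrt (by positivity)).symm
      _ ≤ _ := by gcongr

lemma integrable_linePoissonKernel : Integrable linePoissonKernel := by
  refine Integrable.ofReal ?_
  refine (integrable_inv_one_add_sq.const_mul Real.pi⁻¹).congr (Eventually.of_forall fun s => ?_)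
  exact (mul_inv _ _).symm

lemma linePoissonKernel_nonneg (s : ℝ) : 0 ≤ (Real.pi * (1 + s ^ 2))⁻¹ := by
  have := Real.pi_pos; positivity

lemma integral_norm_linePoissonKernel : ∫ s, ‖linePoissonKernel s‖ = 1 := by
  have : ∀ s, ‖linePoissonKernel s‖ = Real.pi⁻¹ * (1 + s ^ 2)⁻¹ := fun s => by
    rw [linePoissonKernel, Complex.norm_real, Real.norm_of_nonneg (linePoissonKernel_nonneg s),
      mul_inv]
  simp_rw [this]
  rw [integral_const_mul, integral_univ_inv_one_add_sq, inv_mul_cancel₀ Real.pi_pos.ne']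

lemma integral_linePoissonKernel : ∫ s, linePoissonKernel s = 1 := by
  simp only [linePoissonKernel]
  rw [integral_complex_ofReal]
  simp_rw [mul_inv]
  rw [integral_const_mul, integral_univ_inv_one_add_sq, inv_mul_cancel₀ Real.pi_pos.ne']
  simp

lemma linePoissonKernel_eq (s : ℝ) :
    linePoissonKernel s = cauchyKernel 1 s + cauchyKernel 1 (-s) := by
  have h1 := cauchyKernel_den_ne one_pos s
  have h2 := cauchyKernel_den_ne one_pos (-s)
  have h3 : (Real.pi : ℂ) ≠ 0 := by exact_mod_cast Real.pi_pos.ne'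
  have h4 : (1 + (s : ℂ) ^ 2) ≠ 0 := by
    have : (1 + s ^ 2 : ℝ) ≠ 0 := by positivity
    exact_mod_cast this
  have hI : (1 + (s : ℂ) ^ 2) = ((1 : ℝ) - s * Complex.I) * ((1 : ℝ) - (-s : ℝ) * Complex.I) := by
    push_cast; ring_nf; simp
  rw [linePoissonKernel, cauchyKernel, cauchyKernel]
  push_cast
  rw [hI]
  push_cast at h1 h2 ⊢
  rw [neg_mul, sub_neg_eq_add] at h2 ⊢
  field_simp
  ring

lemma rieszSymbol_eq_indicator (y Y : ℝ) : rieszSymbol y Y = (Set.Ioi (0 : ℝ)).indicator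
    fun ξ => Complex.exp (-(2 * Real.pi * y * ξ)) - Complex.exp (-(2 * Real.pi * Y * ξ)) := by
  ext ξ
  by_cases h : 0 < ξ <;> simp [rieszSymbol, h]

lemma continuous_rieszSymbol : Continuous (rieszSymbol y Y) := by
  unfold rieszSymbol
  refine Continuous.if (fun ξ hξ => ?_) (by fun_prop) continuous_const
  have : ξ = 0 := by
    have : ξ ∈ frontier (Set.Ioi (0 : ℝ)) := hξ
    simpa using this
  simp [this]

lemma integrable_rieszSymbol (hy : 0 < y) (hY : 0 < Y) : Integrable (rieszSymbol y Y) := by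
  rw [rieszSymbol_eq_indicator, integrable_indicator_iff measurableSet_Ioi]
  refine ((integrableOn_cexp_mul hy 0).sub (integrableOn_cexp_mul hY 0)).congr_fun ?_
    measurableSet_Ioi
  intro ξ _
  simp

lemma fourierInv_rieszSymbol (hy : 0 < y) (hY : 0 < Y) :
    (𝓕⁻ (rieszSymbol y Y) : ℝ → ℂ) = rieszKernel y Y := by
  ext x
  rw [Real.fourierInv_eq', rieszKernel, ← setIntegral_Ioi_cexp_mul hy,
    ← setIntegral_Ioi_cexp_mul hY,
    ← integral_sub (integrableOn_cexp_mul hy x) (integrableOn_cexp_mul hY x),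
    ← integral_indicator measurableSet_Ioi]
  congr 1; ext ξ
  by_cases h : ξ ∈ Set.Ioi (0 : ℝ)
  · have h' : 0 < ξ := h
    simp only [rieszSymbol, h', if_true, Set.indicator_of_mem h, smul_eq_mul, mul_sub,
      ← Complex.exp_add]
    congr 2 <;> simp <;> ring
  · have h' : ¬ 0 < ξ := h
    simp [rieszSymbol, h']

lemma integral_rieszKernel_mul_exp (hy : 0 < y) (hyY : y ≤ Y) (w : ℝ) :
    ∫ s, rieszKernel y Y s * Complex.exp (-(2 * Real.pi * (s * w) : ℝ) * Complex.I) =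
      rieszSymbol y Y w := by
  have hY := hy.trans_le hyY
  have h := continuous_rieszSymbol.fourier_fourierInv_eq (integrable_rieszSymbol hy hY) (by
    have : (𝓕 (rieszSymbol y Y) : ℝ → ℂ) = fun x => rieszKernel y Y (-x) := by
      rw [← fourierInv_rieszSymbol hy hY]
      ext x
      rw [Real.fourierInv_eq_fourier_neg, neg_neg]
    rw [this]
    exact (integrable_rieszKernel hy hyY).comp_neg)
  rw [fourierInv_rieszSymbol hy hY] at h
  rw [← h, Real.fourier_real_eq_integral_exp_smul]
  congr 1; ext s
  rw [smul_eq_mul, mul_comm]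
  congr 2
  push_cast; ring

lemma integrable_exp_neg_abs : Integrable fun ξ : ℝ => Complex.exp (-(2 * Real.pi * |ξ| : ℝ)) := by
  have h : IntegrableOn (fun ξ : ℝ => Complex.exp (-(2 * Real.pi * |ξ| : ℝ))) (Set.Ioi 0) := by
    refine (integrableOn_cexp_mul one_pos 0).congr_fun (fun ξ hξ => ?_) measurableSet_Ioi
    have : |ξ| = ξ := abs_of_pos hξ
    simp [this]
  rw [← integrableOn_univ, ← Set.Iic_union_Ioi (a := (0 : ℝ)), integrableOn_union]
  refine ⟨?_, h⟩
  rw [integrableOn_Iic_iff_integrableOn_Iio]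
  have := h.comp_neg
  simpa using this

lemma fourierInv_exp_neg_abs :
    (𝓕⁻ (fun ξ : ℝ => Complex.exp (-(2 * Real.pi * |ξ| : ℝ))) : ℝ → ℂ) = linePoissonKernel := by
  ext x
  rw [Real.fourierInv_eq', linePoissonKernel_eq, ← setIntegral_Ioi_cexp_mul one_pos,
    ← setIntegral_Ioi_cexp_mul one_pos]
  have hI : Integrable (fun v : ℝ => Complex.exp (↑(2 * Real.pi * inner ℝ v x) * Complex.I) *
      Complex.exp (-(2 * Real.pi * |v| : ℝ))) :=
    integrable_exp_neg_abs.bdd_mul (c := 1)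
      (Continuous.aestronglyMeasurable (by fun_prop)) (Eventually.of_forall fun v => by
        rw [Complex.norm_exp_ofReal_mul_I])
  simp only [smul_eq_mul]
  rw [← intervalIntegral.integral_Iic_add_Ioi hI.integrableOn hI.integrableOn (b := 0), add_comm]
  congr 1
  · refine setIntegral_congr_fun measurableSet_Ioi fun ξ hξ => ?_
    have : |ξ| = ξ := abs_of_pos hξ
    simp only [this, ← Complex.exp_add]
    congr 1; simp; ring
  · rw [← neg_zero, ← integral_comp_neg_Ioi, neg_zero]
    refine setIntegral_congr_fun measurableSet_Ioi fun ξ hξ => ?_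
    have : |ξ| = ξ := abs_of_pos hξ
    simp only [abs_neg, this, ← Complex.exp_add]
    congr 1; simp; ring

lemma integral_linePoissonKernel_mul_exp (w : ℝ) :
    ∫ s, linePoissonKernel s * Complex.exp (-(2 * Real.pi * (s * w) : ℝ) * Complex.I) =
      Complex.exp (-(2 * Real.pi * |w| : ℝ)) := by
  have h := Continuous.fourier_fourierInv_eq
    (f := fun ξ : ℝ => Complex.exp (-(2 * Real.pi * |ξ| : ℝ))) (by fun_prop)
    integrable_exp_neg_abs (by
    have : (𝓕 (fun ξ : ℝ => Complex.exp (-(2 * Real.pi * |ξ| : ℝ))) : ℝ → ℂ) =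
        fun x => linePoissonKernel (-x) := by
      rw [← fourierInv_exp_neg_abs]
      ext x
      rw [Real.fourierInv_eq_fourier_neg, neg_neg]
    rw [this]
    exact integrable_linePoissonKernel.comp_neg)
  rw [fourierInv_exp_neg_abs] at h
  rw [← congrFun h w, Real.fourier_real_eq_integral_exp_smul]
  congr 1; ext s
  rw [smul_eq_mul, mul_comm]
  congr 2
  push_cast; ring

end Kernels

/-! ### The Poisson semigroup in one direction -/

section PoissonAverage

variable {d : ℕ} {p : ℝ≥0∞} [Fact (1 ≤ p)]

/-- The Poisson average `e^{-a |e·D|}` in the direction `e`. -/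
def poissonAverage (hp : p ≠ ∞) (e : Rd d) (a : ℝ) :
    Lp ℂ p (volume : Measure (Rd d)) →L[ℂ] Lp ℂ p (volume : Measure (Rd d)) :=
  translationAverage hp (integrable_linePoissonKernel)
    (by fun_prop : Measurable fun t : ℝ => (a * t) • e)

lemma norm_poissonAverage_le (hp : p ≠ ∞) (e : Rd d) (a : ℝ)
    (f : Lp ℂ p (volume : Measure (Rd d))) : ‖poissonAverage hp e a f‖ ≤ ‖f‖ := by
  have h := norm_translationAverage_le hp integrable_linePoissonKernel
    (by fun_prop : Measurable fun t : ℝ => (a * t) • e) f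
  rwa [integral_norm_linePoissonKernel, one_mul] at h

lemma isMultiplier_poissonAverage (hp : p ≠ ∞) (e : Rd d) {a : ℝ} (ha : 0 ≤ a) :
    IsMultiplier (poissonAverage hp e a)
      (fun ξ => Complex.exp (-(2 * Real.pi * a * |inner ℝ ξ e| : ℝ))) := by
  have h := isMultiplier_translationAverage hp integrable_linePoissonKernel
    (by fun_prop : Measurable fun t : ℝ => (a * t) • e)
  refine h.congr (Eventually.of_forall fun ξ => ?_)
  have h2 := integral_linePoissonKernel_mul_exp (a * inner ℝ ξ e)
  rw [abs_mul, abs_of_nonneg ha] at h2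
  simp only [inner_smul_right]
  rw [mul_assoc (2 * Real.pi), ← h2]
  congr 1; ext s
  congr 4; push_cast; ring

lemma tendsto_poissonAverage_zero (hp : p ≠ ∞) (e : Rd d) (f : Lp ℂ p (volume : Measure (Rd d)))
    {a : ℕ → ℝ} (ha : Tendsto a atTop (𝓝 0)) :
    Tendsto (fun n => poissonAverage hp e (a n) f) atTop (𝓝 f) := by
  have h0 : f = ∫ t, linePoissonKernel t • f := by
    rw [integral_smul_const, integral_linePoissonKernel, one_smul]
  nth_rw 2 [h0]
  simp only [poissonAverage, translationAverage_apply]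
  refine tendsto_integral_of_dominated_convergence (fun t => ‖linePoissonKernel t‖ * ‖f‖)
    (fun n => ?_)
    (integrable_linePoissonKernel.norm.mul_const _) (fun n => ?_) ?_
  · exact (integrable_smul_translateLp hp integrable_linePoissonKernel
      (by fun_prop) f).aestronglyMeasurable
  · filter_upwards with t
    rw [norm_smul, norm_translateLp]
  · filter_upwards with t
    have h1 : Tendsto (fun n => (a n * t) • e) atTop (𝓝 0) := by
      simpa using ((ha.mul_const t).smul_const e)
    have h2 := ((continuous_translateLp hp f).tendsto 0).comp h1
    rw [translateLp_zero] at h2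
    exact h2.const_smul _

end PoissonAverage

/-! ### Riesz's inequality on the line -/

section RieszLine

/-- For `1 < p ≤ 2` the modulus is controlled, in the closed right half plane, by the real part
up to a multiple of the real part of the holomorphic function `w ^ p`. -/
lemma exists_norm_rpow_le_re_cpow {p : ℝ} (hp : 1 < p) (hp2 : p ≤ 2) :
    ∃ a b : ℝ, 0 ≤ a ∧ 0 ≤ b ∧ ∀ w : ℂ, 0 ≤ w.re →
      ‖w‖ ^ p ≤ a * w.re ^ p - b * (w ^ (p : ℂ)).re := by
  have hpi := Real.pi_pos
  -- beyond the angle `θ₀` one has `cos (p θ) ≤ cos (p θ₀) < 0`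
  obtain ⟨θ₀, h1, h2⟩ : ∃ θ₀, Real.pi / 2 / p < θ₀ ∧ θ₀ < Real.pi / 2 :=
    exists_between (div_lt_self (by positivity) hp)
  have hp0 : 0 < p := by linarith
  have hpos : 0 < θ₀ := lt_trans (by positivity) h1
  have hpθ : Real.pi / 2 < p * θ₀ := by rw [div_lt_iff₀ hp0] at h1; linarith
  have hpθ' : p * θ₀ ≤ Real.pi := by nlinarith
  set δ := - Real.cos (p * θ₀) with hδ
  have hδ0 : 0 < δ := by
    have := Real.cos_neg_of_pi_div_two_lt_of_lt hpθ (by linarith)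
    linarith
  have hc0 : 0 < Real.cos θ₀ := Real.cos_pos_of_mem_Ioo ⟨by linarith, h2⟩
  refine ⟨(1 + δ⁻¹) / Real.cos θ₀ ^ p, δ⁻¹, by positivity, by positivity, fun w hw => ?_⟩
  by_cases hw0 : w = 0
  · have : (p : ℂ) ≠ 0 := by exact_mod_cast hp0.ne'
    simp [hw0, Real.zero_rpow hp0.ne', Complex.zero_cpow this]
  have hn : 0 < ‖w‖ := norm_pos_iff.2 hw0
  have harg : |w.arg| ≤ Real.pi / 2 := Complex.abs_arg_le_pi_div_two_iff.2 hw
  have hre : w.re = ‖w‖ * Real.cos |w.arg| := by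
    rw [Real.cos_abs, Complex.cos_arg hw0]; field_simp
  have hcpow : (w ^ (p : ℂ)).re = ‖w‖ ^ p * Real.cos (p * |w.arg|) := by
    have h3 : w ^ (p : ℂ) = ((‖w‖ ^ p : ℝ) : ℂ) * Complex.exp ((p * w.arg : ℝ) * Complex.I) := by
      rw [Complex.cpow_def_of_ne_zero hw0, Complex.log, Real.rpow_def_of_pos hn, Complex.ofReal_exp,
        ← Complex.exp_add]
      congr 1; push_cast; ring
    rw [h3, Complex.re_ofReal_mul, Complex.exp_ofReal_mul_I_re]
    congr 1
    rw [← Real.cos_abs, abs_mul, abs_of_pos hp0]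
  have hcos : 0 ≤ Real.cos |w.arg| :=
    Real.cos_nonneg_of_mem_Icc ⟨by linarith [abs_nonneg w.arg], harg⟩
  rw [hre, hcpow, Real.mul_rpow hn.le hcos]
  set θ := |w.arg|
  have hθ : 0 ≤ θ := abs_nonneg _
  suffices h : 1 ≤ (1 + δ⁻¹) / Real.cos θ₀ ^ p * Real.cos θ ^ p - δ⁻¹ * Real.cos (p * θ) by
    have h' := mul_le_mul_of_nonneg_left h (Real.rpow_nonneg hn.le p)
    linarith
  rcases le_total θ₀ θ with hc | hc
  · have h4 : Real.cos (p * θ) ≤ -δ := by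
      rw [hδ, neg_neg]
      apply Real.cos_le_cos_of_nonneg_of_le_pi (by positivity) (by nlinarith)
      gcongr
    have h5 : 0 ≤ (1 + δ⁻¹) / Real.cos θ₀ ^ p * Real.cos θ ^ p := by positivity
    have h6 : δ⁻¹ * Real.cos (p * θ) ≤ δ⁻¹ * (-δ) := by gcongr
    have h7 : δ⁻¹ * (-δ) = -1 := by field_simp
    linarith
  · have h4 : Real.cos θ₀ ≤ Real.cos θ :=
      Real.cos_le_cos_of_nonneg_of_le_pi hθ (by linarith) hc
    have h5 : 1 + δ⁻¹ ≤ (1 + δ⁻¹) / Real.cos θ₀ ^ p * Real.cos θ ^ p := by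
      rw [div_mul_eq_mul_div, le_div_iff₀ (by positivity)]
      gcongr
    have h6 : δ⁻¹ * Real.cos (p * θ) ≤ δ⁻¹ * 1 := by gcongr; exact Real.cos_le_one _
    linarith

/-- The Cauchy integral of `g`, at a distance `y` from the real axis. -/
def cauchyIntegral (y : ℝ) (g : ℝ → ℝ) (z : ℂ) : ℂ :=
  ∫ t : ℝ, (2 * Real.pi * (y - (z - t) * Complex.I) : ℂ)⁻¹ * g t

variable {y : ℝ} {g : ℝ → ℝ}

lemma cauchyIntegral_den_re (y t : ℝ) (z : ℂ) :
    (2 * Real.pi * (y - (z - t) * Complex.I) : ℂ).re = 2 * Real.pi * (y + z.im) := by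
  simp

lemma cauchyIntegral_den_le (y t : ℝ) (z : ℂ) :
    2 * Real.pi * (y + z.im) ≤ ‖(2 * Real.pi * (y - (z - t) * Complex.I) : ℂ)‖ := by
  rw [← cauchyIntegral_den_re y t z]; exact Complex.re_le_norm _

lemma cauchyIntegral_den_ne {z : ℂ} (hz : 0 < y + z.im) (t : ℝ) :
    (2 * Real.pi * (y - (z - t) * Complex.I) : ℂ) ≠ 0 := by
  have := Real.pi_pos
  exact norm_pos_iff.1 (lt_of_lt_of_le (by positivity) (cauchyIntegral_den_le y t z))

lemma integrable_cauchyIntegral (hg : Integrable g) {z : ℂ} (hz : 0 < y + z.im) :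
    Integrable fun t : ℝ => (2 * Real.pi * (y - (z - t) * Complex.I) : ℂ)⁻¹ * g t := by
  have := Real.pi_pos
  refine hg.ofReal.bdd_mul (c := (2 * Real.pi * (y + z.im))⁻¹)
    (Continuous.aestronglyMeasurable ?_) (Eventually.of_forall fun t => ?_)
  · exact Continuous.inv₀ (by fun_prop) (cauchyIntegral_den_ne hz)
  · rw [norm_inv]
    exact inv_anti₀ (by positivity) (cauchyIntegral_den_le y t z)

lemma differentiableAt_cauchyIntegral (hg : Integrable g) {z : ℂ} (hz : 0 < y + z.im) :
    DifferentiableAt ℂ (cauchyIntegral y g) z := by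
  have hpi := Real.pi_pos
  set ε := (y + z.im) / 2 with hε
  have hε0 : 0 < ε := by positivity
  have him : ∀ x ∈ Metric.ball z ε, ε ≤ y + x.im := by
    intro x hx
    have h1 : |(x - z).im| < ε := (Complex.abs_im_le_norm _).trans_lt
      (by simpa [dist_eq_norm] using hx)
    rw [Complex.sub_im, abs_lt] at h1
    linarith [h1.1]
  refine (hasDerivAt_integral_of_dominated_loc_of_deriv_le (μ := volume)
    (F := fun z t => (2 * Real.pi * (y - (z - t) * Complex.I) : ℂ)⁻¹ * g t)
    (F' := fun z t =>
      (2 * Real.pi * Complex.I) / (2 * Real.pi * (y - (z - t) * Complex.I) : ℂ) ^ 2 * g t)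
    (bound := fun t => (2 * Real.pi) / (2 * Real.pi * ε) ^ 2 * |g t|) (Metric.ball_mem_nhds z hε0)
    ?_ (integrable_cauchyIntegral hg hz) ?_ ?_ ?_ ?_).2.differentiableAt
  · filter_upwards [Metric.ball_mem_nhds z hε0] with x hx
    exact (integrable_cauchyIntegral hg (hε0.trans_le (him x hx))).aestronglyMeasurable
  · refine AEStronglyMeasurable.mul (Continuous.aestronglyMeasurable ?_)
      hg.ofReal.aestronglyMeasurable
    exact Continuous.div (by fun_prop) (by fun_prop) fun t =>
      pow_ne_zero 2 (cauchyIntegral_den_ne hz t)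
  · filter_upwards with t x hx
    have h1 := him x hx
    have h2 : (2 * Real.pi * ε) ≤ ‖(2 * Real.pi * (y - (x - t) * Complex.I) : ℂ)‖ :=
      le_trans (by gcongr) (cauchyIntegral_den_le y t x)
    rw [norm_mul, norm_div, norm_pow, Complex.norm_real, Real.norm_eq_abs]
    have h3 : ‖(2 * Real.pi * Complex.I : ℂ)‖ = 2 * Real.pi := by
      simp [abs_of_pos hpi]
    rw [h3]
    gcongr
  · exact hg.abs.const_mul _
  · filter_upwards with t x hx
    have h1 := cauchyIntegral_den_ne (hε0.trans_le (him x hx)) t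
    have h2 : HasDerivAt (fun x : ℂ => (2 * Real.pi * (y - (x - t) * Complex.I) : ℂ))
        (2 * Real.pi * (-(1 * Complex.I))) x :=
      ((((hasDerivAt_id x).sub_const (t : ℂ)).mul_const Complex.I).const_sub (y : ℂ)).const_mul _
    convert! (h2.inv h1).mul_const (g t : ℂ) using 1
    ring

lemma re_cauchyIntegral_nonneg (hg : Integrable g) (h0 : ∀ t, 0 ≤ g t) {z : ℂ} (hz : 0 < y + z.im) :
    0 ≤ (cauchyIntegral y g z).re := by
  have hpi := Real.pi_pos
  have h := integral_re (𝕜 := ℂ) (integrable_cauchyIntegral hg hz)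
  simp only [RCLike.re_to_complex] at h
  rw [cauchyIntegral, ← h]
  refine integral_nonneg fun t => ?_
  simp only [Pi.zero_apply]
  rw [Complex.re_mul_ofReal, Complex.inv_re, cauchyIntegral_den_re]
  have := h0 t
  have := Complex.normSq_nonneg (2 * Real.pi * (y - (z - t) * Complex.I) : ℂ)
  positivity

lemma re_cauchyIntegral_pos (hg : Integrable g) (h0 : ∀ t, 0 ≤ g t) (h1 : 0 < ∫ t, g t)
    {z : ℂ} (hz : 0 < y + z.im) :
    0 < (cauchyIntegral y g z).re := by
  have hpi := Real.pi_pos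
  have h := integral_re (𝕜 := ℂ) (integrable_cauchyIntegral hg hz)
  simp only [RCLike.re_to_complex] at h
  have hI := (integrable_cauchyIntegral hg hz).re
  simp only [RCLike.re_to_complex] at hI
  have hpos : ∀ t : ℝ, 0 < ((2 * Real.pi * (y - (z - t) * Complex.I) : ℂ)⁻¹).re := fun t => by
    rw [Complex.inv_re, cauchyIntegral_den_re]
    have := Complex.normSq_pos.2 (cauchyIntegral_den_ne hz t)
    positivity
  rw [integral_pos_iff_support_of_nonneg h0 hg] at h1
  rw [cauchyIntegral, ← h, integral_pos_iff_support_of_nonneg _ hI]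
  · convert h1 using 2
    ext t
    rw [Function.mem_support, Function.mem_support, Complex.re_mul_ofReal, mul_ne_zero_iff]
    exact and_iff_right (hpos t).ne'
  · intro t
    simp only [Pi.zero_apply, Complex.re_mul_ofReal]
    exact mul_nonneg (hpos t).le (h0 t)

/-- The Cauchy integral of a function of compact support is `O(1 / |z|)`. -/
lemma norm_cauchyIntegral_le (hy : 0 < y) (h0 : ∀ t, 0 ≤ g t) (hgi : Integrable g) {R : ℝ}
    (hg : ∀ t, R < |t| → g t = 0) {z : ℂ} (hzR : 2 * (y + R) ≤ ‖z‖) (hz : 0 < ‖z‖) :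
    ‖cauchyIntegral y g z‖ ≤ (∫ t, g t) / ‖z‖ := by
  have hpi := Real.pi_gt_three
  rw [cauchyIntegral, ← integral_div]
  refine norm_integral_le_of_norm_le (hgi.div_const _) (Eventually.of_forall fun t => ?_)
  rw [norm_mul, Complex.norm_real, Real.norm_of_nonneg (h0 t), mul_comm, div_eq_mul_inv]
  by_cases ht : R < |t|
  · simp [hg t ht]
  refine mul_le_mul_of_nonneg_left ?_ (h0 t)
  rw [norm_inv]
  refine inv_anti₀ hz ?_
  have h1 : ‖(y - (z - t) * Complex.I : ℂ)‖ = ‖z - (t - y * Complex.I)‖ := by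
    have : (y - (z - t) * Complex.I : ℂ) = -Complex.I * (z - (t - y * Complex.I)) := by
      ring_nf; simp
    rw [this, norm_mul]; simp
  have h2 : ‖(t - y * Complex.I : ℂ)‖ ≤ R + y := by
    refine (norm_sub_le _ _).trans ?_
    simp only [norm_mul, Complex.norm_real, Complex.norm_I, mul_one, Real.norm_eq_abs,
      abs_of_pos hy]
    linarith
  have h3 := norm_sub_norm_le z (t - y * Complex.I : ℂ)
  rw [norm_mul, h1]
  have h4 : ‖(2 * Real.pi : ℂ)‖ = 2 * Real.pi := by simp [abs_of_pos Real.pi_pos]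
  rw [h4]
  nlinarith [norm_nonneg (z - (t - y * Complex.I : ℂ))]

/-- The integral of a holomorphic function over the diameter of a square is controlled by its
size on the other three sides. -/
lemma norm_intervalIntegral_le_of_square {h : ℂ → ℂ} {R B : ℝ} (hR : 0 < R)
    (hd : ∀ z : ℂ, 0 ≤ z.im → DifferentiableAt ℂ h z)
    (hB : ∀ z : ℂ, 0 ≤ z.im → R ≤ ‖z‖ → ‖h z‖ ≤ B) :
    ‖∫ x in (-R)..R, h (x : ℂ)‖ ≤ 4 * R * B := by
  have hrect := Complex.integral_boundary_rect_eq_zero_of_differentiableOn h (-R : ℂ)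
    (R + R * Complex.I) (fun z hz => (hd z ?_).differentiableWithinAt)
  swap
  · have h1 := hz.2
    simp only [Complex.neg_im, Complex.ofReal_im, neg_zero, Complex.add_im, Complex.mul_im,
      Complex.ofReal_re, Complex.I_im, mul_one, Complex.I_re, mul_zero, add_zero, zero_add,
      Set.mem_preimage, Set.uIcc_of_le hR.le] at h1
    exact h1.1
  simp only [Complex.neg_im, Complex.ofReal_im, neg_zero, Complex.add_im, Complex.mul_im,
      Complex.ofReal_re, Complex.I_im, mul_one, Complex.I_re, mul_zero, add_zero, zero_add,
      Complex.neg_re, Complex.add_re, Complex.mul_re, Complex.ofReal_zero, zero_mul,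
      sub_zero] at hrect
  have e1 : ‖∫ x in (-R)..R, h (x + R * Complex.I)‖ ≤ B * |R - (-R)| := by
    refine intervalIntegral.norm_integral_le_of_norm_le_const fun x _ =>
      hB _ (by simpa using hR.le) ?_
    refine le_trans ?_ (Complex.abs_im_le_norm _)
    simp [abs_of_pos hR]
  have e2 : ‖∫ t in (0 : ℝ)..R, h (R + t * Complex.I)‖ ≤ B * |R - 0| := by
    refine intervalIntegral.norm_integral_le_of_norm_le_const fun x hx => hB _ ?_ ?_
    · rw [Set.uIoc_of_le hR.le] at hx
      simpa using hx.1.le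
    refine le_trans ?_ (Complex.abs_re_le_norm _)
    simp [abs_of_pos hR]
  have e3 : ‖∫ t in (0 : ℝ)..R, h (((-R : ℝ) : ℂ) + t * Complex.I)‖ ≤ B * |R - 0| := by
    refine intervalIntegral.norm_integral_le_of_norm_le_const fun x hx => hB _ ?_ ?_
    · rw [Set.uIoc_of_le hR.le] at hx
      simpa using hx.1.le
    refine le_trans ?_ (Complex.abs_re_le_norm _)
    simp [abs_of_pos hR]
  rw [sub_neg_eq_add, abs_of_pos (by linarith)] at e1
  rw [sub_zero, abs_of_pos hR] at e2 e3
  have hX : (∫ x in (-R)..R, h (x : ℂ)) = (∫ x in (-R)..R, h (x + R * Complex.I))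
      - Complex.I • (∫ t in (0 : ℝ)..R, h (R + t * Complex.I))
      + Complex.I • (∫ t in (0 : ℝ)..R, h (((-R : ℝ) : ℂ) + t * Complex.I)) := by
    have := hrect
    push_cast at this ⊢
    linear_combination (exp := 1) this
  rw [hX]
  refine (norm_add_le _ _).trans ((add_le_add_left (norm_sub_le _ _) _).trans ?_)
  rw [norm_smul, norm_smul, Complex.norm_I, one_mul, one_mul]
  linarith

/-- **M. Riesz's inequality** for the Cauchy integral `A` of a nonnegative function of compact
support. As `Re A > 0`, the function `A ^ p` is holomorphic on the upper half plane, and it decays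
like `|z| ^ (-p)`, so that its integral over the line vanishes. -/
lemma exists_lintegral_cauchyIntegral_le {p : ℝ} (hp : 1 < p) (hp2 : p ≤ 2) :
    ∃ a : ℝ, 0 ≤ a ∧ ∀ y : ℝ, 0 < y → ∀ g : ℝ → ℝ, Continuous g → HasCompactSupport g →
      (∀ t, 0 ≤ g t) →
      ∫⁻ x : ℝ, ENNReal.ofReal (‖cauchyIntegral y g x‖ ^ p) ≤
        ENNReal.ofReal a * ∫⁻ x : ℝ, ENNReal.ofReal ((cauchyIntegral y g x).re ^ p) := by
  obtain ⟨a, b, ha, hb, hab⟩ := exists_norm_rpow_le_re_cpow hp hp2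
  have hp0 : 0 < p := by linarith
  refine ⟨a, ha, fun y hy g hgc hgs hg0 => ?_⟩
  have hgi : Integrable g := hgc.integrable_of_hasCompactSupport hgs
  rcases (integral_nonneg (μ := volume) (f := g) hg0).eq_or_lt with hz | hpos
  · have hg : g = 0 := by
      rw [eq_comm, integral_eq_zero_iff_of_nonneg hg0 hgi] at hz
      exact hgc.ae_eq_iff_eq volume continuous_const |>.1 hz
    subst hg
    simp [cauchyIntegral, Real.zero_rpow hp0.ne']
  obtain ⟨R₀, hR₀⟩ : ∃ R, ∀ t, R < |t| → g t = 0 := by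
    obtain ⟨R, hR⟩ := hgs.isBounded.exists_norm_le
    exact ⟨R, fun t ht => by
      by_contra h
      exact absurd (hR t (subset_tsupport _ h)) (by simpa using ht)⟩
  set A := cauchyIntegral y g with hA
  set M := ∫ t, g t
  have him : ∀ x : ℝ, 0 < y + (x : ℂ).im := fun x => by simpa using hy
  have hAc : Continuous fun x : ℝ => A x := by
    rw [continuous_iff_continuousAt]
    intro x
    exact ContinuousAt.comp (f := fun x : ℝ => (x : ℂ))
      (differentiableAt_cauchyIntegral hgi (him x)).continuousAt
      Complex.continuous_ofReal.continuousAt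
  have hRe : ∀ z : ℂ, 0 ≤ z.im → 0 < (A z).re := fun z hz =>
    re_cauchyIntegral_pos hgi hg0 hpos (by linarith)
  have hdiff : ∀ z : ℂ, 0 ≤ z.im → DifferentiableAt ℂ (fun z => A z ^ (p : ℂ)) z := fun z hz =>
    (differentiableAt_cauchyIntegral hgi (by linarith)).cpow (differentiableAt_const _)
      (Or.inl (hRe z hz))
  have hAn : Continuous fun x : ℝ => ‖A x‖ ^ p :=
    hAc.norm.rpow_const fun _ => Or.inr hp0.le
  have hAr : Continuous fun x : ℝ => (A x).re ^ p :=
    (Complex.continuous_re.comp hAc).rpow_const fun _ => Or.inr hp0.le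
  have hAp : Continuous fun x : ℝ => A x ^ (p : ℂ) := by
    rw [continuous_iff_continuousAt]
    intro x
    exact ContinuousAt.comp (f := fun x : ℝ => (x : ℂ)) (hdiff x (by simp)).continuousAt
      Complex.continuous_ofReal.continuousAt
  have hM : 0 ≤ M := hpos.le
  -- the contour integral over a square of side `2 R` contributes `O(R ^ (1 - p))`
  have key : ∀ R : ℝ, 1 ≤ R → 2 * (y + R₀) ≤ R →
      ∫⁻ x in Set.Ioc (-R) R, ENNReal.ofReal (‖A x‖ ^ p) ≤
        ENNReal.ofReal a * (∫⁻ x : ℝ, ENNReal.ofReal ((A x).re ^ p)) +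
          ENNReal.ofReal (b * (4 * M ^ p * R ^ (-(p - 1)))) := by
    intro R hR1 hR
    have hRp : 0 < R := by linarith
    have h1 : ‖∫ x in (-R)..R, A x ^ (p : ℂ)‖ ≤ 4 * R * (M / R) ^ p := by
      refine norm_intervalIntegral_le_of_square (h := fun z => A z ^ (p : ℂ)) hRp hdiff
        fun z hz hzR => ?_
      rw [Complex.norm_cpow_real]
      refine Real.rpow_le_rpow (norm_nonneg _) ?_ hp0.le
      exact (norm_cauchyIntegral_le hy hg0 hgi hR₀ (hR.trans hzR) (hRp.trans_le hzR)).trans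
        (by gcongr)
    have h2 : 4 * R * (M / R) ^ p = 4 * M ^ p * R ^ (-(p - 1)) := by
      rw [Real.div_rpow hM hRp.le, neg_sub, Real.rpow_sub hRp, Real.rpow_one]
      ring
    rw [h2] at h1
    have h3 : ∫ x in (-R)..R, ‖A x‖ ^ p ≤ a * (∫ x in (-R)..R, (A x).re ^ p)
        + b * (4 * M ^ p * R ^ (-(p - 1))) := by
      have h4 : ∫ x in (-R)..R, ‖A x‖ ^ p ≤
          ∫ x in (-R)..R, (a * (A x).re ^ p - b * (A x ^ (p : ℂ)).re) := by
        refine intervalIntegral.integral_mono_on (by linarith) (hAn.intervalIntegrable _ _) ?_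
          fun x _ => hab _ (hRe x (by simp)).le
        exact ((hAr.const_mul a).sub
          ((Complex.continuous_re.comp hAp).const_mul b)).intervalIntegrable _ _
      have hApr : Continuous fun x : ℝ => (A x ^ (p : ℂ)).re := Complex.continuous_re.comp hAp
      rw [intervalIntegral.integral_sub ((hAr.const_mul a).intervalIntegrable _ _)
        ((hApr.const_mul b).intervalIntegrable _ _),
        intervalIntegral.integral_const_mul, intervalIntegral.integral_const_mul] at h4
      have h5 : ∫ x in (-R)..R, (A x ^ (p : ℂ)).re = (∫ x in (-R)..R, A x ^ (p : ℂ)).re := by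
        have := Complex.reCLM.intervalIntegral_comp_comm
          (hAp.intervalIntegrable (μ := volume) (-R) R)
        simpa using this
      rw [h5] at h4
      have h6 := (abs_le.1 ((Complex.abs_re_le_norm _).trans h1)).1
      nlinarith
    rw [intervalIntegral.integral_of_le (by linarith),
      intervalIntegral.integral_of_le (by linarith)] at h3
    have hi1 : IntegrableOn (fun x : ℝ => ‖A x‖ ^ p) (Set.Ioc (-R) R) :=
      (hAn.integrableOn_Icc).mono_set Set.Ioc_subset_Icc_self
    have hi2 : IntegrableOn (fun x : ℝ => (A x).re ^ p) (Set.Ioc (-R) R) :=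
      (hAr.integrableOn_Icc).mono_set Set.Ioc_subset_Icc_self
    have hre0 : ∀ x : ℝ, 0 ≤ (A x).re ^ p := fun x => Real.rpow_nonneg (hRe x (by simp)).le _
    rw [← ofReal_integral_eq_lintegral_ofReal hi1 (Eventually.of_forall fun x => by positivity)]
    refine (ENNReal.ofReal_le_ofReal h3).trans (ENNReal.ofReal_add_le.trans ?_)
    gcongr
    rw [ENNReal.ofReal_mul ha, ofReal_integral_eq_lintegral_ofReal hi2 (Eventually.of_forall hre0)]
    gcongr
    exact Measure.restrict_le_self
  have hcov : AECover volume atTop fun R : ℝ => Set.Ioc (-R) R :=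
    aecover_Ioc tendsto_neg_atTop_atBot tendsto_id
  have hlim := hcov.lintegral_tendsto_of_countably_generated
    (f := fun x : ℝ => ENNReal.ofReal (‖A x‖ ^ p)) hAn.measurable.ennreal_ofReal.aemeasurable
  have hlim2 : Tendsto (fun R : ℝ => ENNReal.ofReal a * (∫⁻ x : ℝ, ENNReal.ofReal ((A x).re ^ p)) +
      ENNReal.ofReal (b * (4 * M ^ p * R ^ (-(p - 1))))) atTop
      (𝓝 (ENNReal.ofReal a * (∫⁻ x : ℝ, ENNReal.ofReal ((A x).re ^ p)) + 0)) := by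
    refine Tendsto.const_add _ ?_
    rw [← ENNReal.ofReal_zero]
    refine ENNReal.tendsto_ofReal ?_
    simpa using
      ((tendsto_rpow_neg_atTop (by linarith : 0 < p - 1)).const_mul (4 * M ^ p)).const_mul b
  rw [add_zero] at hlim2
  refine le_of_tendsto_of_tendsto hlim hlim2 ?_
  filter_upwards [eventually_ge_atTop 1, eventually_ge_atTop (2 * (y + R₀))] with R h1 h2
  exact key R h1 h2

end RieszLine

/-! ### Riesz's inequality along a direction -/

section RieszDirection

variable {d : ℕ}

/-- Integration over the space through the lines of direction `e`. -/
lemma lintegral_eq_lintegral_lines {e : Rd d} (he : ‖e‖ = 1) {G : Rd d → ℝ≥0∞} (hG : Measurable G) :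
    ∫⁻ x, G x = ∫⁻ x, {x : Rd d | inner ℝ x e ∈ Set.Icc (0 : ℝ) 1}.indicator
      (fun x => ∫⁻ t : ℝ, G (x + t • e)) x := by
  set w : Rd d → ℝ≥0∞ := {x : Rd d | inner ℝ x e ∈ Set.Icc (0 : ℝ) 1}.indicator 1 with hw
  have hwm : Measurable w := by
    refine measurable_one.indicator ?_
    exact (by fun_prop : Measurable fun x : Rd d => inner ℝ x e) measurableSet_Icc
  have h1 : ∀ x, ∫⁻ t : ℝ, w (x + (-t) • e) = 1 := by
    intro x
    have h2 : ∀ t : ℝ, w (x + (-t) • e) =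
        (Set.Icc (inner ℝ x e - 1) (inner ℝ x e)).indicator 1 t := by
      intro t
      rw [hw]
      simp only [Set.indicator, Set.mem_ofPred_eq, inner_add_left, inner_smul_left,
        real_inner_self_eq_norm_sq, he, Set.mem_Icc]
      congr 1
      simp only [RCLike.conj_to_real, eq_iff_iff]
      constructor <;> rintro ⟨h, h'⟩ <;> constructor <;> linarith
    simp_rw [h2]
    rw [lintegral_indicator_one measurableSet_Icc, Real.volume_Icc]
    simp
  have h3 : ∀ x, {x : Rd d | inner ℝ x e ∈ Set.Icc (0 : ℝ) 1}.indicator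
      (fun x => ∫⁻ t : ℝ, G (x + t • e)) x = ∫⁻ t : ℝ, w x * G (x + t • e) := by
    intro x
    rw [lintegral_const_mul _ (by fun_prop)]
    by_cases hx : inner ℝ x e ∈ Set.Icc (0 : ℝ) 1
    · rw [Set.indicator_of_mem (by exact hx), hw, Set.indicator_of_mem (by exact hx)]; simp
    · rw [Set.indicator_of_notMem (by exact hx), hw, Set.indicator_of_notMem (by exact hx)]; simp
  simp_rw [h3]
  rw [lintegral_lintegral_swap (by fun_prop)]
  have h4 : ∀ t : ℝ, ∫⁻ x, w x * G (x + t • e) = ∫⁻ x, w (x + (-t) • e) * G x := by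
    intro t
    rw [← lintegral_add_right_eq_self (fun x => w (x + (-t) • e) * G x) (t • e)]
    simp
  simp_rw [h4]
  rw [lintegral_lintegral_swap (by fun_prop)]
  congr 1; ext x
  rw [lintegral_mul_const _ (by fun_prop), h1, one_mul]

/-- An inequality on all lines of direction `e` integrates to one on the space. -/
lemma lintegral_le_of_forall_lines {e : Rd d} (he : ‖e‖ = 1) {G H : Rd d → ℝ≥0∞} (hG : Measurable G)
    (hH : Measurable H) {c : ℝ≥0∞}
    (h : ∀ x, ∫⁻ t : ℝ, G (x + t • e) ≤ c * ∫⁻ t : ℝ, H (x + t • e)) :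
    ∫⁻ x, G x ≤ c * ∫⁻ x, H x := by
  rw [lintegral_eq_lintegral_lines he hG, lintegral_eq_lintegral_lines he hH,
    ← lintegral_const_mul]
  · refine lintegral_mono fun x => ?_
    by_cases hx : x ∈ {x : Rd d | inner ℝ x e ∈ Set.Icc (0 : ℝ) 1}
    · simpa only [Set.indicator_of_mem hx] using h x
    · rw [Set.indicator_of_notMem hx, Set.indicator_of_notMem hx]; simp
  · refine Measurable.indicator ?_
      ((by fun_prop : Measurable fun x : Rd d => inner ℝ x e) measurableSet_Icc)
    exact Measurable.lintegral_prod_right' (f := fun z : Rd d × ℝ => H (z.1 + z.2 • e))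
      (by fun_prop)

/-- The convolution with the Cauchy kernel in the direction `e`. -/
def cauchyAverage (y : ℝ) (e : Rd d) (f : Rd d → ℝ) (x : Rd d) : ℂ :=
  ∫ s, cauchyKernel y s * f (x - s • e)

lemma cauchyAverage_line (y : ℝ) (e : Rd d) (f : Rd d → ℝ) (x : Rd d) (t : ℝ) :
    cauchyAverage y e f (x + t • e) = cauchyIntegral y (fun t => f (x + t • e)) t := by
  rw [cauchyAverage, cauchyIntegral, ← integral_sub_left_eq_self _ volume t]
  congr 1; ext s
  rw [cauchyKernel, sub_smul]
  congr 4
  · push_cast; ring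
  · abel

lemma isClosedEmbedding_line {e : Rd d} (he : ‖e‖ = 1) (x : Rd d) :
    IsClosedEmbedding fun t : ℝ => x + t • e := by
  have he0 : e ≠ 0 := by rintro rfl; simp at he
  exact (Homeomorph.addLeft x).isClosedEmbedding.comp (isClosedEmbedding_smul_left he0)

lemma measurable_cauchyAverage {y : ℝ} (hy : 0 < y) (e : Rd d) {f : Rd d → ℝ} (hf : Continuous f) :
    Measurable (cauchyAverage y e f) := by
  refine (StronglyMeasurable.integral_prod_right
    (f := fun (x : Rd d) (s : ℝ) => cauchyKernel y s * f (x - s • e)) ?_).measurable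
  refine Continuous.stronglyMeasurable ?_
  exact ((continuous_cauchyKernel hy).comp continuous_snd).mul
    (Complex.continuous_ofReal.comp (hf.comp (by fun_prop)))

lemma integrable_cauchyKernel_mul {y : ℝ} (hy : 0 < y) {e : Rd d} (he : ‖e‖ = 1) {f : Rd d → ℝ}
    (hf : Continuous f) (hfs : HasCompactSupport f) (x : Rd d) :
    Integrable fun s : ℝ => cauchyKernel y s * f (x - s • e) := by
  have hline : HasCompactSupport fun s : ℝ => f (x - s • e) := by
    have h := hfs.comp_isClosedEmbedding (isClosedEmbedding_line (e := -e) (by rwa [norm_neg]) x)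
    simpa [sub_eq_add_neg, Function.comp_def] using h
  refine Continuous.integrable_of_hasCompactSupport ?_ ?_
  · exact (continuous_cauchyKernel hy).mul
      (Complex.continuous_ofReal.comp (hf.comp (by fun_prop)))
  · exact HasCompactSupport.mul_left (hline.comp_left (g := fun r : ℝ => (r : ℂ)) (by simp))

/-- Twice the real part of the Cauchy integral is the Poisson integral. -/
lemma two_mul_re_cauchyAverage {y : ℝ} (hy : 0 < y) {e : Rd d} (he : ‖e‖ = 1) {f : Rd d → ℝ}
    (hf : Continuous f) (hfs : HasCompactSupport f) (x : Rd d) :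
    ((2 * (cauchyAverage y e f x).re : ℝ) : ℂ) =
      ∫ t, linePoissonKernel t * f (x - (y * t) • e) := by
  have hpi := Real.pi_pos
  have hI := integrable_cauchyKernel_mul hy he hf hfs x
  have h1 : (cauchyAverage y e f x).re = ∫ s, (cauchyKernel y s).re * f (x - s • e) := by
    have := integral_re (𝕜 := ℂ) hI
    simp only [RCLike.re_to_complex, Complex.re_mul_ofReal] at this
    exact this.symm
  rw [h1, ← integral_const_mul]
  have h2 : ∀ t, linePoissonKernel t * f (x - (y * t) • e) =
      ((((Real.pi * (1 + t ^ 2))⁻¹ * f (x - (y * t) • e) : ℝ)) : ℂ) := fun t => by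
    rw [linePoissonKernel]; push_cast; ring
  simp_rw [h2]
  rw [integral_complex_ofReal]
  congr 1
  have h3 := Measure.integral_comp_mul_left
    (fun s : ℝ => 2 * ((cauchyKernel y s).re * f (x - s • e))) y
  rw [abs_of_pos (by positivity), eq_comm, smul_eq_mul, inv_mul_eq_iff_eq_mul₀ hy.ne'] at h3
  rw [h3, ← integral_const_mul]
  congr 1; ext t
  rw [← mul_assoc, ← mul_assoc, mul_assoc y, two_mul_re_cauchyKernel]
  congr 1
  have : (1 + t ^ 2) ≠ 0 := by positivity
  field_simp

/-- Riesz's inequality for the Cauchy integrals in the direction `e`: these are controlled by their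
real parts, which are Poisson averages and hence controlled by `f`. -/
lemma exists_eLpNorm_cauchyAverage_le {p : ℝ≥0∞} (hp : 1 < p) (hp2 : p ≤ 2) :
    ∃ C : ℝ≥0, ∀ e : Rd d, ‖e‖ = 1 → ∀ y : ℝ, 0 < y → ∀ f : Rd d → ℝ, Continuous f →
      HasCompactSupport f → (∀ x, 0 ≤ f x) →
      eLpNorm (cauchyAverage y e f) p ≤ C * eLpNorm f p := by
  have hpt : p ≠ ∞ := (hp2.trans_lt (by simp)).ne
  have hp0 : p ≠ 0 := (zero_lt_one.trans hp).ne'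
  have hpr : 1 < p.toReal := by
    rw [← ENNReal.toReal_one]; exact (ENNReal.toReal_lt_toReal (by simp) hpt).2 hp
  have hpr2 : p.toReal ≤ 2 := by
    have := (ENNReal.toReal_le_toReal hpt (by simp)).2 hp2
    simpa using this
  obtain ⟨a, ha, h⟩ := exists_lintegral_cauchyIntegral_le hpr hpr2
  refine ⟨Real.toNNReal (a ^ (1 / p.toReal)), fun e he y hy f hf hfs hf0 => ?_⟩
  have : Fact (1 ≤ p) := ⟨hp.le⟩
  have hmeas := measurable_cauchyAverage hy e hf
  have hconv : ∀ r : ℝ, 0 ≤ r → ENNReal.ofReal (r ^ p.toReal) = ‖r‖ₑ ^ p.toReal := fun r hr => by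
    rw [Real.enorm_eq_ofReal hr, ENNReal.ofReal_rpow_of_nonneg hr (by linarith)]
  have hgc : ∀ x, Continuous fun t : ℝ => f (x + t • e) := fun x => hf.comp (by fun_prop)
  have hgs : ∀ x, HasCompactSupport fun t : ℝ => f (x + t • e) := fun x =>
    hfs.comp_isClosedEmbedding (isClosedEmbedding_line he x)
  have hre : ∀ x, 0 ≤ (cauchyAverage y e f x).re := fun x => by
    have := cauchyAverage_line y e f x 0
    rw [zero_smul, add_zero] at this
    rw [this]
    exact re_cauchyIntegral_nonneg ((hgc x).integrable_of_hasCompactSupport (hgs x))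
      (fun t => hf0 _) (by simpa using hy)
  have key : ∫⁻ x, ‖cauchyAverage y e f x‖ₑ ^ p.toReal ≤
      ENNReal.ofReal a * ∫⁻ x, ‖(cauchyAverage y e f x).re‖ₑ ^ p.toReal := by
    refine lintegral_le_of_forall_lines he (by fun_prop)
      ((Complex.measurable_re.comp hmeas).enorm.pow_const _) fun x => ?_
    have := h y hy _ (hgc x) (hgs x) fun t => hf0 _
    have e1 : ∀ t : ℝ, ‖(cauchyAverage y e f (x + t • e)).re‖ₑ ^ p.toReal =
        ENNReal.ofReal ((cauchyIntegral y (fun t => f (x + t • e)) t).re ^ p.toReal) := fun t => by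
      rw [← hconv _ (hre _), cauchyAverage_line]
    have e2 : ∀ t : ℝ, ‖(cauchyAverage y e f (x + t • e))‖ₑ ^ p.toReal =
        ENNReal.ofReal (‖cauchyIntegral y (fun t => f (x + t • e)) t‖ ^ p.toReal) := fun t => by
      rw [hconv _ (norm_nonneg _), cauchyAverage_line, enorm_norm]
    simp only [Function.comp_apply]
    rw [funext e1, funext e2]
    exact this
  have hfm : MemLp (fun x => (f x : ℂ)) p :=
    (Complex.continuous_ofReal.comp hf).memLp_of_hasCompactSupport
      (hfs.comp_left (g := fun r : ℝ => (r : ℂ)) (by simp))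
  have hre_le : eLpNorm (fun x => (cauchyAverage y e f x).re) p ≤ eLpNorm f p := by
    obtain ⟨M, hM⟩ := hf.bounded_above_of_compact_support hfs
    have h1 := translationAverage_ae hpt integrable_linePoissonKernel
      (by fun_prop : Measurable fun t : ℝ => (y * t) • e) hfm
      (by fun_prop) (M := M) (by simpa using hM)
    simp_rw [← two_mul_re_cauchyAverage hy he hf hfs] at h1
    have h2 := norm_poissonAverage_le hpt e y (hfm.toLp _)
    rw [Lp.norm_toLp, Lp.norm_def, ENNReal.toReal_le_toReal (Lp.eLpNorm_ne_top _) hfm.2.ne,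
      poissonAverage, eLpNorm_congr_ae h1] at h2
    have h3 : eLpNorm (fun x => (f x : ℂ)) p = eLpNorm f p :=
      eLpNorm_congr_norm_ae (Eventually.of_forall fun x => by simp)
    rw [h3] at h2
    refine le_trans (eLpNorm_mono fun x => ?_) h2
    rw [Complex.norm_real, norm_mul, Real.norm_ofNat]
    linarith [norm_nonneg (cauchyAverage y e f x).re]
  rw [eLpNorm_eq_lintegral_rpow_enorm_toReal hp0 hpt]
  calc _ ≤ (ENNReal.ofReal a *
          ∫⁻ x, ‖(cauchyAverage y e f x).re‖ₑ ^ p.toReal) ^ (1 / p.toReal) := by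
        gcongr
    _ = ENNReal.ofReal (a ^ (1 / p.toReal)) * eLpNorm (fun x => (cauchyAverage y e f x).re) p := by
        rw [ENNReal.mul_rpow_of_nonneg _ _ (by positivity),
          ENNReal.ofReal_rpow_of_nonneg ha (by positivity),
          eLpNorm_eq_lintegral_rpow_enorm_toReal hp0 hpt]
    _ ≤ _ := by
        rw [ENNReal.ofReal]
        gcongr

end RieszDirection

/-! ### The Riesz projection in one direction -/

section RieszProjection

variable {d : ℕ} {p : ℝ≥0∞} [Fact (1 ≤ p)]

/-- The operator with symbol `1_{ξ·e > 0} (e^{-2π y ξ·e} - e^{-2π Y ξ·e})`, an approximation of the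
Riesz projection in the direction `e`. -/
def rieszAverage (hp : p ≠ ∞) (e : Rd d) {y Y : ℝ} (hy : 0 < y) (hyY : y ≤ Y) :
    Lp ℂ p (volume : Measure (Rd d)) →L[ℂ] Lp ℂ p (volume : Measure (Rd d)) :=
  translationAverage hp (integrable_rieszKernel hy hyY)
    (by fun_prop : Measurable fun t : ℝ => t • e)

lemma isMultiplier_rieszAverage (hp : p ≠ ∞) (e : Rd d) {y Y : ℝ} (hy : 0 < y) (hyY : y ≤ Y) :
    IsMultiplier (rieszAverage hp e hy hyY) (fun ξ => rieszSymbol y Y (inner ℝ ξ e)) := by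
  have h := isMultiplier_translationAverage hp (integrable_rieszKernel hy hyY)
    (by fun_prop : Measurable fun t : ℝ => t • e)
  refine h.congr (Eventually.of_forall fun ξ => ?_)
  have h2 := integral_rieszKernel_mul_exp hy hyY (inner ℝ ξ e)
  simp only [inner_smul_right]
  rw [← h2]

/-- Continuous functions of compact support are dense in `L^p`. -/
lemma exists_compactSupport_norm_sub_lt {p : ℝ≥0∞} (hp : p ≠ ∞)
    (f : Lp ℂ p (volume : Measure (Rd d))) {ε : ℝ} (hε : 0 < ε) :
    ∃ (g : Rd d → ℂ) (_ : Continuous g) (_ : HasCompactSupport g)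
      (hg : MemLp g p volume), ‖f - hg.toLp g‖ < ε := by
  obtain ⟨g, hgs, hg, hgc, hgm⟩ := (Lp.memLp f).exists_hasCompactSupport_eLpNorm_sub_le hp
    (ε := ENNReal.ofReal (ε / 2)) (by simpa using hε)
  refine ⟨g, hgc, hgs, hgm, ?_⟩
  rw [Lp.norm_def]
  have h1 : eLpNorm (f - hgm.toLp g : Lp ℂ p (volume : Measure (Rd d))) p volume =
      eLpNorm (⇑f - g) p volume := by
    refine eLpNorm_congr_ae ((Lp.coeFn_sub _ _).trans ?_)
    filter_upwards [hgm.coeFn_toLp] with x hx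
    simp [hx]
  rw [h1]
  refine lt_of_le_of_lt (ENNReal.toReal_mono (by simp) hg) ?_
  rw [ENNReal.toReal_ofReal (by positivity)]
  linarith

lemma norm_le_of_forall_compactSupport (hp : p ≠ ∞)
    {T : Lp ℂ p (volume : Measure (Rd d)) →L[ℂ] Lp ℂ p (volume : Measure (Rd d))} {C : ℝ}
    (h : ∀ (f : Rd d → ℂ) (_ : Continuous f) (_ : HasCompactSupport f) (hf : MemLp f p),
      ‖T (hf.toLp f)‖ ≤ C * ‖hf.toLp f‖) (f : Lp ℂ p (volume : Measure (Rd d))) :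
    ‖T f‖ ≤ C * ‖f‖ := by
  have hcl : IsClosed {f | ‖T f‖ ≤ C * ‖f‖} :=
    isClosed_le (by fun_prop) (by fun_prop)
  refine hcl.closure_subset (Metric.mem_closure_iff.2 fun ε hε => ?_)
  obtain ⟨g, hgc, hgs, hgm, hg⟩ := exists_compactSupport_norm_sub_lt hp f hε
  exact ⟨hgm.toLp g, h g hgc hgs hgm, by rwa [dist_eq_norm]⟩

/-- The kernel of `rieszAverage` is the difference of two Cauchy kernels, and Riesz's inequality
applies to each of them. -/
lemma exists_norm_rieszAverage_toLp_le (hp1 : 1 < p) (hp2 : p ≤ 2) (hp : p ≠ ∞) :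
    ∃ C : ℝ≥0, ∀ e : Rd d, ‖e‖ = 1 → ∀ (y Y : ℝ) (hy : 0 < y) (hyY : y ≤ Y) (f : Rd d → ℝ),
      Continuous f → HasCompactSupport f → (∀ x, 0 ≤ f x) → ∀ (hf : MemLp (fun x => (f x : ℂ)) p),
      ‖rieszAverage hp e hy hyY (hf.toLp _)‖ ≤ C * ‖hf.toLp _‖ := by
  obtain ⟨C, hC⟩ := exists_eLpNorm_cauchyAverage_le (d := d) hp1 hp2
  refine ⟨2 * C, fun e he y Y hy hyY f hfc hfs hf0 hf => ?_⟩
  have hY := hy.trans_le hyY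
  obtain ⟨M, hM⟩ := hfc.bounded_above_of_compact_support hfs
  have h1 := translationAverage_ae hp (integrable_rieszKernel hy hyY)
    (by fun_prop : Measurable fun t : ℝ => t • e) hf (by fun_prop) (M := M) (by simpa using hM)
  have h2 : ∀ x, ∫ s, rieszKernel y Y s * f (x - s • e) =
      (cauchyAverage y e f - cauchyAverage Y e f) x := fun x => by
    rw [Pi.sub_apply, cauchyAverage, cauchyAverage,
      ← integral_sub (integrable_cauchyKernel_mul hy he hfc hfs x)
        (integrable_cauchyKernel_mul hY he hfc hfs x)]
    simp only [rieszKernel, sub_mul]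
  simp_rw [h2] at h1
  have h3 : eLpNorm (fun x => (f x : ℂ)) p = eLpNorm f p :=
    eLpNorm_congr_norm_ae (Eventually.of_forall fun x => by simp)
  rw [Lp.norm_def, Lp.norm_toLp, h3, rieszAverage, eLpNorm_congr_ae h1]
  have h4 : eLpNorm (cauchyAverage y e f - cauchyAverage Y e f) p ≤
      (2 * C : ℝ≥0) * eLpNorm f p := by
    refine (eLpNorm_sub_le (measurable_cauchyAverage hy e hfc).aestronglyMeasurable
      (measurable_cauchyAverage hY e hfc).aestronglyMeasurable hp1.le).trans ?_
    refine (add_le_add (hC e he y hy f hfc hfs hf0) (hC e he Y hY f hfc hfs hf0)).trans_eq ?_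
    push_cast; ring
  have h5 : eLpNorm f p ≠ ∞ := by rw [← h3]; exact hf.2.ne
  refine (ENNReal.toReal_mono (ENNReal.mul_ne_top ENNReal.coe_ne_top h5) h4).trans_eq ?_
  rw [ENNReal.toReal_mul]; simp

lemma exists_norm_rieszAverage_le_of_le_two (hp1 : 1 < p) (hp2 : p ≤ 2) (hp : p ≠ ∞) :
    ∃ C : ℝ≥0, ∀ e : Rd d, ‖e‖ = 1 → ∀ (y Y : ℝ) (hy : 0 < y) (hyY : y ≤ Y)
      (f : Lp ℂ p (volume : Measure (Rd d))), ‖rieszAverage hp e hy hyY f‖ ≤ C * ‖f‖ := by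
  obtain ⟨C, hC⟩ := exists_norm_rieszAverage_toLp_le (d := d) hp1 hp2 hp
  refine ⟨4 * C, fun e he y Y hy hyY => norm_le_of_forall_compactSupport hp fun f hfc hfs hf => ?_⟩
  set T := rieszAverage hp e hy hyY
  -- the four nonnegative parts of `f`
  have hpart : ∀ g : Rd d → ℝ, Continuous g → HasCompactSupport g → (∀ x, 0 ≤ g x) →
      (∀ x, g x ≤ ‖f x‖) → ∃ hg : MemLp (fun x => (g x : ℂ)) p,
        ‖T (hg.toLp _)‖ ≤ C * ‖hf.toLp f‖ := by
    intro g hgc hgs hg0 hgf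
    have hg : MemLp (fun x => (g x : ℂ)) p :=
      (Complex.continuous_ofReal.comp hgc).memLp_of_hasCompactSupport
        (hgs.comp_left (g := fun r : ℝ => (r : ℂ)) (by simp))
    refine ⟨hg, (hC e he y Y hy hyY g hgc hgs hg0 hg).trans ?_⟩
    gcongr
    rw [Lp.norm_toLp, Lp.norm_toLp]
    refine ENNReal.toReal_mono hf.2.ne (eLpNorm_mono fun x => ?_)
    rw [Complex.norm_real, Real.norm_of_nonneg (hg0 x)]
    exact hgf x
  have hcs : ∀ φ : ℂ → ℝ, φ 0 = 0 → HasCompactSupport fun x => φ (f x) := fun φ hφ =>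
    hfs.comp_left (g := φ) hφ
  obtain ⟨g1, h1⟩ := hpart (fun x => max (f x).re 0) (by fun_prop)
    (hcs (fun z => max z.re 0) (by simp)) (fun x => le_max_right _ _)
    (fun x => max_le (Complex.re_le_norm _) (norm_nonneg _))
  obtain ⟨g2, h2⟩ := hpart (fun x => max (-(f x).re) 0) (by fun_prop)
    (hcs (fun z => max (-z.re) 0) (by simp)) (fun x => le_max_right _ _)
    (fun x => max_le ((neg_le_abs _).trans (Complex.abs_re_le_norm _)) (norm_nonneg _))
  obtain ⟨g3, h3⟩ := hpart (fun x => max (f x).im 0) (by fun_prop)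
    (hcs (fun z => max z.im 0) (by simp)) (fun x => le_max_right _ _)
    (fun x => max_le (Complex.im_le_norm _) (norm_nonneg _))
  obtain ⟨g4, h4⟩ := hpart (fun x => max (-(f x).im) 0) (by fun_prop)
    (hcs (fun z => max (-z.im) 0) (by simp)) (fun x => le_max_right _ _)
    (fun x => max_le ((neg_le_abs _).trans (Complex.abs_im_le_norm _)) (norm_nonneg _))
  have hsum : hf.toLp f = (g1.toLp _ - g2.toLp _) + Complex.I • (g3.toLp _ - g4.toLp _) := by
    rw [← MemLp.toLp_sub, ← MemLp.toLp_sub, ← MemLp.toLp_const_smul, ← MemLp.toLp_add]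
    refine MemLp.toLp_congr _ _ (Eventually.of_forall fun x => ?_)
    have hmax : ∀ r : ℝ, ((max r 0 : ℝ) : ℂ) - ((max (-r) 0 : ℝ) : ℂ) = r := fun r => by
      rw [← Complex.ofReal_sub]
      congr 1
      rcases le_total r 0 with h | h
      · rw [max_eq_right h, max_eq_left (by linarith)]; ring
      · rw [max_eq_left h, max_eq_right (by linarith)]; ring
    simp only [Pi.add_apply, Pi.sub_apply, Pi.smul_apply, hmax, smul_eq_mul]
    rw [mul_comm, Complex.re_add_im]
  have hT : T (hf.toLp f) = (T (g1.toLp _) - T (g2.toLp _)) +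
      Complex.I • (T (g3.toLp _) - T (g4.toLp _)) := by
    rw [hsum, map_add, map_smul, map_sub, map_sub]
  rw [hT]
  refine (norm_add_le _ _).trans ?_
  rw [norm_smul, Complex.norm_I, one_mul]
  have h5 := norm_sub_le (T (g1.toLp _)) (T (g2.toLp _))
  have h6 := norm_sub_le (T (g3.toLp _)) (T (g4.toLp _))
  push_cast
  linarith

end RieszProjection

/-! ### Duality and the Riesz projection for all exponents -/

section RieszDuality

variable {d : ℕ} {p q : ℝ≥0∞} [Fact (1 ≤ p)] [Fact (1 ≤ q)]

/-- The converse of Hölder's inequality, with `q < ∞`. -/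
lemma norm_le_of_forall_integral_mul_le {p q : ℝ≥0∞} [Fact (1 ≤ p)] [ENNReal.HolderConjugate p q]
    (hp : p ≠ ∞) (hq : q ≠ ∞)
    {h : Lp ℂ p (volume : Measure (Rd d))} {K : ℝ} (hK0 : 0 ≤ K)
    (hK : ∀ G : Lp ℂ q (volume : Measure (Rd d)), ‖∫ x, G x * h x‖ ≤ K * ‖G‖) : ‖h‖ ≤ K := by
  have hpq := ENNReal.HolderConjugate.toReal_of_ne_top hp hq
  have hp1 : 1 < p.toReal := hpq.lt
  have hpos : 0 < p.toReal - 1 := by linarith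
  have hq0 : 0 < q.toReal := hpq.symm.pos
  have hp0 : p ≠ 0 := (zero_lt_one.trans_le (Fact.out : 1 ≤ p)).ne'
  have hexp : q * ENNReal.ofReal (p.toReal - 1) = p := by
    rw [← ENNReal.ofReal_toReal hq, ← ENNReal.ofReal_mul hq0.le, mul_comm, hpq.sub_one_mul_conj,
      ENNReal.ofReal_toReal hp]
  set g : Rd d → ℂ := fun x => ((‖h x‖ ^ (p.toReal - 2) : ℝ) : ℂ) * (starRingEnd ℂ) (h x) with hg
  have hsm : AEStronglyMeasurable g := by
    have h1 := (Lp.aestronglyMeasurable h)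
    refine AEStronglyMeasurable.mul ?_ (Complex.continuous_conj.comp_aestronglyMeasurable h1)
    exact (Complex.measurable_ofReal.comp_aemeasurable
      (h1.norm.aemeasurable.pow_const _)).aestronglyMeasurable
  have hgn : ∀ x, ‖g x‖ = ‖h x‖ ^ (p.toReal - 1) := fun x => by
    rw [hg]
    simp only [norm_mul, Complex.norm_real, RCLike.norm_conj]
    rw [Real.norm_of_nonneg (by positivity)]
    rcases (norm_nonneg (h x)).eq_or_lt with h0 | h0
    · rw [← h0, mul_zero, Real.zero_rpow hpos.ne']
    · rw [← Real.rpow_add_one h0.ne']; ring_nf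
  have hgh : ∀ x, g x * h x = ((‖h x‖ ^ p.toReal : ℝ) : ℂ) := fun x => by
    simp only [hg]
    rw [mul_assoc, mul_comm ((starRingEnd ℂ) (h x)), Complex.mul_conj, Complex.normSq_eq_norm_sq,
      ← Complex.ofReal_mul]
    congr 1
    rcases (norm_nonneg (h x)).eq_or_lt with h0 | h0
    · rw [← h0, Real.zero_rpow hpq.pos.ne']; simp
    · rw [← Real.rpow_natCast, ← Real.rpow_add h0]; norm_num
  have hgnorm : eLpNorm g q volume = eLpNorm h p volume ^ (p.toReal - 1) := by
    have := eLpNorm_norm_rpow (p := q) (μ := volume) (h : Rd d → ℂ) hpos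
    rw [hexp] at this
    rw [← this]
    refine eLpNorm_congr_norm_ae (Eventually.of_forall fun x => ?_)
    rw [hgn, Real.norm_of_nonneg (by positivity)]
  have hgm : MemLp g q := ⟨hsm, by
    rw [hgnorm]; exact ENNReal.rpow_lt_top_of_nonneg hpos.le (Lp.memLp h).2.ne⟩
  have h1 := hK (hgm.toLp g)
  have h2 : ∫ x, (hgm.toLp g) x * h x = ((∫ x, ‖h x‖ ^ p.toReal : ℝ) : ℂ) := by
    rw [← integral_complex_ofReal]
    refine integral_congr_ae ?_
    filter_upwards [hgm.coeFn_toLp] with x hx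
    rw [hx, hgh]
  have h3 : ‖h‖ ^ p.toReal = ∫ x, ‖h x‖ ^ p.toReal := by
    have h0 : (0 : ℝ) ≤ ∫ x, ‖h x‖ ^ p.toReal := integral_nonneg fun x => by positivity
    rw [Lp.norm_def, (Lp.memLp h).eLpNorm_eq_integral_rpow_norm hp0 hp,
      ENNReal.toReal_ofReal (by positivity), ← Real.rpow_mul h0, inv_mul_cancel₀ hpq.pos.ne',
      Real.rpow_one]
  rw [h2, Complex.norm_real, Real.norm_of_nonneg (integral_nonneg fun x => by positivity), ← h3,
    Lp.norm_toLp, hgnorm, ← ENNReal.toReal_rpow, ← Lp.norm_def] at h1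
  rcases (norm_nonneg h).eq_or_lt with h0 | h0
  · rwa [← h0]
  · have h4 : ‖h‖ ^ p.toReal = ‖h‖ * ‖h‖ ^ (p.toReal - 1) := by
      rw [mul_comm, ← Real.rpow_add_one h0.ne']; ring_nf
    rw [h4] at h1
    exact le_of_mul_le_mul_right h1 (by positivity)

lemma norm_integral_mul_le {p q : ℝ≥0∞} [ENNReal.HolderConjugate p q]
    (f : Lp ℂ p (volume : Measure (Rd d)))
    (g : Lp ℂ q (volume : Measure (Rd d))) : ‖∫ x, f x * g x‖ ≤ ‖f‖ * ‖g‖ := by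
  have h := eLpNorm_le_eLpNorm_mul_eLpNorm_of_nnnorm (Lp.aestronglyMeasurable f)
    (Lp.aestronglyMeasurable g) (fun a b => a * b) 1 (p := p) (q := q) (r := 1)
    (Eventually.of_forall fun x => by simp [nnnorm_mul])
  rw [ENNReal.coe_one, one_mul, eLpNorm_one_eq_lintegral_enorm] at h
  have h2 := ENNReal.toReal_mono (ENNReal.mul_ne_top (Lp.memLp f).2.ne (Lp.memLp g).2.ne)
    ((enorm_integral_le_lintegral_enorm _).trans h)
  rwa [ENNReal.toReal_mul, toReal_enorm, ← Lp.norm_def, ← Lp.norm_def] at h2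

/-- The approximate Riesz projections are uniformly bounded on `L^p` for all `1 < p < ∞`: for
`p ≥ 2` their transposes are the approximate projections in the opposite direction on `L^q`, with
`q ≤ 2`. -/
lemma exists_norm_rieszAverage_le (hp1 : 1 < p) (hp : p ≠ ∞) :
    ∃ C : ℝ≥0, ∀ e : Rd d, ‖e‖ = 1 → ∀ (y Y : ℝ) (hy : 0 < y) (hyY : y ≤ Y)
      (f : Lp ℂ p (volume : Measure (Rd d))), ‖rieszAverage hp e hy hyY f‖ ≤ C * ‖f‖ := by
  rcases le_total p 2 with h2 | h2
  · exact exists_norm_rieszAverage_le_of_le_two hp1 h2 hp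
  have hconj := ENNReal.HolderConjugate.inv_one_sub_inv' (Fact.out : 1 ≤ p)
  set q := (1 - p⁻¹)⁻¹ with hqdef
  have : Fact (1 ≤ q) := ⟨by simp [hqdef]⟩
  have hconj' : ENNReal.HolderConjugate q p := ENNReal.HolderConjugate.symm
  have hq1 : 1 < q := (ENNReal.HolderConjugate.lt_top_iff_one_lt p q).1 hp.lt_top
  have hq : q ≠ ∞ := ((ENNReal.HolderConjugate.lt_top_iff_one_lt q p).2 hp1).ne
  have hq2 : q ≤ 2 := by
    rw [hqdef, ENNReal.inv_le_iff_inv_le]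
    rw [← ENNReal.inv_two_add_inv_two]
    refine ENNReal.le_sub_of_add_le_right (by simp; positivity) ?_
    gcongr
  obtain ⟨C, hC⟩ := exists_norm_rieszAverage_le_of_le_two (d := d) hq1 hq2 hq
  refine ⟨C, fun e he y Y hy hyY f => norm_le_of_forall_integral_mul_le (q := q) hp hq
    (by positivity) fun G => ?_⟩
  have h1 := (isMultiplier_rieszAverage hp e hy hyY).integral_mul_transpose hp hq
    (T' := rieszAverage hq (-e) hy hyY) ((isMultiplier_rieszAverage hq (-e) hy hyY).congr
      (Eventually.of_forall fun ξ => by simp [inner_neg_left, inner_neg_right])) f G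
  rw [h1]
  have h3 := hC (-e) (by rwa [norm_neg]) y Y hy hyY G
  refine (norm_integral_mul_le _ _).trans ?_
  calc ‖f‖ * ‖rieszAverage hq (-e) hy hyY G‖ ≤ ‖f‖ * (C * ‖G‖) := by gcongr
    _ = C * ‖f‖ * ‖G‖ := by ring

end RieszDuality

/-! ### The Riesz projection as a strong limit -/

section StrongLimit

variable {d : ℕ} {p : ℝ≥0∞} [Fact (1 ≤ p)]

lemma norm_linePoissonKernel_le (s : ℝ) : ‖linePoissonKernel s‖ ≤ 1 := by
  rw [linePoissonKernel, Complex.norm_real, Real.norm_of_nonneg (linePoissonKernel_nonneg s)]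
  refine inv_le_one_of_one_le₀ ?_
  nlinarith [Real.pi_gt_three, sq_nonneg s]

/-- A Poisson average over long segments of a bounded function of bounded support is small. -/
lemma norm_integral_linePoissonKernel_mul_le {e : Rd d} (he : ‖e‖ = 1) {f : Rd d → ℂ}
    {M R : ℝ} (hM : ∀ x, ‖f x‖ ≤ M) (hR : ∀ x, R < ‖x‖ → f x = 0) (hR0 : 0 ≤ R) {Y : ℝ} (hY : 0 < Y)
    (x : Rd d) : ‖∫ s, linePoissonKernel s * f (x - (Y * s) • e)‖ ≤ M * (4 * R / Y) := by
  have hM0 : 0 ≤ M := (norm_nonneg _).trans (hM 0)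
  by_cases hex : ∃ s₀ : ℝ, ‖x - (Y * s₀) • e‖ ≤ R
  swap
  · push Not at hex
    have : ∀ s, linePoissonKernel s * f (x - (Y * s) • e) = 0 := fun s => by
      rw [hR _ (hex s), mul_zero]
    simp only [this, integral_zero, norm_zero]
    positivity
  obtain ⟨s₀, hs₀⟩ := hex
  have hzero : ∀ s, s ∉ Metric.closedBall s₀ (2 * R / Y) →
      linePoissonKernel s * f (x - (Y * s) • e) = 0 := fun s hs => by
    rw [hR _ ?_, mul_zero]
    by_contra! hlt
    apply hs
    rw [Metric.mem_closedBall, Real.dist_eq, le_div_iff₀ hY]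
    have h1 : ‖(Y * (s - s₀)) • e‖ ≤ 2 * R := by
      have : (Y * (s - s₀)) • e = (x - (Y * s₀) • e) - (x - (Y * s) • e) := by module
      rw [this]
      exact (norm_sub_le _ _).trans (by linarith)
    rw [norm_smul, he, mul_one, norm_mul, Real.norm_of_nonneg hY.le, Real.norm_eq_abs] at h1
    linarith
  rw [← setIntegral_eq_integral_of_forall_compl_eq_zero hzero]
  refine (norm_setIntegral_le_of_norm_le_const (C := M) measure_closedBall_lt_top
    fun s _ => ?_).trans_eq ?_
  · rw [norm_mul]
    calc _ ≤ 1 * M := mul_le_mul (norm_linePoissonKernel_le s) (hM _) (norm_nonneg _) zero_le_one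
      _ = M := one_mul M
  · rw [measureReal_def, Real.volume_closedBall, ENNReal.toReal_ofReal (by positivity)]
    ring

/-- Interpolation between `L^1` and `L^∞`. -/
lemma eLpNorm_rpow_le_of_bound {p : ℝ≥0∞} (hp1 : 1 < p) (hp : p ≠ ∞) {g : Rd d → ℂ} {δ : ℝ≥0}
    (hδ : ∀ᵐ x, ‖g x‖ₑ ≤ δ) :
    eLpNorm g p volume ^ p.toReal ≤ δ ^ (p.toReal - 1) * eLpNorm g 1 volume := by
  have hp0 : p ≠ 0 := (zero_lt_one.trans hp1).ne'
  have hpr : 1 < p.toReal := by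
    rw [← ENNReal.toReal_one]; exact (ENNReal.toReal_lt_toReal ENNReal.one_ne_top hp).2 hp1
  rw [eLpNorm_eq_lintegral_rpow_enorm_toReal hp0 hp, ← ENNReal.rpow_mul, one_div,
    inv_mul_cancel₀ (by positivity), ENNReal.rpow_one, eLpNorm_one_eq_lintegral_enorm,
    ← lintegral_const_mul' _ _ (ENNReal.rpow_ne_top_of_nonneg (by linarith) ENNReal.coe_ne_top)]
  refine lintegral_mono_ae ?_
  filter_upwards [hδ] with x hx
  calc ‖g x‖ₑ ^ p.toReal = ‖g x‖ₑ ^ (p.toReal - 1) * ‖g x‖ₑ := by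
        conv_rhs => rw [← ENNReal.rpow_one ‖g x‖ₑ, ← ENNReal.rpow_mul, one_mul,
          ← ENNReal.rpow_add_of_nonneg _ _ (by linarith) zero_le_one, sub_add_cancel]
    _ ≤ _ := by gcongr

/-- The averages are bounded in `L^1` and tend to zero uniformly. -/
lemma tendsto_poissonAverage_toLp_atTop (hp1 : 1 < p) (hp : p ≠ ∞) {e : Rd d} (he : ‖e‖ = 1)
    {f : Rd d → ℂ} (hfc : Continuous f) (hfs : HasCompactSupport f) (hf : MemLp f p)
    {Y : ℕ → ℝ} (hY : Tendsto Y atTop atTop) :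
    Tendsto (fun n => poissonAverage hp e (Y n) (hf.toLp f)) atTop (𝓝 0) := by
  obtain ⟨M, hM⟩ := hfc.bounded_above_of_compact_support hfs
  obtain ⟨R, hR0, hR⟩ := hfs.exists_pos_le_norm
  have hM0 : 0 ≤ M := (norm_nonneg _).trans (hM 0)
  have hf1 : MemLp f 1 := hfc.memLp_of_hasCompactSupport hfs
  have hpr : 1 < p.toReal := by
    rw [← ENNReal.toReal_one]; exact (ENNReal.toReal_lt_toReal ENNReal.one_ne_top hp).2 hp1
  have hae : ∀ (q : ℝ≥0∞) [Fact (1 ≤ q)] (hq : q ≠ ∞) (hfq : MemLp f q) (y : ℝ),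
      poissonAverage hq e y (hfq.toLp f) =ᵐ[volume]
        fun x => ∫ s, linePoissonKernel s * f (x - (y * s) • e) := fun q _ hq hfq y =>
    translationAverage_ae hq integrable_linePoissonKernel
      (by fun_prop : Measurable fun t : ℝ => (y * t) • e) hfq (by fun_prop) hM
  have key : ∀ y : ℝ, 0 < y → ‖poissonAverage hp e y (hf.toLp f)‖ ^ p.toReal ≤
      (M * (4 * R / y)) ^ (p.toReal - 1) * ‖hf1.toLp f‖ := by
    intro y hy
    have h1 := norm_poissonAverage_le (p := 1) ENNReal.one_ne_top e y (hf1.toLp f)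
    have hδ : 0 ≤ M * (4 * R / y) := by positivity
    have h2 := eLpNorm_rpow_le_of_bound hp1 hp (g := poissonAverage hp e y (hf.toLp f))
      (δ := (M * (4 * R / y)).toNNReal) (by
        filter_upwards [hae p hp hf y] with x hx
        rw [hx, ← ofReal_norm]
        exact ENNReal.ofReal_le_ofReal
          (norm_integral_linePoissonKernel_mul_le he hM (fun x hx => hR x hx.le) hR0.le hy x))
    have h3 : eLpNorm (poissonAverage hp e y (hf.toLp f)) 1 volume =
        eLpNorm (poissonAverage ENNReal.one_ne_top e y (hf1.toLp f)) 1 volume :=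
      eLpNorm_congr_ae ((hae p hp hf y).trans (hae 1 ENNReal.one_ne_top hf1 y).symm)
    have h4 := ENNReal.toReal_mono (ENNReal.mul_ne_top
      (ENNReal.rpow_ne_top_of_nonneg (by linarith) ENNReal.coe_ne_top)
      (by rw [h3]; exact (Lp.memLp _).2.ne)) h2
    rw [ENNReal.toReal_mul, ← ENNReal.toReal_rpow, ← ENNReal.toReal_rpow, h3, ← Lp.norm_def,
      ← Lp.norm_def, ENNReal.coe_toReal, Real.coe_toNNReal _ hδ] at h4
    exact h4.trans (by gcongr)
  have hlim : Tendsto (fun n => (M * (4 * R / Y n)) ^ (p.toReal - 1) * ‖hf1.toLp f‖) atTop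
      (𝓝 0) := by
    have h1 : Tendsto (fun n => M * (4 * R / Y n)) atTop (𝓝 0) := by
      simpa using (hY.const_div_atTop (4 * R)).const_mul M
    have h2 := (h1.rpow_const (p := p.toReal - 1) (Or.inr (by linarith))).mul_const ‖hf1.toLp f‖
    rwa [Real.zero_rpow (by linarith), zero_mul] at h2
  rw [tendsto_zero_iff_norm_tendsto_zero]
  have h5 : Tendsto (fun n => ‖poissonAverage hp e (Y n) (hf.toLp f)‖ ^ p.toReal) atTop (𝓝 0) :=
    squeeze_zero' (Eventually.of_forall fun n => by positivity)
      ((hY.eventually_gt_atTop 0).mono fun n hn => key _ hn) hlim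
  have h6 := h5.rpow_const (p := p.toReal⁻¹) (Or.inr (by positivity))
  rw [Real.zero_rpow (by positivity)] at h6
  refine h6.congr fun n => ?_
  rw [← Real.rpow_mul (norm_nonneg _), mul_inv_cancel₀ (by positivity), Real.rpow_one]

/-- On `L^p` with `p > 1`, Poisson averages in one direction vanish in the limit of long
segments. -/
lemma tendsto_poissonAverage_atTop (hp1 : 1 < p) (hp : p ≠ ∞) {e : Rd d} (he : ‖e‖ = 1)
    (f : Lp ℂ p (volume : Measure (Rd d))) {Y : ℕ → ℝ} (hY : Tendsto Y atTop atTop) :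
    Tendsto (fun n => poissonAverage hp e (Y n) f) atTop (𝓝 0) := by
  rw [Metric.tendsto_atTop]
  intro ε hε
  obtain ⟨g, hgc, hgs, hg, hfg⟩ := exists_compactSupport_norm_sub_lt hp f (half_pos hε)
  obtain ⟨N, hN⟩ := Metric.tendsto_atTop.1
    (tendsto_poissonAverage_toLp_atTop hp1 hp he hgc hgs hg hY) _ (half_pos hε)
  refine ⟨N, fun n hn => ?_⟩
  have h1 := hN n hn
  rw [dist_zero_right] at h1 ⊢
  have h2 : poissonAverage hp e (Y n) f = poissonAverage hp e (Y n) (f - hg.toLp g) +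
      poissonAverage hp e (Y n) (hg.toLp g) := by rw [map_sub, sub_add_cancel]
  rw [h2]
  refine (norm_add_le _ _).trans_lt ?_
  have := norm_poissonAverage_le hp e (Y n) (f - hg.toLp g)
  linarith

/-- The Riesz projection: the projection onto the frequencies `ξ·e > 0` is bounded on `L^p`. It is
the strong limit of `rieszAverage` with `y → 0` and `Y → ∞`; strong convergence is transferred from
the differences of Poisson averages, which commute with these operators. -/
theorem exists_isMultiplier_halfSpace (hp1 : 1 < p) (hp : p ≠ ∞) {e : Rd d} (he : ‖e‖ = 1) :
    ∃ P : Lp ℂ p (volume : Measure (Rd d)) →L[ℂ] Lp ℂ p (volume : Measure (Rd d)),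
      IsMultiplier P (fun ξ => if 0 < (inner ℝ ξ e : ℝ) then 1 else 0) := by
  obtain ⟨C, hC⟩ := exists_norm_rieszAverage_le (d := d) hp1 hp
  set a : ℕ → ℝ := fun n => 1 / ((n : ℝ) + 1) with ha
  have ha0 : ∀ n, 0 < a n := fun n => by positivity
  have hab : ∀ n, a n ≤ (n : ℝ) + 1 := fun n => by
    rw [ha]
    simp only [div_le_iff₀ (by positivity : (0 : ℝ) < n + 1)]
    nlinarith [(Nat.cast_nonneg n : (0 : ℝ) ≤ n)]
  have hlim0 : Tendsto a atTop (𝓝 0) := tendsto_one_div_add_atTop_nhds_zero_nat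
  have hlim1 : Tendsto (fun n : ℕ => (n : ℝ) + 1) atTop atTop :=
    tendsto_atTop_add_const_right _ _ tendsto_natCast_atTop_atTop
  set T := fun n : ℕ => rieszAverage (p := p) hp e (ha0 n) (hab n) with hT
  set Q := fun n : ℕ => poissonAverage (p := p) hp e (a n) - poissonAverage hp e ((n : ℝ) + 1)
  have hQ : ∀ f, Tendsto (fun n => Q n f) atTop (𝓝 f) := fun f => by
    have h := (tendsto_poissonAverage_zero hp e f hlim0).sub
      (tendsto_poissonAverage_atTop hp1 hp he f hlim1)
    rw [sub_zero] at h
    exact h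
  have hTm : ∀ n, IsMultiplier (T n) _ := fun n => isMultiplier_rieszAverage hp e (ha0 n) (hab n)
  have hQm : ∀ n, IsMultiplier (Q n) _ := fun n => (isMultiplier_poissonAverage hp e (ha0 n).le).sub
    (isMultiplier_poissonAverage hp e (by positivity : (0 : ℝ) ≤ n + 1))
  -- both sides have the symbol of `T n` times the symbol of `T m`
  have hTQ : ∀ n m f, T n (Q m f) = Q n (T m f) := by
    intro n m f
    have h1 := (hTm n).comp (hQm m)
    have h2 := (hQm n).comp (hTm m)
    refine congrArg (fun S => S f) (h1.ext hp (h2.congr (Eventually.of_forall fun ξ => ?_)))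
    simp only [rieszSymbol]
    split_ifs with h
    · rw [abs_of_pos h]; push_cast; ring
    · simp
  have hTC : ∀ n f, ‖T n f‖ ≤ C * ‖f‖ := fun n f => hC e he _ _ (ha0 n) (hab n) f
  have hcau : ∀ f, CauchySeq fun n => T n f := by
    intro f
    rw [Metric.cauchySeq_iff]
    intro ε hε
    have hC1 : (0 : ℝ) < C + 1 := by positivity
    -- `f` is close to `Q m f`, and `T k (Q m f) = Q k (T m f)` converges as `k → ∞`
    obtain ⟨m, hm⟩ := (Metric.tendsto_atTop.1 (hQ f)) (ε / 3 / (C + 1)) (by positivity)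
    have hm := hm m le_rfl
    rw [dist_comm, dist_eq_norm, lt_div_iff₀ hC1] at hm
    obtain ⟨N, hN⟩ := Metric.cauchySeq_iff.1 (hQ (T m f)).cauchySeq (ε / 3) (by positivity)
    refine ⟨N, fun k hk l hl => ?_⟩
    have h1 := hN k hk l hl
    rw [dist_eq_norm, ← hTQ, ← hTQ] at h1
    rw [dist_eq_norm]
    have h2 := hTC k (f - Q m f)
    have h3 := hTC l (f - Q m f)
    have h4 : T k f - T l f =
        T k (f - Q m f) + (T k (Q m f) - T l (Q m f)) - T l (f - Q m f) := by
      simp only [map_sub]; abel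
    rw [h4]
    have h5 := norm_sub_le (T k (f - Q m f) + (T k (Q m f) - T l (Q m f))) (T l (f - Q m f))
    have h6 := norm_add_le (T k (f - Q m f)) (T k (Q m f) - T l (Q m f))
    nlinarith [norm_nonneg (f - Q m f)]
  choose P₀ hP₀ using fun f => cauchySeq_tendsto_of_complete (hcau f)
  refine ⟨continuousLinearMapOfTendsto T (tendsto_pi_nhds.2 hP₀),
    IsMultiplier.of_tendsto hTm hP₀ (C := 2) (fun n ξ => ?_) fun ξ => ?_⟩
  · simp only [rieszSymbol]
    split_ifs with h
    · have hbd : ∀ y : ℝ, 0 ≤ y →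
          ‖Complex.exp (-(2 * Real.pi * y * (inner ℝ ξ e : ℝ)))‖ ≤ 1 := fun y hy => by
        rw [Complex.norm_exp]
        refine Real.exp_le_one_iff.2 ?_
        norm_cast
        have : 0 ≤ 2 * Real.pi * y * (inner ℝ ξ e : ℝ) := by positivity
        linarith
      refine (norm_sub_le _ _).trans ?_
      have h1 := hbd (a n) (ha0 n).le
      have h2 := hbd ((n : ℝ) + 1) (by positivity)
      linarith
    · simp
  · simp only [rieszSymbol]
    split_ifs with h
    · have h1 : Tendsto (fun n => Complex.exp (-(2 * Real.pi * a n * (inner ℝ ξ e : ℝ)))) atTop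
          (𝓝 1) := by
        have h0 : Continuous fun y : ℝ => Complex.exp (-(2 * Real.pi * y * (inner ℝ ξ e : ℝ))) := by
          fun_prop
        have h3 := (h0.tendsto 0).comp hlim0
        simp only [Complex.ofReal_zero, mul_zero, zero_mul, neg_zero, Complex.exp_zero] at h3
        exact h3
      have h2 : Tendsto (fun n : ℕ =>
          Complex.exp (-(2 * Real.pi * ((n : ℝ) + 1 : ℝ) * (inner ℝ ξ e : ℝ)))) atTop (𝓝 0) := by
        rw [tendsto_zero_iff_norm_tendsto_zero]
        have h3 : ∀ n : ℕ, ‖Complex.exp (-(2 * Real.pi * ((n : ℝ) + 1 : ℝ) * (inner ℝ ξ e : ℝ)))‖ =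
            Real.exp (-(2 * Real.pi * (inner ℝ ξ e : ℝ) * ((n : ℝ) + 1))) := fun n => by
          rw [Complex.norm_exp]
          congr 1
          norm_cast
          ring
        simp only [h3]
        exact Real.tendsto_exp_neg_atTop_nhds_zero.comp
          (hlim1.const_mul_atTop (by positivity))
      simpa using h1.sub h2
    · exact tendsto_const_nhds

end StrongLimit

/-! ### Bilinear multipliers -/

section BilinearMultiplier

variable {d : ℕ} {p p₁ p₂ : ℝ≥0∞} [Fact (1 ≤ p)] [Fact (1 ≤ p₁)] [Fact (1 ≤ p₂)]

/-- The bounded bilinear operator `B : L^{p₁} × L^{p₂} → L^p` has the symbol `m`: the spectrum of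
`B u v` at `ξ` is `∫ m(η, ξ - η) û(η) v̂(ξ - η) dη`. -/
def IsBilinearMultiplier
    (B : Lp ℂ p₁ (volume : Measure (Rd d)) →L[ℂ] Lp ℂ p₂ (volume : Measure (Rd d)) →L[ℂ]
      Lp ℂ p (volume : Measure (Rd d))) (m : Rd d → Rd d → ℂ) : Prop :=
  ∀ (u : Lp ℂ p₁ (volume : Measure (Rd d))) (v : Lp ℂ p₂ (volume : Measure (Rd d)))
    (g h : Rd d → ℂ), HasSpectrum u g → HasSpectrum v h →
    (∀ᵐ ξ, Integrable fun η => m η (ξ - η) * (g η * h (ξ - η))) ∧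
      HasSpectrum (B u v) (fun ξ => ∫ η, m η (ξ - η) * (g η * h (ξ - η)))

variable {B B' : Lp ℂ p₁ (volume : Measure (Rd d)) →L[ℂ] Lp ℂ p₂ (volume : Measure (Rd d)) →L[ℂ]
      Lp ℂ p (volume : Measure (Rd d))} {m m' : Rd d → Rd d → ℂ}

/-- The pointwise product `L^{p₁} × L^{p₂} → L^p`. -/
def lpMul (p p₁ p₂ : ℝ≥0∞) [Fact (1 ≤ p)] [Fact (1 ≤ p₁)] [Fact (1 ≤ p₂)]
    [ENNReal.HolderTriple p₁ p₂ p] :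
    Lp ℂ p₁ (volume : Measure (Rd d)) →L[ℂ] Lp ℂ p₂ (volume : Measure (Rd d)) →L[ℂ]
      Lp ℂ p (volume : Measure (Rd d)) :=
  (ContinuousLinearMap.mul ℂ ℂ).holderL volume p₁ p₂ p

lemma lpMul_ae [ENNReal.HolderTriple p₁ p₂ p] (u : Lp ℂ p₁ (volume : Measure (Rd d)))
    (v : Lp ℂ p₂ (volume : Measure (Rd d))) :
    lpMul p p₁ p₂ u v =ᵐ[volume] fun x => u x * v x :=
  (ContinuousLinearMap.mul ℂ ℂ).coeFn_holder u v

lemma norm_lpMul_apply_le [ENNReal.HolderTriple p₁ p₂ p] (u : Lp ℂ p₁ (volume : Measure (Rd d)))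
    (v : Lp ℂ p₂ (volume : Measure (Rd d))) :
    ‖lpMul p p₁ p₂ u v‖ ≤ (1 : ℝ≥0) * ‖u‖ * ‖v‖ := by
  refine ((ContinuousLinearMap.mul ℂ ℂ).norm_holder_apply_apply_le u v).trans ?_
  gcongr
  exact_mod_cast ContinuousLinearMap.opNorm_mul_le ℂ ℂ

lemma isBilinearMultiplier_lpMul [ENNReal.HolderTriple p₁ p₂ p] :
    IsBilinearMultiplier (d := d) (lpMul p p₁ p₂) (fun _ _ => 1) := by
  intro u v g h hu hv
  simp only [one_mul]
  exact ⟨hu.1.ae_convolution_exists (ContinuousLinearMap.mul ℂ ℂ) hv.1,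
    (hu.mul hv).congr_left (lpMul_ae u v)⟩

lemma IsBilinearMultiplier.congr (hB : IsBilinearMultiplier B m) (hm : ∀ η ζ, m' η ζ = m η ζ) :
    IsBilinearMultiplier B m' := by
  have : m' = m := funext fun η => funext (hm η)
  rwa [this]

lemma IsBilinearMultiplier.add (hB : IsBilinearMultiplier B m) (hB' : IsBilinearMultiplier B' m') :
    IsBilinearMultiplier (B + B') (fun η ζ => m η ζ + m' η ζ) := by
  intro u v g h hu hv
  obtain ⟨h1, h2⟩ := hB u v g h hu hv
  obtain ⟨h3, h4⟩ := hB' u v g h hu hv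
  simp only [add_mul]
  refine ⟨by filter_upwards [h1, h3] with ξ hξ hξ' using hξ.add hξ',
    ((h2.add h4).congr_left (Lp.coeFn_add _ _)).congr_right ?_⟩
  filter_upwards [h1, h3] with ξ hξ hξ'
  exact integral_add hξ hξ'

lemma IsBilinearMultiplier.bilinearComp (hB : IsBilinearMultiplier B m)
    {S : Lp ℂ p₁ (volume : Measure (Rd d)) →L[ℂ] Lp ℂ p₁ (volume : Measure (Rd d))}
    {T : Lp ℂ p₂ (volume : Measure (Rd d)) →L[ℂ] Lp ℂ p₂ (volume : Measure (Rd d))}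
    {α β : Rd d → ℂ} (hS : IsMultiplier S α) (hT : IsMultiplier T β) :
    IsBilinearMultiplier (B.bilinearComp S T) (fun η ζ => m η ζ * (α η * β ζ)) := by
  intro u v g h hu hv
  have := hB _ _ _ _ (hS u g hu) (hT v h hv)
  have e : ∀ ξ η, m η (ξ - η) * (α η * β (ξ - η)) * (g η * h (ξ - η)) =
    m η (ξ - η) * (α η * g η * (β (ξ - η) * h (ξ - η))) := fun ξ η => by ring
  simpa only [e, ContinuousLinearMap.bilinearComp_apply] using this

/-- The composition of a linear operator with a bilinear one. -/
def bilinearPostcomp (T : Lp ℂ p (volume : Measure (Rd d)) →L[ℂ] Lp ℂ p (volume : Measure (Rd d)))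
    (B : Lp ℂ p₁ (volume : Measure (Rd d)) →L[ℂ] Lp ℂ p₂ (volume : Measure (Rd d)) →L[ℂ]
      Lp ℂ p (volume : Measure (Rd d))) :
    Lp ℂ p₁ (volume : Measure (Rd d)) →L[ℂ] Lp ℂ p₂ (volume : Measure (Rd d)) →L[ℂ]
      Lp ℂ p (volume : Measure (Rd d)) :=
  T.postcomp _ ∘L B

lemma bilinearPostcomp_apply
    (T : Lp ℂ p (volume : Measure (Rd d)) →L[ℂ] Lp ℂ p (volume : Measure (Rd d)))
    (u : Lp ℂ p₁ (volume : Measure (Rd d))) (v : Lp ℂ p₂ (volume : Measure (Rd d))) :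
    bilinearPostcomp T B u v = T (B u v) := rfl

lemma IsBilinearMultiplier.postcomp (hB : IsBilinearMultiplier B m)
    {T : Lp ℂ p (volume : Measure (Rd d)) →L[ℂ] Lp ℂ p (volume : Measure (Rd d))}
    {γ : Rd d → ℂ} (hT : IsMultiplier T γ) :
    IsBilinearMultiplier (bilinearPostcomp T B) (fun η ζ => γ (η + ζ) * m η ζ) := by
  intro u v g h hu hv
  obtain ⟨h1, h2⟩ := hB u v g h hu hv
  have h3 := hT _ _ h2
  simp only [add_sub_cancel, mul_assoc, integral_const_mul]
  exact ⟨h1.mono fun ξ hξ => hξ.const_mul _, h3⟩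

lemma IsBilinearMultiplier.ext (hp₁ : p₁ ≠ ∞) (hp₂ : p₂ ≠ ∞) (hB : IsBilinearMultiplier B m)
    (hB' : IsBilinearMultiplier B' m) : B = B' := by
  refine ContinuousLinearMap.ext fun u => congrFun ((dense_schwartz hp₁).equalizer B.continuous
    B'.continuous ?_) u
  ext1 φ
  refine ContinuousLinearMap.ext fun v => congrFun ((dense_schwartz hp₂).equalizer
    (B _).continuous (B' _).continuous ?_) v
  ext1 ψ
  exact Lp.ext ((hB _ _ _ _ (hasSpectrum_schwartz φ) (hasSpectrum_schwartz ψ)).2.ae_eq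
    (hB' _ _ _ _ (hasSpectrum_schwartz φ) (hasSpectrum_schwartz ψ)).2)

/-- A product of two functions with localized spectra has localized spectrum. -/
lemma multiplier_lpMul_eq_zero [ENNReal.HolderTriple p₁ p₂ p] (hp₁ : p₁ ≠ ∞) (hp₂ : p₂ ≠ ∞)
    {S : Lp ℂ p₁ (volume : Measure (Rd d)) →L[ℂ] Lp ℂ p₁ (volume : Measure (Rd d))}
    {T : Lp ℂ p₂ (volume : Measure (Rd d)) →L[ℂ] Lp ℂ p₂ (volume : Measure (Rd d))}
    {R : Lp ℂ p (volume : Measure (Rd d)) →L[ℂ] Lp ℂ p (volume : Measure (Rd d))}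
    {α β γ : Rd d → ℂ} (hS : IsMultiplier S α) (hT : IsMultiplier T β) (hR : IsMultiplier R γ)
    {M : Lp ℂ p₁ (volume : Measure (Rd d)) →L[ℂ] Lp ℂ p₂ (volume : Measure (Rd d)) →L[ℂ]
      Lp ℂ p (volume : Measure (Rd d))} (hM : IsBilinearMultiplier M m)
    (h : ∀ η ζ, γ (η + ζ) * (α η * β ζ) = 0) (u : Lp ℂ p₁ (volume : Measure (Rd d)))
    (v : Lp ℂ p₂ (volume : Measure (Rd d))) : R (M (S u) (T v)) = 0 := by
  have h1 := (hM.bilinearComp hS hT).postcomp hR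
  have h0 : IsBilinearMultiplier (0 : Lp ℂ p₁ (volume : Measure (Rd d)) →L[ℂ]
      Lp ℂ p₂ (volume : Measure (Rd d)) →L[ℂ] Lp ℂ p (volume : Measure (Rd d)))
      (fun η ζ => γ (η + ζ) * (m η ζ * (α η * β ζ))) := by
    have e : ∀ η ζ, γ (η + ζ) * (m η ζ * (α η * β ζ)) = 0 := fun η ζ => by
      rw [mul_left_comm, h, mul_zero]
    intro u v g h hu hv
    simp only [e, zero_mul, integral_zero]
    refine ⟨by simp, integrable_zero _ _ _, ?_⟩
    refine (Lp.coeFn_zero _ _ _).trans (Eventually.of_forall fun x => ?_)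
    simp [Real.fourierInv_eq']
  exact congrArg (fun S => S u v) (h1.ext hp₁ hp₂ h0)

end BilinearMultiplier

/-! ### Products of functions with exponentially decaying spectrum -/

section ExponentialProduct

variable {d : ℕ} {p p₁ p₂ : ℝ≥0∞} [Fact (1 ≤ p)] [Fact (1 ≤ p₁)] [Fact (1 ≤ p₂)]

lemma norm_apply_apply_le
    {M : Lp ℂ p₁ (volume : Measure (Rd d)) →L[ℂ] Lp ℂ p₂ (volume : Measure (Rd d)) →L[ℂ]
      Lp ℂ p (volume : Measure (Rd d))} {C : ℝ≥0} (hM : ∀ u v, ‖M u v‖ ≤ C * ‖u‖ * ‖v‖)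
    {N : ℝ≥0} {u u' : Lp ℂ p₁ (volume : Measure (Rd d))} {v v' : Lp ℂ p₂ (volume : Measure (Rd d))}
    (hu : ‖u'‖ ≤ N * ‖u‖) (hv : ‖v'‖ ≤ N * ‖v‖) : ‖M u' v'‖ ≤ N ^ 2 * C * ‖u‖ * ‖v‖ := by
  calc ‖M u' v'‖ ≤ C * ‖u'‖ * ‖v'‖ := hM _ _
    _ ≤ C * (N * ‖u‖) * (N * ‖v‖) := by gcongr
    _ = N ^ 2 * C * ‖u‖ * ‖v‖ := by ring

lemma norm_add_six_le {E : Type*} [SeminormedAddCommGroup E] (a b c d e f : E) :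
    ‖a + b + c + d + e + f‖ ≤ ‖a‖ + ‖b‖ + ‖c‖ + ‖d‖ + ‖e‖ + ‖f‖ := by
  have h1 := norm_add₄_le (a := a) (b := b) (c := c) (d := d)
  have h2 := norm_add₃_le (a := a + b + c + d) (b := e) (c := f)
  linarith

/-- For each choice of the signs of `x`, `y` and `x + y` the exponential of
`|x + y| - |x| - |y|` is `1` or depends only on one of `x` and `y`. -/
lemma exp_abs_add_sub_abs_eq (a x y : ℝ) :
    Complex.exp ((2 * Real.pi * a * (|x + y| - |x| - |y|) : ℝ)) =
      (if 0 < x then 1 else 0) * (if 0 < y then 1 else 0) +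
      (1 - if 0 < x then 1 else 0) * (1 - if 0 < y then 1 else 0) +
      (if 0 < x + y then 1 else 0) * ((if 0 < x then 1 else 0) *
        (Complex.exp (-(2 * Real.pi * (2 * a) * |y| : ℝ)) * (1 - if 0 < y then 1 else 0))) +
      (1 - if 0 < x + y then 1 else 0) *
        (Complex.exp (-(2 * Real.pi * (2 * a) * |x| : ℝ)) * (if 0 < x then 1 else 0) *
          (1 - if 0 < y then 1 else 0)) +
      (if 0 < x + y then 1 else 0) *
        (Complex.exp (-(2 * Real.pi * (2 * a) * |x| : ℝ)) * (1 - if 0 < x then 1 else 0) *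
          (if 0 < y then 1 else 0)) +
      (1 - if 0 < x + y then 1 else 0) * ((1 - if 0 < x then 1 else 0) *
        (Complex.exp (-(2 * Real.pi * (2 * a) * |y| : ℝ)) * (if 0 < y then 1 else 0))) := by
  rcases lt_or_ge 0 x with hx | hx <;> rcases lt_or_ge 0 y with hy | hy <;>
    rcases lt_or_ge 0 (x + y) with hxy | hxy
  · rw [abs_of_pos hx, abs_of_pos hy, abs_of_pos hxy]
    simp [hx, hy, hxy]
  · exact absurd hxy (by linarith)
  · rw [abs_of_pos hx, abs_of_nonpos hy, abs_of_pos hxy]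
    simp [hx, hy.not_gt, hxy]
    ring_nf
  · rw [abs_of_pos hx, abs_of_nonpos hy, abs_of_nonpos hxy]
    simp [hx, hy.not_gt, hxy.not_gt]
    ring_nf
  · rw [abs_of_nonpos hx, abs_of_pos hy, abs_of_pos hxy]
    simp [hx.not_gt, hy, hxy]
    ring_nf
  · rw [abs_of_nonpos hx, abs_of_pos hy, abs_of_nonpos hxy]
    simp [hx.not_gt, hy, hxy.not_gt]
    ring_nf
  · exact absurd hxy (by linarith)
  · rw [abs_of_nonpos hx, abs_of_nonpos hy, abs_of_nonpos hxy]
    simp [hx.not_gt, hy.not_gt, hxy.not_gt]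

lemma exists_halfSpaceProjections (hp : 1 < p ∧ p < ∞) {e : Rd d} (he : ‖e‖ = 1) :
    ∃ (K : ℝ≥0) (P N : Lp ℂ p (volume : Measure (Rd d)) →L[ℂ] Lp ℂ p (volume : Measure (Rd d))),
      (∀ f, ‖P f‖ ≤ K * ‖f‖) ∧ (∀ f, ‖N f‖ ≤ K * ‖f‖) ∧
      IsMultiplier P (fun ξ => if 0 < (inner ℝ ξ e : ℝ) then 1 else 0) ∧
      IsMultiplier N (fun ξ => 1 - if 0 < (inner ℝ ξ e : ℝ) then 1 else 0) := by
  obtain ⟨P, hP⟩ := exists_isMultiplier_halfSpace hp.1 hp.2.ne he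
  refine ⟨‖P‖₊ + 1, P, _, fun f => ?_, fun f => ?_, hP, isMultiplier_id.sub hP⟩
  · refine (P.le_opNorm f).trans ?_
    push_cast
    nlinarith [norm_nonneg f]
  · refine (norm_sub_le _ _).trans ?_
    have := P.le_opNorm f
    push_cast
    change ‖f‖ + ‖P f‖ ≤ _
    linarith

set_option maxHeartbeats 1000000 in
/-- The factor of the symbol of the twisted product that belongs to one direction: the Riesz
projections separate the signs of the frequencies, and for each choice of signs the exponential is
`1` or the symbol of a Poisson average. -/
lemma exists_bilinearMultiplier_direction (hp : 1 < p ∧ p < ∞) (hp₁ : 1 < p₁ ∧ p₁ < ∞)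
    (hp₂ : 1 < p₂ ∧ p₂ < ∞) {e : Rd d} (he : ‖e‖ = 1) :
    ∃ K : ℝ≥0, ∀ a : ℝ, 0 ≤ a →
      ∀ (M : Lp ℂ p₁ (volume : Measure (Rd d)) →L[ℂ] Lp ℂ p₂ (volume : Measure (Rd d)) →L[ℂ]
        Lp ℂ p (volume : Measure (Rd d))) (m : Rd d → Rd d → ℂ) (C : ℝ≥0),
        (∀ u v, ‖M u v‖ ≤ C * ‖u‖ * ‖v‖) → IsBilinearMultiplier M m →
      ∃ M' : Lp ℂ p₁ (volume : Measure (Rd d)) →L[ℂ] Lp ℂ p₂ (volume : Measure (Rd d)) →L[ℂ]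
        Lp ℂ p (volume : Measure (Rd d)), (∀ u v, ‖M' u v‖ ≤ K * C * ‖u‖ * ‖v‖) ∧
        IsBilinearMultiplier M' (fun η ζ => m η ζ * Complex.exp
          ((2 * Real.pi * a * (|inner ℝ (η + ζ) e| - |inner ℝ η e| - |inner ℝ ζ e|) : ℝ))) := by
  obtain ⟨K₀, P, N, hKP, hKN, hP, hN⟩ := exists_halfSpaceProjections hp he
  obtain ⟨K₁, P₁, N₁, hKP₁, hKN₁, hP₁, hN₁⟩ := exists_halfSpaceProjections hp₁ he
  obtain ⟨K₂, P₂, N₂, hKP₂, hKN₂, hP₂, hN₂⟩ := exists_halfSpaceProjections hp₂ he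
  obtain ⟨K, h0, h1, h2⟩ : ∃ K : ℝ≥0, (K₀ : ℝ) ≤ K ∧ (K₁ : ℝ) ≤ K ∧ (K₂ : ℝ) ≤ K :=
    ⟨max K₀ (max K₁ K₂), by simp, by simp, by simp⟩
  refine ⟨2 * K ^ 2 + 4 * K ^ 3, fun a ha M m C hC hM => ?_⟩
  have h2a : (0 : ℝ) ≤ 2 * a := by positivity
  -- `E₁` and `E₂` are the Poisson averages with symbols `e^{-2a|η·e|}` and `e^{-2a|ζ·e|}`
  have hE₁ := isMultiplier_poissonAverage hp₁.2.ne e h2a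
  have hEb₁ := norm_poissonAverage_le hp₁.2.ne e (2 * a)
  generalize poissonAverage hp₁.2.ne e (2 * a) = E₁ at hE₁ hEb₁
  have hE₂ := isMultiplier_poissonAverage hp₂.2.ne e h2a
  have hEb₂ := norm_poissonAverage_le hp₂.2.ne e (2 * a)
  generalize poissonAverage hp₂.2.ne e (2 * a) = E₂ at hE₂ hEb₂
  -- the operators that correspond to the six summands of `exp_abs_add_sub_abs_eq`
  have hs := (((((hM.bilinearComp hP₁ hP₂).add (hM.bilinearComp hN₁ hN₂)).add
      ((hM.bilinearComp hP₁ (hE₂.comp hN₂)).postcomp hP)).add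
      ((hM.bilinearComp (hE₁.comp hP₁) hN₂).postcomp hN)).add
      ((hM.bilinearComp (hE₁.comp hN₁) hP₂).postcomp hP)).add
      ((hM.bilinearComp hN₁ (hE₂.comp hP₂)).postcomp hN)
  refine ⟨_, ?_, hs.congr fun η ζ => ?_⟩
  · intro u v
    simp only [add_apply, ContinuousLinearMap.bilinearComp_apply,
      bilinearPostcomp_apply, ContinuousLinearMap.comp_apply]
    refine (norm_add_six_le _ _ _ _ _ _).trans ?_
    have hu : (K₁ : ℝ) * ‖u‖ ≤ K * ‖u‖ := by gcongr
    have hv : (K₂ : ℝ) * ‖v‖ ≤ K * ‖v‖ := by gcongr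
    have hPu := (hKP₁ u).trans hu
    have hNu := (hKN₁ u).trans hu
    have hPv := (hKP₂ v).trans hv
    have hNv := (hKN₂ v).trans hv
    have hpost : ∀ {R : Lp ℂ p (volume : Measure (Rd d)) →L[ℂ] Lp ℂ p (volume : Measure (Rd d))}
        {w : Lp ℂ p (volume : Measure (Rd d))}, (∀ f, ‖R f‖ ≤ K₀ * ‖f‖) →
        ‖w‖ ≤ K ^ 2 * C * ‖u‖ * ‖v‖ → ‖R w‖ ≤ K ^ 3 * C * ‖u‖ * ‖v‖ := fun {R w} hR hw => by
      calc ‖R w‖ ≤ K₀ * ‖w‖ := hR w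
        _ ≤ K * (K ^ 2 * C * ‖u‖ * ‖v‖) := by gcongr
        _ = _ := by ring
    have h1 := norm_apply_apply_le hC hPu hPv
    have h2 := norm_apply_apply_le hC hNu hNv
    have h3 := hpost hKP (norm_apply_apply_le hC hPu ((hEb₂ _).trans hNv))
    have h4 := hpost hKN (norm_apply_apply_le hC ((hEb₁ _).trans hPu) hNv)
    have h5 := hpost hKP (norm_apply_apply_le hC ((hEb₁ _).trans hNu) hPv)
    have h6 := hpost hKN (norm_apply_apply_le hC hNu ((hEb₂ _).trans hPv))
    push_cast
    linarith
  · rw [inner_add_left, exp_abs_add_sub_abs_eq]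
    ring

/-- The composition of the Poisson averages in the coordinate directions listed in `l`. -/
def coordPoisson (hp : p ≠ ∞) (a : ℝ) :
    List (Fin d) → Lp ℂ p (volume : Measure (Rd d)) →L[ℂ] Lp ℂ p (volume : Measure (Rd d))
  | [] => ContinuousLinearMap.id ℂ _
  | i :: l => poissonAverage hp (EuclideanSpace.single i 1) a ∘L coordPoisson hp a l

lemma norm_coordPoisson_le (hp : p ≠ ∞) (a : ℝ) (l : List (Fin d))
    (f : Lp ℂ p (volume : Measure (Rd d))) : ‖coordPoisson hp a l f‖ ≤ ‖f‖ := by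
  induction l with
  | nil => exact le_rfl
  | cons i l ih => exact (norm_poissonAverage_le hp _ a _).trans ih

lemma isMultiplier_coordPoisson (hp : p ≠ ∞) {a : ℝ} (ha : 0 ≤ a) (l : List (Fin d)) :
    IsMultiplier (coordPoisson hp a l) (fun ξ =>
      Complex.exp ((-(2 * Real.pi * a * (l.map fun i => |ξ i|).sum) : ℝ))) := by
  induction l with
  | nil => exact isMultiplier_id.congr (by simp)
  | cons i l ih =>
    refine ((isMultiplier_poissonAverage hp (EuclideanSpace.single i 1) ha).comp ih).congr
      (Eventually.of_forall fun ξ => ?_)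
    simp only [List.map_cons, List.sum_cons, EuclideanSpace.inner_single_right]
    rw [← Complex.exp_add]
    congr 1
    simp
    ring

/-- The operator `e^{-a Λ₁}` on `L^p`, as the composition of the one-dimensional Poisson averages in
all coordinate directions. -/
def expNegLambda (hp : p ≠ ∞) (a : ℝ) :
    Lp ℂ p (volume : Measure (Rd d)) →L[ℂ] Lp ℂ p (volume : Measure (Rd d)) :=
  coordPoisson hp a (List.finRange d)

lemma norm_expNegLambda_le (hp : p ≠ ∞) (a : ℝ) (f : Lp ℂ p (volume : Measure (Rd d))) :
    ‖expNegLambda hp a f‖ ≤ ‖f‖ := norm_coordPoisson_le hp a _ f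

lemma isMultiplier_expNegLambda (hp : p ≠ ∞) {a : ℝ} (ha : 0 ≤ a) :
    IsMultiplier (expNegLambda (d := d) hp a)
      (fun ξ => ((Real.exp (-a * ∑ i, |2 * Real.pi * ξ i|) : ℝ) : ℂ)) := by
  refine (isMultiplier_coordPoisson hp ha _).congr (Eventually.of_forall fun ξ => ?_)
  simp only [abs_mul, abs_of_pos Real.two_pi_pos, ← Finset.mul_sum, ← List.ofFn_eq_map,
    List.sum_ofFn]
  rw [← Complex.ofReal_exp]
  congr 2
  ring

/-- The twisted product with respect to the coordinates listed in `l`, obtained from the pointwise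
product by adding the factors of the symbol one by one. -/
lemma exists_twistedProduct_coordPoisson [ENNReal.HolderTriple p₁ p₂ p] (hp : 1 < p ∧ p < ∞)
    (hp₁ : 1 < p₁ ∧ p₁ < ∞) (hp₂ : 1 < p₂ ∧ p₂ < ∞) (l : List (Fin d)) :
    ∃ K : ℝ≥0, ∀ a : ℝ, 0 ≤ a →
      ∃ (M : Lp ℂ p₁ (volume : Measure (Rd d)) →L[ℂ] Lp ℂ p₂ (volume : Measure (Rd d)) →L[ℂ]
        Lp ℂ p (volume : Measure (Rd d))), (∀ u v, ‖M u v‖ ≤ K * ‖u‖ * ‖v‖) ∧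
        IsBilinearMultiplier M (fun η ζ => Complex.exp ((2 * Real.pi * a *
          ((l.map fun i => |(η + ζ) i|).sum - (l.map fun i => |η i|).sum
            - (l.map fun i => |ζ i|).sum) : ℝ))) := by
  induction l with
  | nil =>
    exact ⟨1, fun a _ => ⟨lpMul p p₁ p₂, norm_lpMul_apply_le,
      isBilinearMultiplier_lpMul.congr (by simp)⟩⟩
  | cons i l ih =>
    obtain ⟨K, hK⟩ := ih
    obtain ⟨K', hK'⟩ := exists_bilinearMultiplier_direction (d := d) hp hp₁ hp₂
      (e := EuclideanSpace.single i 1) (by simp)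
    refine ⟨K' * K, fun a ha => ?_⟩
    obtain ⟨M, hM, hMm⟩ := hK a ha
    obtain ⟨M', hM', hMm'⟩ := hK' a ha M _ K hM hMm
    refine ⟨M', by simpa using hM', hMm'.congr fun η ζ => ?_⟩
    simp only [List.map_cons, List.sum_cons, EuclideanSpace.inner_single_right]
    rw [← Complex.exp_add, ← Complex.ofReal_add]
    congr 2
    simp
    ring

/-- The twisted product: multiplication of functions of the form `e^{-aΛ₁} u` corresponds to a
bilinear operator on the functions `u`, bounded uniformly in `a`. -/
theorem exists_twistedProduct [ENNReal.HolderTriple p₁ p₂ p] (hp : 1 < p ∧ p < ∞)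
    (hp₁ : 1 < p₁ ∧ p₁ < ∞) (hp₂ : 1 < p₂ ∧ p₂ < ∞) :
    ∃ K : ℝ≥0, ∀ a : ℝ, 0 ≤ a →
      ∃ (M : Lp ℂ p₁ (volume : Measure (Rd d)) →L[ℂ] Lp ℂ p₂ (volume : Measure (Rd d)) →L[ℂ]
        Lp ℂ p (volume : Measure (Rd d))), (∀ u v, ‖M u v‖ ≤ K * ‖u‖ * ‖v‖) ∧
        (∃ m, IsBilinearMultiplier M m) ∧
        ∀ u v, lpMul p p₁ p₂ (expNegLambda hp₁.2.ne a u) (expNegLambda hp₂.2.ne a v) =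
          expNegLambda hp.2.ne a (M u v) := by
  obtain ⟨K, hK⟩ := exists_twistedProduct_coordPoisson (d := d) hp hp₁ hp₂ (List.finRange d)
  refine ⟨K, fun a ha => ?_⟩
  obtain ⟨M, hM, hMm⟩ := hK a ha
  refine ⟨M, hM, ⟨_, hMm⟩, fun u v => ?_⟩
  have h1 := isBilinearMultiplier_lpMul.bilinearComp (isMultiplier_coordPoisson hp₁.2.ne ha
    (List.finRange d)) (isMultiplier_coordPoisson hp₂.2.ne ha (List.finRange d)) (p := p)
  have h2 := hMm.postcomp (isMultiplier_coordPoisson hp.2.ne ha (List.finRange d))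
  refine congrArg (fun S => S u v) (h1.ext hp₁.2.ne hp₂.2.ne (h2.congr fun η ζ => ?_))
  rw [← Complex.exp_add, ← Complex.exp_add, one_mul, ← Complex.ofReal_add, ← Complex.ofReal_add]
  congr 2
  ring

end ExponentialProduct

/-! ### Tempered distributions given by functions in Lebesgue spaces -/

section LpDist

variable {d : ℕ} {p : ℝ≥0∞} [Fact (1 ≤ p)]

/-- The embedding of `L^p` into the tempered distributions. -/
def lpDist (p : ℝ≥0∞) [Fact (1 ≤ p)] : Lp ℂ p (volume : Measure (Rd d)) →L[ℂ] TempDist d :=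
  Lp.toTemperedDistributionCLM ℂ volume p

lemma lpDist_apply (v : Lp ℂ p (volume : Measure (Rd d))) (φ : 𝓢(Rd d, ℂ)) :
    lpDist p v φ = ∫ x, φ x * v x := Lp.toTemperedDistribution_apply v φ

lemma IsGivenBy.congr {u : TempDist d} {v v' : Rd d → ℂ} (h : IsGivenBy u v)
    (hv : v' =ᵐ[volume] v) : IsGivenBy u v' := by
  intro φ
  have hae : (fun x => v' x * φ x) =ᵐ[volume] fun x => v x * φ x := by
    filter_upwards [hv] with x hx
    rw [hx]
  exact ⟨(h φ).1.congr hae.symm, (h φ).2.trans (integral_congr_ae hae.symm)⟩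

lemma isGivenBy_lpDist (v : Lp ℂ p (volume : Measure (Rd d))) : IsGivenBy (lpDist p v) v := by
  intro φ
  have := ENNReal.HolderConjugate.inv_one_sub_inv' (Fact.out : 1 ≤ p)
  refine ⟨(Lp.memLp v).integrable_mul (φ.memLp (1 - p⁻¹)⁻¹ volume), ?_⟩
  rw [lpDist_apply]
  simp only [mul_comm]

/-- On `L^p` the Fourier multiplier of a tempered distribution is the operator with that symbol. -/
lemma fourierMultiplierCLM_lpDist (hp : p ≠ ∞) {m : Rd d → ℂ} (hm : m.HasTemperateGrowth)
    {T : Lp ℂ p (volume : Measure (Rd d)) →L[ℂ] Lp ℂ p (volume : Measure (Rd d))}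
    (hT : IsMultiplier T m) (v : Lp ℂ p (volume : Measure (Rd d))) :
    TemperedDistribution.fourierMultiplierCLM ℂ m (lpDist p v) = lpDist p (T v) := by
  have := ENNReal.HolderConjugate.inv_one_sub_inv' (Fact.out : 1 ≤ p)
  have : Fact (1 ≤ (1 - p⁻¹)⁻¹) := ⟨by simp⟩
  ext φ
  rw [TemperedDistribution.fourierMultiplierCLM_apply_apply, lpDist_apply, lpDist_apply]
  set ψ := SchwartzMap.smulLeftCLM ℂ m (𝓕⁻ φ)
  have hψ : (ψ : Rd d → ℂ) = fun ξ => m ξ * (𝓕⁻ φ : 𝓢(Rd d, ℂ)) ξ := by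
    ext ξ
    exact SchwartzMap.smulLeftCLM_apply_apply hm _ _
  rw [hT.integral_mul_schwartz hp φ (hψ ▸ ψ.integrable) ((𝓕 ψ).toLp (1 - p⁻¹)⁻¹ volume) (by
    rw [← hψ]
    exact (𝓕 ψ).coeFn_toLp _ _)]
  refine integral_congr_ae ?_
  filter_upwards [(𝓕 ψ).coeFn_toLp (1 - p⁻¹)⁻¹ (volume : Measure (Rd d))] with x hx
  rw [hx, mul_comm]

/-- The operator `expNegLambda` on `L^p` is the transpose of `expNegLambdaTest`. -/
lemma integral_schwartz_mul_expNegLambda (hp1 : 1 < p) (hp : p ≠ ∞) {a : ℝ} (ha : 0 ≤ a)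
    (v : Lp ℂ p (volume : Measure (Rd d))) (φ : 𝓢(Rd d, ℂ)) :
    ∫ x, φ x * expNegLambda hp a v x = ∫ x, v x * expNegLambdaTest a φ x := by
  have hconj := ENNReal.HolderConjugate.inv_one_sub_inv' (Fact.out : 1 ≤ p)
  set q := (1 - p⁻¹)⁻¹ with hq
  have : Fact (1 ≤ q) := ⟨by simp [hq]⟩
  have hconj' : ENNReal.HolderConjugate q p := ENNReal.HolderConjugate.symm
  have hqt : q ≠ ∞ := ((ENNReal.HolderConjugate.lt_top_iff_one_lt q p).2 hp1).ne
  have h1 := isMultiplier_expNegLambda hqt ha _ _ (hasSpectrum_schwartz φ)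
  -- the symbol is even
  have h2 : ∀ ξ : Rd d, ((Real.exp (-a * ∑ i, |2 * Real.pi * (-ξ) i|) : ℝ) : ℂ) *
      (𝓕 φ : 𝓢(Rd d, ℂ)) (-ξ) =
      ((Real.exp (-a * ∑ i, |2 * Real.pi * ξ i|) : ℝ) : ℂ) * (𝓕⁻ φ : 𝓢(Rd d, ℂ)) ξ := fun ξ => by
    rw [SchwartzMap.fourierInv_coe, Real.fourierInv_eq_fourier_neg, SchwartzMap.fourier_coe]
    simp only [PiLp.neg_apply, mul_neg, abs_neg]
  have h3 := h1.1.comp_neg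
  have h4 := h1.2
  rw [Real.fourierInv_eq_fourier_comp_neg] at h4
  simp only [h2] at h3 h4
  rw [(isMultiplier_expNegLambda hp ha).integral_mul_schwartz hp φ h3 _ h4 v]
  refine integral_congr_ae ?_
  filter_upwards [h4] with x hx
  rw [hx]
  rfl

lemma isExpLambda_lpDist (hp1 : 1 < p) (hp : p ≠ ∞) {a : ℝ} (ha : 0 ≤ a)
    (v : Lp ℂ p (volume : Measure (Rd d))) : IsExpLambda a (lpDist p (expNegLambda hp a v)) v :=
  fun φ => by rw [lpDist_apply, integral_schwartz_mul_expNegLambda hp1 hp ha]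

lemma IsExpLambda.eq_lpDist (hp1 : 1 < p) (hp : p ≠ ∞) {a : ℝ} (ha : 0 ≤ a) {w : TempDist d}
    {v : Rd d → ℂ} (h : IsExpLambda a w v) (hv : MemLp v p) :
    w = lpDist p (expNegLambda hp a (hv.toLp v)) := by
  ext φ
  rw [h φ, lpDist_apply, integral_schwartz_mul_expNegLambda hp1 hp ha]
  refine integral_congr_ae ?_
  filter_upwards [hv.coeFn_toLp] with x hx
  rw [hx]

lemma expLambdaLpNorm_lpDist_le (hp1 : 1 < p) (hp : p ≠ ∞) {a : ℝ} (ha : 0 ≤ a)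
    (v : Lp ℂ p (volume : Measure (Rd d))) :
    expLambdaLpNorm a p (lpDist p (expNegLambda hp a v)) ≤ ‖v‖ₑ := by
  rw [Lp.enorm_def]
  exact iInf_le_of_le v (iInf_le_of_le (Lp.memLp v)
    (iInf_le_of_le (isExpLambda_lpDist hp1 hp ha v) le_rfl))

/-- If `e^{aΛ₁} w` is in `L^p`, then `w = e^{-aΛ₁} v` for some `v` in `L^p` that almost attains the
norm. The factor `2` makes up for the infimum in the definition of the norm; if the infimum is
zero, then `w = 0`. -/
lemma exists_eq_lpDist_of_expLambdaLpNorm_lt_top (hp1 : 1 < p) (hp : p ≠ ∞) {a : ℝ} (ha : 0 ≤ a)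
    {w : TempDist d} (hw : expLambdaLpNorm a p w < ∞) :
    ∃ v : Lp ℂ p (volume : Measure (Rd d)), w = lpDist p (expNegLambda hp a v) ∧
      ‖v‖ₑ ≤ 2 * expLambdaLpNorm a p w := by
  have key : ∀ c, expLambdaLpNorm a p w < c → ∃ v : Lp ℂ p (volume : Measure (Rd d)),
      w = lpDist p (expNegLambda hp a v) ∧ ‖v‖ₑ < c := by
    intro c hc
    simp only [expLambdaLpNorm, iInf_lt_iff] at hc
    obtain ⟨v, hv, hwv, hc⟩ := hc
    refine ⟨hv.toLp v, hwv.eq_lpDist hp1 hp ha hv, ?_⟩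
    rwa [Lp.enorm_toLp]
  rcases eq_or_ne (expLambdaLpNorm a p w) 0 with h0 | h0
  · refine ⟨0, ?_, by simp⟩
    simp only [map_zero]
    ext φ
    by_contra hne
    have hpos : 0 < ‖w φ‖ := norm_pos_iff.2 hne
    set S := ‖schwartzPairing (d := d) p φ‖
    have hS : 0 ≤ S := norm_nonneg _
    obtain ⟨v, hv, hvn⟩ := key (ENNReal.ofReal (‖w φ‖ / (S + 1)))
      (by rw [h0]; exact ENNReal.ofReal_pos.2 (by positivity))
    rw [← ofReal_norm, ENNReal.ofReal_lt_ofReal_iff (by positivity),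
      lt_div_iff₀ (by positivity)] at hvn
    have h1 : ‖w φ‖ ≤ S * ‖v‖ := by
      rw [hv, lpDist_apply, ← schwartzPairing_apply]
      exact ((schwartzPairing p φ).le_opNorm _).trans (by gcongr; exact norm_expNegLambda_le hp a v)
    nlinarith [norm_nonneg v]
  · obtain ⟨v, hv, hvn⟩ := key (2 * expLambdaLpNorm a p w) (by
      rw [two_mul]
      exact ENNReal.lt_add_right hw.ne h0)
    exact ⟨v, hv, hvn.le⟩

/-- Dilates of a Schwartz function are symbols of uniformly bounded operators. -/
lemma exists_isMultiplier_schwartz (hp : p ≠ ∞) (θ : 𝓢(Rd d, ℂ)) :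
    ∃ C : ℝ≥0, ∀ r : ℝ, ∃ T : Lp ℂ p (volume : Measure (Rd d)) →L[ℂ]
      Lp ℂ p (volume : Measure (Rd d)), IsMultiplier T (fun ξ => θ (r • ξ)) ∧
        ∀ f, ‖T f‖ ≤ C * ‖f‖ := by
  set k : 𝓢(Rd d, ℂ) := 𝓕⁻ θ with hk
  refine ⟨⟨∫ x, ‖k x‖, integral_nonneg fun x => norm_nonneg _⟩, fun r =>
    ⟨translationAverage hp k.integrable (by fun_prop : Measurable fun s : Rd d => r • s), ?_,
      norm_translationAverage_le hp k.integrable _⟩⟩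
  refine (isMultiplier_translationAverage hp k.integrable _).congr
    (Eventually.of_forall fun ξ => ?_)
  have h1 : θ = 𝓕 k := by rw [hk, FourierTransform.fourier_fourierInv_eq]
  simp only
  rw [h1, SchwartzMap.fourier_coe, Real.fourier_eq']
  congr 1
  ext s
  rw [smul_eq_mul, mul_comm, inner_smul_right, inner_smul_right, real_inner_comm]
  congr 2
  push_cast
  ring

end LpDist

/-! ### Dyadic localization -/

section Dyadic

variable {d : ℕ} {p : ℝ≥0∞} [Fact (1 ≤ p)]

/-- The rescaled frequency `2^{-j} 2π ξ`. -/
def dyadicScale {d : ℕ} (j : ℤ) (ξ : Rd d) : Rd d := (2 : ℝ) ^ (-j) • ((2 * Real.pi) • ξ)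

/-- The symbol `θ(2^{-j} 2π ξ)` of `dyadicMultiplier θ j`. -/
def dyadicSymbol {d : ℕ} (θ : Rd d → ℝ) (j : ℤ) (ξ : Rd d) : ℂ := ((θ (dyadicScale j ξ) : ℝ) : ℂ)

lemma dyadicScale_add (j : ℤ) (ξ η : Rd d) :
    dyadicScale j (ξ + η) = dyadicScale j ξ + dyadicScale j η := by
  simp only [dyadicScale, smul_add]

lemma dyadicScale_eq (j k : ℤ) (ξ : Rd d) :
    dyadicScale k ξ = (2 : ℝ) ^ (j - k) • dyadicScale j ξ := by
  rw [dyadicScale, dyadicScale, smul_smul ((2 : ℝ) ^ (j - k)), ← zpow_add₀ two_ne_zero]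
  congr 2
  ring

lemma norm_dyadicScale (j k : ℤ) (ξ : Rd d) :
    ‖dyadicScale k ξ‖ = (2 : ℝ) ^ (j - k) * ‖dyadicScale j ξ‖ := by
  rw [dyadicScale_eq j k, norm_smul, Real.norm_of_nonneg (by positivity)]

/-- Smooth functions with compact support. -/
def IsTestFunction {d : ℕ} (θ : Rd d → ℝ) : Prop :=
  ContDiff ℝ ((⊤ : ℕ∞) : WithTop ℕ∞) θ ∧ HasCompactSupport θ

variable {θ θ' : Rd d → ℝ}

lemma IsTestFunction.smul (hθ : IsTestFunction θ) {c : ℝ} (hc : c ≠ 0) :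
    IsTestFunction fun ξ => θ (c • ξ) :=
  ⟨hθ.1.comp (contDiff_const_smul c), hθ.2.comp_smul hc⟩

lemma IsTestFunction.sub (hθ : IsTestFunction θ) (hθ' : IsTestFunction θ') :
    IsTestFunction fun ξ => θ ξ - θ' ξ :=
  ⟨hθ.1.sub hθ'.1, hθ.2.sub hθ'.2⟩

lemma IsTestFunction.contDiff_ofReal (hθ : IsTestFunction θ) :
    ContDiff ℝ ((⊤ : ℕ∞) : WithTop ℕ∞) fun ξ => ((θ ξ : ℝ) : ℂ) :=
  Complex.ofRealCLM.contDiff.comp hθ.1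

lemma IsTestFunction.hasCompactSupport_ofReal (hθ : IsTestFunction θ) :
    HasCompactSupport fun ξ => ((θ ξ : ℝ) : ℂ) :=
  hθ.2.comp_left (g := fun r : ℝ => (r : ℂ)) (by simp)

lemma IsTestFunction.comp_dyadicScale (hθ : IsTestFunction θ) (j : ℤ) :
    IsTestFunction fun ξ => θ (dyadicScale j ξ) :=
  (hθ.smul (c := (2 : ℝ) ^ (-j)) (by positivity)).smul (c := 2 * Real.pi) (by positivity)

lemma IsTestFunction.hasTemperateGrowth (hθ : IsTestFunction θ) (j : ℤ) :
    (dyadicSymbol θ j).HasTemperateGrowth :=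
  (hθ.comp_dyadicScale j).hasCompactSupport_ofReal.hasTemperateGrowth
    (hθ.comp_dyadicScale j).contDiff_ofReal

/-- The multipliers `θ(2^{-j} D)` are uniformly bounded on `L^p`. -/
lemma IsTestFunction.exists_isMultiplier (hθ : IsTestFunction θ) (hp : p ≠ ∞) :
    ∃ (C : ℝ≥0) (T : ℤ → Lp ℂ p (volume : Measure (Rd d)) →L[ℂ] Lp ℂ p (volume : Measure (Rd d))),
      (∀ j, IsMultiplier (T j) (dyadicSymbol θ j)) ∧ ∀ j f, ‖T j f‖ ≤ C * ‖f‖ := by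
  obtain ⟨C, hC⟩ := exists_isMultiplier_schwartz hp
    (hθ.hasCompactSupport_ofReal.toSchwartzMap hθ.contDiff_ofReal)
  choose T hT hTn using hC
  refine ⟨C, fun j => T ((2 : ℝ) ^ (-j) * (2 * Real.pi)), fun j => ?_, fun j => hTn _⟩
  refine (hT _).congr (Eventually.of_forall fun ξ => ?_)
  rw [dyadicSymbol, dyadicScale, smul_smul]
  rfl

lemma dyadicMultiplier_eq (θ : Rd d → ℝ) (j : ℤ) :
    dyadicMultiplier θ j = TemperedDistribution.fourierMultiplierCLM ℂ (dyadicSymbol θ j) := rfl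

lemma IsTestFunction.dyadicMultiplier_lpDist (hθ : IsTestFunction θ) (hp : p ≠ ∞) {j : ℤ}
    {T : Lp ℂ p (volume : Measure (Rd d)) →L[ℂ] Lp ℂ p (volume : Measure (Rd d))}
    (hT : IsMultiplier T (dyadicSymbol θ j)) (v : Lp ℂ p (volume : Measure (Rd d))) :
    dyadicMultiplier θ j (lpDist p v) = lpDist p (T v) :=
  fourierMultiplierCLM_lpDist hp (hθ.hasTemperateGrowth j) hT v

lemma IsTestFunction.dyadicMultiplier_dyadicMultiplier (hθ : IsTestFunction θ)
    (hθ' : IsTestFunction θ') (h : ∀ ξ, θ ξ ≠ 0 → θ' ξ = 1) (j : ℤ) (f : TempDist d) :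
    dyadicMultiplier θ' j (dyadicMultiplier θ j f) = dyadicMultiplier θ j f := by
  rw [dyadicMultiplier_eq, dyadicMultiplier_eq,
    TemperedDistribution.fourierMultiplierCLM_fourierMultiplierCLM_apply
      (hθ.hasTemperateGrowth j) (hθ'.hasTemperateGrowth j)]
  congr 2
  ext ξ
  simp only [Pi.mul_apply, dyadicSymbol]
  by_cases h0 : θ (dyadicScale j ξ) = 0
  · simp [h0]
  · simp [h _ h0]

lemma exists_isTestFunction_ball {r R : ℝ} (hr : 0 < r) (hR : r < R) :
    ∃ θ : Rd d → ℝ, IsTestFunction θ ∧ (∀ ξ, ‖ξ‖ ≤ r → θ ξ = 1) ∧ ∀ ξ, R ≤ ‖ξ‖ → θ ξ = 0 := by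
  let b : ContDiffBump (0 : Rd d) := ⟨r, R, hr, hR⟩
  refine ⟨b, ⟨b.contDiff, b.hasCompactSupport⟩, fun ξ hξ => ?_, fun ξ hξ => ?_⟩
  · exact b.one_of_mem_closedBall (by simpa using hξ)
  · exact b.zero_of_le_dist (by simpa using hξ)

/-- A cut-off equal to one on the annulus that carries `φ`, with slightly larger support. -/
lemma exists_isTestFunction_annulus : ∃ θ : Rd d → ℝ, IsTestFunction θ ∧
    (∀ ξ, 3 / 4 ≤ ‖ξ‖ → ‖ξ‖ ≤ 8 / 3 → θ ξ = 1) ∧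
    ∀ ξ, θ ξ ≠ 0 → 72 / 100 < ‖ξ‖ ∧ ‖ξ‖ < 27 / 10 := by
  obtain ⟨θ, hθ, hθ1, hθ2⟩ := exists_isTestFunction_ball (d := d) (r := 8 / 3) (R := 27 / 10)
    (by norm_num) (by norm_num)
  obtain ⟨θ', hθ', hθ1', hθ2'⟩ := exists_isTestFunction_ball (d := d) (r := 72 / 100) (R := 3 / 4)
    (by norm_num) (by norm_num)
  refine ⟨_, hθ.sub hθ', fun ξ h1 h2 => by simp [hθ1 ξ h2, hθ2' ξ h1], fun ξ h => ⟨?_, ?_⟩⟩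
  · by_contra! hle
    exact h (by simp [hθ1 ξ (hle.trans (by norm_num)), hθ1' ξ hle])
  · by_contra! hle
    exact h (by simp [hθ2 ξ hle, hθ2' ξ (le_trans (by norm_num) hle)])

variable {χ : Rd d → ℝ}

lemma IsCutoff.isTestFunction (hχ : IsCutoff χ) : IsTestFunction χ :=
  ⟨hχ.smooth, (isCompact_closedBall (0 : Rd d) (4 / 3)).of_isClosed_subset (isClosed_tsupport χ)
    hχ.support⟩

lemma IsCutoff.isTestFunction_block (hχ : IsCutoff χ) :
    IsTestFunction fun ξ => χ ((2 : ℝ)⁻¹ • ξ) - χ ξ :=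
  (hχ.isTestFunction.smul (by norm_num)).sub hχ.isTestFunction

lemma IsCutoff.norm_of_block_ne_zero (hχ : IsCutoff χ) {ξ : Rd d}
    (h : χ ((2 : ℝ)⁻¹ • ξ) - χ ξ ≠ 0) : 3 / 4 ≤ ‖ξ‖ ∧ ‖ξ‖ ≤ 8 / 3 := by
  have hs : ∀ ζ : Rd d, 4 / 3 < ‖ζ‖ → χ ζ = 0 := fun ζ hζ => by
    by_contra h0
    have := hχ.support (subset_tsupport _ h0)
    rw [mem_closedBall_zero_iff] at this
    linarith
  have hn : ‖(2 : ℝ)⁻¹ • ξ‖ = ‖ξ‖ / 2 := by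
    rw [norm_smul, Real.norm_of_nonneg (by norm_num)]; ring
  constructor
  · by_contra! hlt
    apply h
    rw [hχ.eq_one _ (by rw [mem_closedBall_zero_iff, hn]; linarith [norm_nonneg ξ]),
      hχ.eq_one _ (by rw [mem_closedBall_zero_iff]; linarith), sub_self]
  · by_contra! hlt
    apply h
    rw [hs _ (by rw [hn]; linarith), hs _ (by linarith), sub_self]

lemma IsCutoff.dyadicBlock_apply (hχ : IsCutoff χ) (j : ℤ) (f : TempDist d) :
    dyadicBlock χ j f = lowFreq χ (j + 1) f - lowFreq χ j f := by
  have h1 : ∀ (k : ℤ) (φ : 𝓢(Rd d, ℂ)), lowFreq χ k f φ =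
      f (𝓕 (SchwartzMap.smulLeftCLM ℂ (dyadicSymbol χ k) (𝓕⁻ φ))) := fun k φ => rfl
  have h2 : ∀ φ : 𝓢(Rd d, ℂ), dyadicBlock χ j f φ = f (𝓕 (SchwartzMap.smulLeftCLM ℂ
      (dyadicSymbol (fun ξ => χ ((2 : ℝ)⁻¹ • ξ) - χ ξ) j) (𝓕⁻ φ))) := fun φ => rfl
  ext φ
  have h3 : (lowFreq χ (j + 1) f - lowFreq χ j f) φ = lowFreq χ (j + 1) f φ - lowFreq χ j f φ := rfl
  have h4 : ∀ a b : 𝓢(Rd d, ℂ), 𝓕 a - 𝓕 b = 𝓕 (a - b) := fun a b =>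
    (map_sub (FourierTransform.fourierCLM ℂ 𝓢(Rd d, ℂ)) a b).symm
  rw [h3, h1, h1, h2, ← map_sub, h4]
  congr 2
  ext ξ
  rw [SchwartzMap.smulLeftCLM_apply_apply (hχ.isTestFunction_block.hasTemperateGrowth j),
    sub_apply, SchwartzMap.smulLeftCLM_apply_apply (hχ.isTestFunction.hasTemperateGrowth _),
    SchwartzMap.smulLeftCLM_apply_apply (hχ.isTestFunction.hasTemperateGrowth _), ← sub_smul]
  congr 1
  simp only [dyadicSymbol]
  rw [dyadicScale_eq j (j + 1), Complex.ofReal_sub]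
  congr 4
  simp

lemma enorm_apply_le_lpNormDist (u : TempDist d) (φ : 𝓢(Rd d, ℂ)) :
    ‖u φ‖ₑ ≤ lpNormDist ∞ u * ((∫⁻ x, ‖φ x‖ₑ) + 1) := by
  have h0 : (∫⁻ x, ‖φ x‖ₑ) + 1 ≠ ∞ := ENNReal.add_ne_top.2 ⟨φ.integrable.2.ne, ENNReal.one_ne_top⟩
  have h1 : (∫⁻ x, ‖φ x‖ₑ) + 1 ≠ 0 := by simp
  rw [← ENNReal.div_le_iff_le_mul (Or.inl h1) (Or.inl h0)]
  refine le_iInf fun v => le_iInf fun hv => le_iInf fun huv => ?_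
  rw [ENNReal.div_le_iff_le_mul (Or.inl h1) (Or.inl h0), (huv φ).2]
  calc ‖∫ x, v x * φ x‖ₑ ≤ ∫⁻ x, ‖v x * φ x‖ₑ := enorm_integral_le_lintegral_enorm _
    _ ≤ ∫⁻ x, eLpNorm v ∞ volume * ‖φ x‖ₑ := by
        refine lintegral_mono_ae ?_
        filter_upwards [enorm_ae_le_eLpNormEssSup v volume] with x hx
        rw [enorm_mul, eLpNorm_exponent_top]
        gcongr
    _ = eLpNorm v ∞ volume * ∫⁻ x, ‖φ x‖ₑ := lintegral_const_mul' _ _ hv.2.ne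
    _ ≤ _ := by gcongr; exact le_self_add

/-- The low frequency part of an element of `S'_h` tends to zero. -/
lemma tendsto_lowFreq_atBot {f : TempDist d} (hf : f ∈ SPrimeH χ) :
    Tendsto (fun j => lowFreq χ j f) atBot (𝓝 0) := by
  rw [PointwiseConvergenceCLM.tendsto_iff_forall_tendsto]
  intro φ
  have h0 : (∫⁻ x, ‖φ x‖ₑ) + 1 ≠ ∞ := ENNReal.add_ne_top.2 ⟨φ.integrable.2.ne, ENNReal.one_ne_top⟩
  have h1 : Tendsto (fun j => lpNormDist ∞ (lowFreq χ j f) * ((∫⁻ x, ‖φ x‖ₑ) + 1)) atBot (𝓝 0) := by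
    simpa using ENNReal.Tendsto.mul_const hf (Or.inr h0)
  rw [show ((0 : TempDist d) φ) = 0 from rfl, tendsto_zero_iff_enorm_tendsto_zero]
  exact tendsto_of_tendsto_of_tendsto_of_le_of_le tendsto_const_nhds h1 (fun _ => zero_le)
    (fun j => enorm_apply_le_lpNormDist _ φ)

/-- An element of `S'_h` is the sum of its dyadic blocks, up to any fixed frequency. -/
lemma tendsto_sum_dyadicBlock (hχ : IsCutoff χ) {f : TempDist d} (hf : f ∈ SPrimeH χ) (j : ℤ) :
    Tendsto (fun N : ℕ => ∑ n ∈ Finset.range N, dyadicBlock χ (j - 1 - n) f) atTop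
      (𝓝 (lowFreq χ j f)) := by
  have h1 : ∀ N : ℕ, ∑ n ∈ Finset.range N, dyadicBlock χ (j - 1 - n) f =
      lowFreq χ j f - lowFreq χ (j - N) f := fun N => by
    induction N with
    | zero => simp
    | succ N ih =>
      rw [Finset.sum_range_succ, ih, hχ.dyadicBlock_apply]
      have e1 : j - 1 - (N : ℤ) + 1 = j - N := by ring
      have e2 : j - 1 - (N : ℤ) = j - ((N + 1 : ℕ) : ℤ) := by push_cast; ring
      rw [e1, e2]
      abel
  simp only [h1]
  have h2 : Tendsto (fun N : ℕ => j - (N : ℤ)) atTop atBot :=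
    tendsto_atBot_add_const_left _ j (tendsto_neg_atTop_atBot.comp tendsto_natCast_atTop_atTop)
  simpa using tendsto_const_nhds.sub ((tendsto_lowFreq_atBot hf).comp h2)

end Dyadic

/-! ### Weighted sequence spaces -/

section Sequences

/-- Minkowski's inequality for series of nonnegative functions. -/
lemma eLpNorm_tsum_le {α ι : Type*} [MeasurableSpace α] [Countable ι] {μ : Measure α} {r : ℝ≥0∞}
    (hr : 1 ≤ r) {f : ι → α → ℝ≥0∞} (hf : ∀ i, Measurable (f i)) :
    eLpNorm (fun x => ∑' i, f i x) r μ ≤ ∑' i, eLpNorm (f i) r μ := by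
  rcases eq_or_ne r ∞ with rfl | hr'
  · simp only [eLpNorm_exponent_top]
    refine essSup_le_of_ae_le _ ?_
    filter_upwards [ae_all_iff.2 fun i => enorm_ae_le_eLpNormEssSup (f i) μ] with x hx
    exact ENNReal.tsum_le_tsum hx
  have hr0 : r ≠ 0 := (zero_lt_one.trans_le hr).ne'
  have hpos : 0 < r.toReal := ENNReal.toReal_pos hr0 hr'
  have hsum : ∀ s : Finset ι, ∫⁻ x, (∑ i ∈ s, f i x) ^ r.toReal ∂μ ≤
      (∑' i, eLpNorm (f i) r μ) ^ r.toReal := fun s => by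
    have h1 : eLpNorm (∑ i ∈ s, f i) r μ ≤ ∑' i, eLpNorm (f i) r μ :=
      (eLpNorm_sum_le (fun i _ => (hf i).aestronglyMeasurable) hr).trans (ENNReal.sum_le_tsum s)
    rw [eLpNorm_eq_lintegral_rpow_enorm_toReal hr0 hr', one_div,
      ENNReal.rpow_inv_le_iff hpos] at h1
    simpa using h1
  rw [eLpNorm_eq_lintegral_rpow_enorm_toReal hr0 hr', one_div, ENNReal.rpow_inv_le_iff hpos]
  have h2 : ∀ x, ‖∑' i, f i x‖ₑ ^ r.toReal =
      ⨆ s : Finset ι, (∑ i ∈ s, f i x) ^ r.toReal := fun x => by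
    rw [enorm_eq_self, ENNReal.tsum_eq_iSup_sum]
    exact (ENNReal.orderIsoRpow r.toReal hpos).map_iSup _
  simp only [h2]
  rw [lintegral_iSup_directed]
  · exact iSup_le hsum
  · intro s
    exact ((Finset.measurable_sum s fun i _ => hf i).pow_const _).aemeasurable
  · refine directed_of_isDirected_le fun s t hst x => ?_
    exact ENNReal.rpow_le_rpow (Finset.sum_le_sum_of_subset hst) hpos.le

lemma eLpNorm_const_mul_count (c : ℝ≥0∞) (hc : c ≠ ∞) (x : ℤ → ℝ≥0∞) (r : ℝ≥0∞) :
    eLpNorm (fun k => c * x k) r Measure.count ≤ c * eLpNorm x r Measure.count := by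
  lift c to ℝ≥0 using hc
  exact eLpNorm_le_nnreal_smul_eLpNorm_of_ae_le_mul' (Eventually.of_forall fun k => by simp) r

lemma eLpNorm_comp_sub_count (x : ℤ → ℝ≥0∞) (n : ℤ) (r : ℝ≥0∞) :
    eLpNorm (fun k => x (k - n)) r Measure.count = eLpNorm x r Measure.count := by
  have h : MeasurePreserving (fun k : ℤ => k - n) Measure.count Measure.count :=
    measurePreserving_sub_right _ n
  exact eLpNorm_comp_measurePreserving (measurable_of_countable x).aestronglyMeasurable h

/-- Young's inequality `ℓ^1 * ℓ^r ⊆ ℓ^r`. -/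
lemma eLpNorm_tsum_mul_sub_le {r : ℝ≥0∞} (hr : 1 ≤ r) {c : ℤ → ℝ≥0∞} (hc : ∀ n, c n ≠ ∞)
    (x : ℤ → ℝ≥0∞) :
    eLpNorm (fun k => ∑' n, c n * x (k - n)) r Measure.count ≤
      (∑' n, c n) * eLpNorm x r Measure.count := by
  refine (eLpNorm_tsum_le hr fun n => measurable_of_countable _).trans ?_
  rw [← ENNReal.tsum_mul_right]
  refine ENNReal.tsum_le_tsum fun n => ?_
  rw [← eLpNorm_comp_sub_count x n r]
  exact eLpNorm_const_mul_count (c n) (hc n) _ r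

/-- Hölder's inequality for sequences. -/
lemma eLpNorm_mul_le_count {r r₁ r₂ : ℝ≥0∞} (hr : r⁻¹ = r₁⁻¹ + r₂⁻¹) {x y : ℤ → ℝ≥0∞}
    (hx : ∀ j, x j ≠ ∞) (hy : ∀ j, y j ≠ ∞) :
    eLpNorm (fun j => x j * y j) r Measure.count ≤
      eLpNorm x r₁ Measure.count * eLpNorm y r₂ Measure.count := by
  have : ENNReal.HolderTriple r₁ r₂ r := ⟨hr.symm⟩
  lift x to ℤ → ℝ≥0 using hx
  lift y to ℤ → ℝ≥0 using hy
  have h := eLpNorm_le_eLpNorm_mul_eLpNorm_of_nnnorm (μ := Measure.count) (p := r₁) (q := r₂)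
    (r := r) (f := fun j => (x j : ℝ)) (g := fun j => (y j : ℝ))
    (measurable_of_countable _).aestronglyMeasurable
    (measurable_of_countable _).aestronglyMeasurable
    (fun a b => a * b) 1 (Eventually.of_forall fun j => by simp)
  have e : ∀ z : ℤ → ℝ≥0, ∀ q, eLpNorm (fun j => (z j : ℝ)) q Measure.count =
      eLpNorm (fun j => (z j : ℝ≥0∞)) q Measure.count := fun z q =>
    eLpNorm_congr_enorm_ae (Eventually.of_forall fun j => by simp [enorm])
  rw [ENNReal.coe_one, one_mul, e x, e y] at h
  refine le_of_eq_of_le (eLpNorm_congr_enorm_ae (Eventually.of_forall fun j => ?_)) h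
  simp [enorm_mul]

lemma eLpNorm_mono_count {r : ℝ≥0∞} {x y : ℤ → ℝ≥0∞} (h : ∀ j, x j ≤ y j) :
    eLpNorm x r Measure.count ≤ eLpNorm y r Measure.count :=
  eLpNorm_mono_enorm fun j => by simpa using h j

lemma le_eLpNorm_count {r : ℝ≥0∞} (hr : 1 ≤ r) (x : ℤ → ℝ≥0∞) (j : ℤ) :
    x j ≤ eLpNorm x r Measure.count := by
  rcases eq_or_ne r ∞ with rfl | hr'
  · rw [eLpNorm_exponent_top]
    have h := enorm_ae_le_eLpNormEssSup x Measure.count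
    rw [Measure.ae_count_iff] at h
    simpa using h j
  have hr0 : r ≠ 0 := (zero_lt_one.trans_le hr).ne'
  have hpos : 0 < r.toReal := ENNReal.toReal_pos hr0 hr'
  rw [eLpNorm_eq_lintegral_rpow_enorm_toReal hr0 hr', lintegral_count, one_div,
    ENNReal.le_rpow_inv_iff hpos]
  simpa using ENNReal.le_tsum (f := fun i => ‖x i‖ₑ ^ r.toReal) j

/-- A weight of the form `2^{ns}`. -/
def dyadicWeight (s : ℝ) (n : ℤ) : ℝ≥0∞ := (2 : ℝ≥0∞) ^ ((n : ℝ) * s)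

lemma dyadicWeight_ne_top (s : ℝ) (n : ℤ) : dyadicWeight s n ≠ ∞ :=
  ENNReal.rpow_ne_top_of_ne_zero (by simp) (by simp)

lemma dyadicWeight_ne_zero (s : ℝ) (n : ℤ) : dyadicWeight s n ≠ 0 := by
  simp [dyadicWeight, ENNReal.rpow_eq_zero_iff]

lemma dyadicWeight_add (s : ℝ) (m n : ℤ) :
    dyadicWeight s (m + n) = dyadicWeight s m * dyadicWeight s n := by
  rw [dyadicWeight, dyadicWeight, dyadicWeight, ← ENNReal.rpow_add _ _ (by simp) (by simp)]
  congr 1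
  push_cast
  ring

lemma dyadicWeight_mul (s s' : ℝ) (n : ℤ) :
    dyadicWeight s n * dyadicWeight s' n = dyadicWeight (s + s') n := by
  rw [dyadicWeight, dyadicWeight, dyadicWeight, ← ENNReal.rpow_add _ _ (by simp) (by simp), mul_add]

/-- Geometric series over a half line of integers. -/
lemma tsum_dyadicWeight_ne_top {s : ℝ} (hs : 0 < s) (m : ℤ) :
    ∑' n : ℤ, (if n ≤ m then dyadicWeight s n else 0) ≠ ∞ := by
  have hinj : Function.Injective fun n : ℕ => m - (n : ℤ) := fun a b h => by simpa using h
  have hsupp : Function.support (fun n : ℤ => if n ≤ m then dyadicWeight s n else 0) ⊆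
      Set.range fun n : ℕ => m - (n : ℤ) := by
    intro n hn
    have : n ≤ m := by
      by_contra h
      simp [h] at hn
    exact ⟨(m - n).toNat, by simp only; omega⟩
  rw [← hinj.tsum_eq hsupp]
  have h1 : ∀ n : ℕ, (if m - (n : ℤ) ≤ m then dyadicWeight s (m - n) else 0) =
      dyadicWeight s m * (((2 : ℝ≥0∞) ^ (-s)) ^ n) := fun n => by
    rw [if_pos (by omega), sub_eq_add_neg, dyadicWeight_add, dyadicWeight, dyadicWeight,
      ← ENNReal.rpow_natCast, ← ENNReal.rpow_mul]
    congr 2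
    push_cast
    ring
  simp only [h1]
  rw [ENNReal.tsum_mul_left, ENNReal.tsum_geometric]
  refine ENNReal.mul_ne_top (dyadicWeight_ne_top s m) ?_
  rw [ENNReal.inv_ne_top]
  have : (2 : ℝ≥0∞) ^ (-s) < 1 := ENNReal.rpow_lt_one_of_one_lt_of_neg (by norm_num) (by linarith)
  exact (tsub_pos_iff_lt.2 this).ne'

end Sequences

/-! ### Dyadic blocks of series of localized terms -/

section LocalizedBlocks

variable {d : ℕ} {χ : Rd d → ℝ} {p p₁ p₂ : ℝ≥0∞} [Fact (1 ≤ p)] [Fact (1 ≤ p₁)] [Fact (1 ≤ p₂)]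

lemma IsMultiplier.apply_apply_eq_self (hp : p ≠ ∞) {m m' : Rd d → ℂ}
    {S T : Lp ℂ p (volume : Measure (Rd d)) →L[ℂ] Lp ℂ p (volume : Measure (Rd d))}
    (hS : IsMultiplier S m) (hT : IsMultiplier T m') (h : ∀ ξ, m' ξ ≠ 0 → m ξ = 1)
    (v : Lp ℂ p (volume : Measure (Rd d))) : S (T v) = T v := by
  refine congrArg (fun R => R v) ((hS.comp hT).ext hp (hT.congr (Eventually.of_forall fun ξ => ?_)))
  by_cases h0 : m' ξ = 0
  · simp [h0]
  · simp [h ξ h0]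

/-- The dyadic blocks of `e^{aΛ₁} f` may be chosen with exactly localized spectra: applying a
cut-off equal to one on the annulus of the block does not change the block. -/
lemma exists_localized_blocks (hχ : IsCutoff χ) (hp1 : 1 < p) (hp : p ≠ ∞) {θ : Rd d → ℝ}
    (hθ : IsTestFunction θ) (hθ1 : ∀ ξ, 3 / 4 ≤ ‖ξ‖ → ‖ξ‖ ≤ 8 / 3 → θ ξ = 1)
    {T : ℤ → Lp ℂ p (volume : Measure (Rd d)) →L[ℂ] Lp ℂ p (volume : Measure (Rd d))}
    (hT : ∀ j, IsMultiplier (T j) (dyadicSymbol θ j)) {C : ℝ≥0} (hC : ∀ j f, ‖T j f‖ ≤ C * ‖f‖)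
    {a : ℝ} (ha : 0 ≤ a) {f : TempDist d}
    (hf : ∀ j, expLambdaLpNorm a p (dyadicBlock χ j f) < ∞) :
    ∃ F : ℤ → Lp ℂ p (volume : Measure (Rd d)),
      (∀ j, dyadicBlock χ j f = lpDist p (expNegLambda hp a (F j))) ∧
      (∀ j, ‖F j‖ₑ ≤ (2 * C : ℝ≥0) * expLambdaLpNorm a p (dyadicBlock χ j f)) ∧
      ∀ j, ∃ F₀, F j = T j F₀ := by
  choose F hF hFn using fun j => exists_eq_lpDist_of_expLambdaLpNorm_lt_top hp1 hp ha (hf j)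
  refine ⟨fun j => T j (F j), fun j => ?_, fun j => ?_, fun j => ⟨F j, rfl⟩⟩
  · have h0 : dyadicMultiplier θ j (dyadicBlock χ j f) = dyadicBlock χ j f :=
      hχ.isTestFunction_block.dyadicMultiplier_dyadicMultiplier hθ (fun ξ hξ =>
        hθ1 ξ (hχ.norm_of_block_ne_zero hξ).1 (hχ.norm_of_block_ne_zero hξ).2) j f
    rw [← h0, hF j, hθ.dyadicMultiplier_lpDist hp (hT j),
      (hT j).comm hp (isMultiplier_expNegLambda hp ha)]
  · have h1 : ‖T j (F j)‖ₑ ≤ C * ‖F j‖ₑ := by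
      rw [← ofReal_norm, ← ofReal_norm, ← ENNReal.ofReal_coe_nnreal,
        ← ENNReal.ofReal_mul (by positivity)]
      exact ENNReal.ofReal_le_ofReal (hC j _)
    calc ‖T j (F j)‖ₑ ≤ C * ‖F j‖ₑ := h1
      _ ≤ C * (2 * expLambdaLpNorm a p (dyadicBlock χ j f)) := by gcongr; exact hFn j
      _ = _ := by push_cast; ring

/-- The spectrum of the product of a low frequency part and a dyadic block lies in an annulus. The
frequencies `η` of `ψ` are below `7/10` and the frequencies `ζ` of `θ` above `72/100`, which keeps
`η + ζ` away from zero. -/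
lemma block_lowFreq_mul_eq_zero (hχ : IsCutoff χ) {θ ψ : Rd d → ℝ}
    (hθ : ∀ ξ, θ ξ ≠ 0 → 72 / 100 < ‖ξ‖ ∧ ‖ξ‖ < 27 / 10) (hψ : ∀ ξ, 7 / 10 ≤ ‖ξ‖ → ψ ξ = 0)
    {j k : ℤ} (hjk : k - j ∉ Finset.Icc (-7 : ℤ) 7) (η ζ : Rd d) :
    dyadicSymbol (fun ξ => χ ((2 : ℝ)⁻¹ • ξ) - χ ξ) k (η + ζ) *
      (dyadicSymbol ψ j η * dyadicSymbol θ j ζ) = 0 := by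
  by_contra hne
  simp only [dyadicSymbol, mul_eq_zero, Complex.ofReal_eq_zero, not_or] at hne
  obtain ⟨h1, h2, h3⟩ := hne
  obtain ⟨h4, h5⟩ := hχ.norm_of_block_ne_zero h1
  obtain ⟨h6, h7⟩ := hθ _ h3
  have h8 : ‖dyadicScale j η‖ < 7 / 10 := by
    by_contra! h
    exact h2 (hψ _ h)
  rw [norm_dyadicScale j k, dyadicScale_add] at h4 h5
  have h9 := norm_add_le (dyadicScale j η) (dyadicScale j ζ)
  have h10 := norm_sub_le_norm_add (dyadicScale j ζ) (dyadicScale j η)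
  rw [add_comm (dyadicScale j ζ)] at h10
  rw [Finset.mem_Icc, not_and_or, not_le, not_le] at hjk
  rcases hjk with h | h
  · have : (2 : ℝ) ^ (8 : ℤ) ≤ 2 ^ (j - k) := zpow_le_zpow_right₀ (by norm_num) (by omega)
    norm_num at this
    nlinarith
  · have : (2 : ℝ) ^ (j - k) ≤ 2 ^ (-8 : ℤ) := zpow_le_zpow_right₀ (by norm_num) (by omega)
    norm_num at this
    nlinarith [norm_nonneg (dyadicScale j η + dyadicScale j ζ)]

/-- The spectrum of the product of two neighbouring dyadic blocks lies in a ball. -/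
lemma block_block_mul_eq_zero (hχ : IsCutoff χ) {θ : Rd d → ℝ}
    (hθ : ∀ ξ, θ ξ ≠ 0 → 72 / 100 < ‖ξ‖ ∧ ‖ξ‖ < 27 / 10)
    {j j' k : ℤ} (hjj : j' ≤ j + 1) (hjk : ¬ k - j ≤ 3) (η ζ : Rd d) :
    dyadicSymbol (fun ξ => χ ((2 : ℝ)⁻¹ • ξ) - χ ξ) k (η + ζ) *
      (dyadicSymbol θ j η * dyadicSymbol θ j' ζ) = 0 := by
  by_contra hne
  simp only [dyadicSymbol, mul_eq_zero, Complex.ofReal_eq_zero, not_or] at hne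
  obtain ⟨h1, h2, h3⟩ := hne
  obtain ⟨h4, -⟩ := hχ.norm_of_block_ne_zero h1
  obtain ⟨-, h5⟩ := hθ _ h2
  obtain ⟨-, h6⟩ := hθ _ h3
  rw [dyadicScale_add] at h4
  have h7 := norm_add_le (dyadicScale k η) (dyadicScale k ζ)
  rw [norm_dyadicScale j k η, norm_dyadicScale j' k ζ] at h7
  have h8 : (2 : ℝ) ^ (j - k) ≤ 2 ^ (-4 : ℤ) := zpow_le_zpow_right₀ (by norm_num) (by omega)
  have h9 : (2 : ℝ) ^ (j' - k) ≤ 2 ^ (-3 : ℤ) := zpow_le_zpow_right₀ (by norm_num) (by omega)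
  norm_num at h8 h9
  nlinarith [norm_nonneg (dyadicScale j η), norm_nonneg (dyadicScale j' ζ)]

/-- A cut-off at the frequency `2^j` does not change the blocks of frequency at most
`2^(j - 2)`. -/
lemma low_eq_one_of_block (θ ψ : Rd d → ℝ)
    (hθ : ∀ ξ, θ ξ ≠ 0 → 72 / 100 < ‖ξ‖ ∧ ‖ξ‖ < 27 / 10) (hψ : ∀ ξ, ‖ξ‖ ≤ 68 / 100 → ψ ξ = 1)
    {j j' : ℤ} (h : j' ≤ j - 2) (ξ : Rd d) (hξ : dyadicSymbol θ j' ξ ≠ 0) :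
    dyadicSymbol ψ j ξ = 1 := by
  rw [dyadicSymbol, ne_eq, Complex.ofReal_eq_zero] at hξ
  obtain ⟨-, h1⟩ := hθ _ hξ
  rw [dyadicSymbol, hψ, Complex.ofReal_one]
  rw [norm_dyadicScale j' j]
  have h2 : (2 : ℝ) ^ (j' - j) ≤ 2 ^ (-2 : ℤ) := zpow_le_zpow_right₀ (by norm_num) (by omega)
  norm_num at h2
  nlinarith [norm_nonneg (dyadicScale j' ξ)]

lemma tendsto_Icc_atBot_prod_atTop :
    Tendsto (fun N : ℤ × ℤ => Finset.Icc N.1 N.2) (atBot ×ˢ atTop) atTop := by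
  rw [tendsto_atTop]
  intro s
  have h1 : ∀ᶠ m : ℤ in atBot, ∀ i ∈ s, m ≤ i :=
    (Finset.eventually_all s).2 fun i _ => eventually_le_atBot i
  have h2 : ∀ᶠ m : ℤ in atTop, ∀ i ∈ s, i ≤ m :=
    (Finset.eventually_all s).2 fun i _ => eventually_ge_atTop i
  filter_upwards [h1.prod_mk h2] with N hN i hi
  exact Finset.mem_Icc.2 ⟨hN.1 i hi, hN.2 i hi⟩

lemma summable_of_tsum_enorm_ne_top {ι E : Type*} [NormedAddCommGroup E] [CompleteSpace E]
    {f : ι → E} (h : ∑' i, ‖f i‖ₑ ≠ ∞) : Summable f :=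
  Summable.of_nnnorm (ENNReal.tsum_coe_ne_top_iff_summable.1 h)

lemma enorm_tsum_le {ι E : Type*} [NormedAddCommGroup E] [CompleteSpace E] {f : ι → E}
    (h : ∑' i, ‖f i‖ₑ ≠ ∞) : ‖∑' i, f i‖ₑ ≤ ∑' i, ‖f i‖ₑ := by
  have h1 := ENNReal.tsum_coe_ne_top_iff_summable.1 h
  have h2 := nnnorm_tsum_le h1
  have h3 := ENNReal.coe_le_coe.2 h2
  rwa [ENNReal.coe_tsum h1] at h3

/-- The blocks of the series of the terms `e^{-aΛ₁} Y_j` converge as series in `L^p`. -/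
lemma hasSum_dyadicBlock (hχ : IsCutoff χ) (hp : p ≠ ∞) {a : ℝ} (ha : 0 ≤ a) {k : ℤ}
    {D : Lp ℂ p (volume : Measure (Rd d)) →L[ℂ] Lp ℂ p (volume : Measure (Rd d))}
    (hD : IsMultiplier D (dyadicSymbol (fun ξ => χ ((2 : ℝ)⁻¹ • ξ) - χ ξ) k))
    {Y : ℤ → Lp ℂ p (volume : Measure (Rd d))} (hY : Summable fun j => D (Y j)) :
    HasSum (fun j => dyadicBlock χ k (lpDist p (expNegLambda hp a (Y j))))
      (lpDist p (expNegLambda hp a (∑' j, D (Y j)))) := by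
  have h1 : ∀ j, dyadicBlock χ k (lpDist p (expNegLambda hp a (Y j))) =
      lpDist p (expNegLambda hp a (D (Y j))) := fun j => by
    have h2 := hχ.isTestFunction_block.dyadicMultiplier_lpDist hp hD (expNegLambda hp a (Y j))
    rw [hD.comm hp (isMultiplier_expNegLambda hp ha)] at h2
    exact h2
  simp only [h1]
  exact (lpDist p).hasSum ((expNegLambda hp a).hasSum hY.hasSum)

/-- The estimate of the series of the terms `e^{-aΛ₁} Y_j`, where the `k`-th block of `Y_j` vanishes
unless `k - j` satisfies `N`. The condition on `N` is that Young's inequality applies. -/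
lemma seriesEstimate_of_localized (hχ : IsCutoff χ) (hp1 : 1 < p) (hp : p ≠ ∞) {a : ℝ}
    (ha : 0 ≤ a)
    {D : ℤ → Lp ℂ p (volume : Measure (Rd d)) →L[ℂ] Lp ℂ p (volume : Measure (Rd d))}
    (hD : ∀ j, IsMultiplier (D j) (dyadicSymbol (fun ξ => χ ((2 : ℝ)⁻¹ • ξ) - χ ξ) j)) {C : ℝ≥0}
    (hC : ∀ j f, ‖D j f‖ ≤ C * ‖f‖) {N : ℤ → Prop} [DecidablePred N] {s : ℝ}
    (hN : ∑' n, (if N n then dyadicWeight s n else 0) ≠ ∞) {r : ℝ≥0∞} (hr : 1 ≤ r)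
    {Y : ℤ → Lp ℂ p (volume : Measure (Rd d))} (hY : ∀ j k, ¬ N (k - j) → D k (Y j) = 0)
    {K : ℝ≥0∞} (hK : K ≠ ∞)
    (hle : C * ((∑' n, if N n then dyadicWeight s n else 0) *
      eLpNorm (fun j => dyadicWeight s j * ‖Y j‖ₑ) r Measure.count) ≤ K) :
    SeriesEstimate χ a s p r (fun j => lpDist p (expNegLambda hp a (Y j))) K := by
  set c : ℤ → ℝ≥0∞ := fun n => if N n then dyadicWeight s n else 0 with hc
  set x : ℤ → ℝ≥0∞ := fun j => dyadicWeight s j * ‖Y j‖ₑ with hx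
  set u : ℤ → ℝ≥0∞ := fun k => C * ∑' n, c n * x (k - n) with hu
  have hcn : ∀ n, c n ≠ ∞ := fun n => ENNReal.ne_top_of_tsum_ne_top hN n
  have huK : eLpNorm u r Measure.count ≤ K := by
    refine le_trans (eLpNorm_const_mul_count C ENNReal.coe_ne_top _ r) (le_trans ?_ hle)
    gcongr
    exact eLpNorm_tsum_mul_sub_le hr hcn x
  have hDn : ∀ k v, ‖D k v‖ₑ ≤ C * ‖v‖ₑ := fun k v => by
    rw [← ofReal_norm, ← ofReal_norm, ← ENNReal.ofReal_coe_nnreal,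
      ← ENNReal.ofReal_mul (by positivity)]
    exact ENNReal.ofReal_le_ofReal (hC k v)
  have hbu : ∀ k, dyadicWeight s k * ∑' j, ‖D k (Y j)‖ₑ ≤ u k := by
    intro k
    rw [hu]
    simp only
    rw [← (Equiv.subLeft k).tsum_eq (fun n => c n * x (k - n)), ← ENNReal.tsum_mul_left,
      ← ENNReal.tsum_mul_left]
    refine ENNReal.tsum_le_tsum fun j => ?_
    simp only [Equiv.subLeft_apply, sub_sub_cancel, hc, hx]
    by_cases hj : N (k - j)
    · rw [if_pos hj]
      calc dyadicWeight s k * ‖D k (Y j)‖ₑ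
          ≤ (dyadicWeight s (k - j) * dyadicWeight s j) * (C * ‖Y j‖ₑ) := by
            rw [← dyadicWeight_add, sub_add_cancel]
            gcongr
            exact hDn k _
        _ = _ := by ring
    · rw [hY j k hj]
      simp
  have hfin : ∀ k, ∑' j, ‖D k (Y j)‖ₑ ≠ ∞ := fun k htop => by
    have h1 := (hbu k).trans ((le_eLpNorm_count hr u k).trans huK)
    rw [htop, ENNReal.mul_top (dyadicWeight_ne_zero s k)] at h1
    exact hK (top_le_iff.1 h1)
  set B : ℤ → TempDist d := fun k => lpDist p (expNegLambda hp a (∑' j, D k (Y j))) with hB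
  have hsum : SeriesHasBlocks χ (fun j => lpDist p (expNegLambda hp a (Y j))) B := by
    intro k
    exact hasSum_dyadicBlock hχ hp ha (hD k) (summable_of_tsum_enorm_ne_top (hfin k))
  have hBK : expLambdaBesovNormOfBlocks a s p r B ≤ K := by
    refine le_trans (eLpNorm_mono_count fun k => ?_) huK
    refine le_trans ?_ (hbu k)
    exact mul_le_mul_right
      ((expLambdaLpNorm_lpDist_le hp1 hp ha _).trans (enorm_tsum_le (hfin k))) _
  refine ⟨⟨B, hsum, hBK⟩, fun w hw => ?_⟩
  have hblock : (fun k => dyadicBlock χ k w) = B := by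
    ext1 k
    have h1 := (((dyadicBlock χ k).continuous.tendsto w).comp hw)
    have h2 : Tendsto (fun s : Finset ℤ => ∑ j ∈ s,
        dyadicBlock χ k (lpDist p (expNegLambda hp a (Y j)))) atTop (𝓝 (B k)) := by
      simpa [HasSum] using hsum k
    refine tendsto_nhds_unique h1 ((h2.comp tendsto_Icc_atBot_prod_atTop).congr fun M => ?_)
    simp only [Function.comp_apply, map_sum]
  rw [expLambdaBesovNorm, hblock]
  exact hBK

end LocalizedBlocks

/-! ### The paraproduct and the remainder -/

section Products

variable {d : ℕ} {χ : Rd d → ℝ} {p p₁ p₂ : ℝ≥0∞} [Fact (1 ≤ p)] [Fact (1 ≤ p₁)] [Fact (1 ≤ p₂)]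

/-- The sum over the blocks of lower frequency, with the weight `2^{-jσ}`, maps `ℓ^{r₁}` to
`ℓ^ρ`, where `ρ = r₁` if `σ > 0`, and `ρ = ∞` if `σ = 0` and `r₁ = 1`. In both cases `ρ` is the
exponent that Hölder's inequality with `ℓ^{r₂}` requires. -/
lemma exists_eLpNorm_lowFreq_le {σ : ℝ} {r r₁ r₂ : ℝ≥0∞} (hr₁ : 1 ≤ r₁)
    (h : (0 < σ ∧ r⁻¹ = r₁⁻¹ + r₂⁻¹) ∨ (σ = 0 ∧ r₁ = 1 ∧ r = r₂)) :
    ∃ (ρ : ℝ≥0∞) (C : ℝ≥0), 1 ≤ ρ ∧ r⁻¹ = ρ⁻¹ + r₂⁻¹ ∧ ∀ x : ℤ → ℝ≥0∞,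
      eLpNorm (fun j => ∑' m, (if 2 ≤ m then dyadicWeight (-σ) m else 0) * x (j - m)) ρ
        Measure.count ≤ C * eLpNorm x r₁ Measure.count := by
  rcases h with ⟨hσ, hr⟩ | ⟨rfl, rfl, rfl⟩
  · have h1 : ∑' m : ℤ, (if 2 ≤ m then dyadicWeight (-σ) m else 0) =
        ∑' m : ℤ, (if m ≤ -2 then dyadicWeight σ m else 0) := by
      rw [← (Equiv.neg ℤ).tsum_eq]
      refine tsum_congr fun m => ?_
      have : (2 ≤ -m) ↔ m ≤ -2 := by omega
      simp only [Equiv.neg_apply, this]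
      congr 1
      simp [dyadicWeight]
    have h2 := tsum_dyadicWeight_ne_top hσ (-2)
    rw [← h1] at h2
    refine ⟨r₁, (∑' m : ℤ, (if 2 ≤ m then dyadicWeight (-σ) m else 0)).toNNReal, hr₁, hr,
      fun x => ?_⟩
    rw [ENNReal.coe_toNNReal h2]
    exact eLpNorm_tsum_mul_sub_le hr₁ (fun n => ENNReal.ne_top_of_tsum_ne_top h2 n) x
  · refine ⟨∞, 1, le_top, by simp, fun x => ?_⟩
    rw [eLpNorm_exponent_top, eLpNorm_one_eq_lintegral_enorm, lintegral_count, ENNReal.coe_one,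
      one_mul]
    refine essSup_le_of_ae_le _ (Eventually.of_forall fun j => ?_)
    simp only [enorm_eq_self]
    rw [← (Equiv.subLeft j).tsum_eq x]
    refine ENNReal.tsum_le_tsum fun m => ?_
    simp only [Equiv.subLeft_apply]
    split_ifs <;> simp [dyadicWeight]

/-- The low frequency parts `∑_{n ≤ j - 2} F_n` converge and are controlled in `ℓ^ρ`. -/
lemma exists_summable_lowFreq {E : Type*} [NormedAddCommGroup E] [CompleteSpace E] {σ : ℝ}
    {r₁ ρ : ℝ≥0∞} {C : ℝ≥0} (hρ : 1 ≤ ρ)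
    (hC : ∀ x : ℤ → ℝ≥0∞,
      eLpNorm (fun j => ∑' m, (if 2 ≤ m then dyadicWeight (-σ) m else 0) * x (j - m)) ρ
        Measure.count ≤ C * eLpNorm x r₁ Measure.count) {F : ℤ → E}
    (hF : eLpNorm (fun j => dyadicWeight (-σ) j * ‖F j‖ₑ) r₁ Measure.count < ∞) :
    (∀ j, Summable fun n : ℕ => F (j - 2 - n)) ∧
      eLpNorm (fun j => dyadicWeight (-σ) j * ‖∑' n : ℕ, F (j - 2 - n)‖ₑ) ρ Measure.count ≤
        C * eLpNorm (fun j => dyadicWeight (-σ) j * ‖F j‖ₑ) r₁ Measure.count := by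
  set x : ℤ → ℝ≥0∞ := fun j => dyadicWeight (-σ) j * ‖F j‖ₑ with hx
  set A : ℤ → ℝ≥0∞ := fun j => ∑' m, (if 2 ≤ m then dyadicWeight (-σ) m else 0) * x (j - m) with hA
  have hA_top : ∀ j, A j ≠ ∞ := fun j => (((le_eLpNorm_count hρ A j).trans (hC x)).trans_lt
    (ENNReal.mul_lt_top ENNReal.coe_lt_top hF)).ne
  have hsumA : ∀ j, dyadicWeight (-σ) j * ∑' n : ℕ, ‖F (j - 2 - n)‖ₑ ≤ A j := fun j => by
    have hinj : Function.Injective fun n : ℕ => (n : ℤ) + 2 := fun a b h => by simpa using h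
    refine le_trans (le_of_eq ?_) (ENNReal.tsum_comp_le_tsum_of_injective hinj _)
    rw [← ENNReal.tsum_mul_left]
    refine tsum_congr fun n => ?_
    simp only [hx]
    rw [if_pos (by omega), ← mul_assoc, ← dyadicWeight_add]
    have e1 : (n : ℤ) + 2 + (j - (n + 2)) = j := by ring
    have e2 : j - ((n : ℤ) + 2) = j - 2 - n := by ring
    rw [e1, e2]
  have hfin : ∀ j, ∑' n : ℕ, ‖F (j - 2 - n)‖ₑ ≠ ∞ := fun j htop => by
    have h1 := hsumA j
    rw [htop, ENNReal.mul_top (dyadicWeight_ne_zero _ j)] at h1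
    exact hA_top j (top_le_iff.1 h1)
  exact ⟨fun j => summable_of_tsum_enorm_ne_top (hfin j), (eLpNorm_mono_count fun j =>
    le_trans (mul_le_mul_right (enorm_tsum_le (hfin j)) _) (hsumA j)).trans (hC x)⟩

/-- The sum over neighbouring blocks is bounded on weighted sequence spaces. -/
lemma exists_eLpNorm_neighbours_le {r : ℝ≥0∞} (hr : 1 ≤ r) (s : ℝ) :
    ∃ C : ℝ≥0, ∀ y : ℤ → ℝ≥0∞,
      eLpNorm (fun j => dyadicWeight s j * ∑ j' ∈ Finset.Icc (j - 1) (j + 1), y j') r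
        Measure.count ≤ C * eLpNorm (fun j => dyadicWeight s j * y j) r Measure.count := by
  set c : ℤ → ℝ≥0∞ := fun n => if n ∈ Finset.Icc (-1 : ℤ) 1 then dyadicWeight s n else 0 with hc
  have hcS : ∑' n, c n ≠ ∞ := by
    rw [tsum_eq_sum (s := Finset.Icc (-1 : ℤ) 1) fun n hn => if_neg hn]
    exact ENNReal.sum_ne_top.2 fun n hn => by
      simp only [if_pos hn]
      exact dyadicWeight_ne_top _ n
  refine ⟨(∑' n, c n).toNNReal, fun y => ?_⟩
  rw [ENNReal.coe_toNNReal hcS]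
  refine le_trans (eLpNorm_mono_count fun j => le_of_eq ?_)
    (eLpNorm_tsum_mul_sub_le hr (fun n => ENNReal.ne_top_of_tsum_ne_top hcS n) _)
  rw [← (Equiv.subLeft j).tsum_eq (fun n => c n * (dyadicWeight s (j - n) * y (j - n))),
    tsum_eq_sum (s := Finset.Icc (j - 1) (j + 1)), Finset.mul_sum]
  · refine Finset.sum_congr rfl fun j' hj' => ?_
    have hmem : j - j' ∈ Finset.Icc (-1 : ℤ) 1 := by
      rw [Finset.mem_Icc] at hj' ⊢
      omega
    simp only [Equiv.subLeft_apply, hc, if_pos hmem, sub_sub_cancel]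
    rw [← mul_assoc, ← dyadicWeight_add, sub_add_cancel]
  · intro j' hj'
    have hmem : j - j' ∉ Finset.Icc (-1 : ℤ) 1 := by
      rw [Finset.mem_Icc] at hj' ⊢
      omega
    simp only [Equiv.subLeft_apply, hc, if_neg hmem, zero_mul]

/-- Hölder's inequality for weighted sequences. -/
lemma eLpNorm_dyadicWeight_mul_le {r r₁ r₂ : ℝ≥0∞} (hr₁ : 1 ≤ r₁) (hr₂ : 1 ≤ r₂)
    (h : r⁻¹ = r₁⁻¹ + r₂⁻¹) {s₁ s₂ : ℝ} {K : ℝ≥0} {x y z : ℤ → ℝ≥0∞}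
    (hx : eLpNorm (fun j => dyadicWeight s₁ j * x j) r₁ Measure.count < ∞)
    (hy : eLpNorm (fun j => dyadicWeight s₂ j * y j) r₂ Measure.count < ∞)
    (hz : ∀ j, z j ≤ K * (x j * y j)) :
    eLpNorm (fun j => dyadicWeight (s₁ + s₂) j * z j) r Measure.count ≤
      K * (eLpNorm (fun j => dyadicWeight s₁ j * x j) r₁ Measure.count *
        eLpNorm (fun j => dyadicWeight s₂ j * y j) r₂ Measure.count) := by
  refine le_trans (eLpNorm_mono_count fun j => ?_) ((eLpNorm_const_mul_count K ENNReal.coe_ne_top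
    (fun j => (dyadicWeight s₁ j * x j) * (dyadicWeight s₂ j * y j)) r).trans (by
      gcongr
      exact eLpNorm_mul_le_count h
        (fun j => ((le_eLpNorm_count hr₁ (fun j => dyadicWeight s₁ j * x j) j).trans_lt hx).ne)
        (fun j => ((le_eLpNorm_count hr₂ (fun j => dyadicWeight s₂ j * y j) j).trans_lt hy).ne)))
  calc dyadicWeight (s₁ + s₂) j * z j ≤ dyadicWeight (s₁ + s₂) j * (K * (x j * y j)) := by
        gcongr; exact hz j
    _ = _ := by rw [← dyadicWeight_mul]; ring

/-- The low frequency part as the sum in `L^p` of the preceding blocks. -/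
lemma lowFreq_eq_lpDist_tsum (hχ : IsCutoff χ) (hp : p ≠ ∞) {a : ℝ} {f : TempDist d}
    (hf : f ∈ SPrimeH χ) {F : ℤ → Lp ℂ p (volume : Measure (Rd d))}
    (hF : ∀ j, dyadicBlock χ j f = lpDist p (expNegLambda hp a (F j))) (j : ℤ)
    (hs : Summable fun n : ℕ => F (j - 2 - n)) :
    lowFreq χ (j - 1) f = lpDist p (expNegLambda hp a (∑' n : ℕ, F (j - 2 - n))) := by
  have h1 := tendsto_sum_dyadicBlock hχ hf (j - 1)
  have h2 := ((lpDist p).hasSum ((expNegLambda hp a).hasSum hs.hasSum)).tendsto_sum_nat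
  refine tendsto_nhds_unique h1 (h2.congr fun N => Finset.sum_congr rfl fun n _ => ?_)
  rw [← hF]
  congr 2
  ring

lemma isProduct_lpDist [ENNReal.HolderTriple p₁ p₂ p] (u : Lp ℂ p₁ (volume : Measure (Rd d)))
    (v : Lp ℂ p₂ (volume : Measure (Rd d))) :
    IsProduct (lpDist p₁ u) (lpDist p₂ v) (lpDist p (lpMul p p₁ p₂ u v)) :=
  ⟨u, v, isGivenBy_lpDist u, isGivenBy_lpDist v,
    (isGivenBy_lpDist _).congr (lpMul_ae u v).symm⟩

lemma GevreyBesov.expLambdaLpNorm_lt_top {p : ℝ≥0∞} {a s : ℝ} {r : ℝ≥0∞} (hr : 1 ≤ r)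
    {f : TempDist d} (hf : f ∈ GevreyBesov χ a s p r) (j : ℤ) :
    expLambdaLpNorm a p (dyadicBlock χ j f) < ∞ := by
  have h1 := (le_eLpNorm_count hr _ j).trans_lt hf.2
  refine lt_top_iff_ne_top.2 fun htop => ?_
  simp only [htop] at h1
  change dyadicWeight s j * ∞ < ∞ at h1
  rw [ENNReal.mul_top (dyadicWeight_ne_zero s j)] at h1
  exact h1.ne rfl

lemma eLpNorm_dyadicWeight_mul_enorm_le {a s : ℝ} {r : ℝ≥0∞} {f : TempDist d} {C : ℝ≥0}
    {F : ℤ → Lp ℂ p (volume : Measure (Rd d))}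
    (hF : ∀ j, ‖F j‖ₑ ≤ C * expLambdaLpNorm a p (dyadicBlock χ j f)) :
    eLpNorm (fun j => dyadicWeight s j * ‖F j‖ₑ) r Measure.count ≤
      C * expLambdaBesovNorm χ a s p r f := by
  refine le_trans (eLpNorm_mono_count fun j => ?_)
    (eLpNorm_const_mul_count C ENNReal.coe_ne_top _ r)
  calc dyadicWeight s j * ‖F j‖ₑ
      ≤ dyadicWeight s j * (C * expLambdaLpNorm a p (dyadicBlock χ j f)) := by gcongr; exact hF j
    _ = C * (dyadicWeight s j * expLambdaLpNorm a p (dyadicBlock χ j f)) := by ring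

lemma enorm_bilinear_apply_le
    {M : Lp ℂ p₁ (volume : Measure (Rd d)) →L[ℂ] Lp ℂ p₂ (volume : Measure (Rd d)) →L[ℂ]
      Lp ℂ p (volume : Measure (Rd d))} {K : ℝ≥0} (hM : ∀ u v, ‖M u v‖ ≤ K * ‖u‖ * ‖v‖)
    (u : Lp ℂ p₁ (volume : Measure (Rd d))) (v : Lp ℂ p₂ (volume : Measure (Rd d))) :
    ‖M u v‖ₑ ≤ K * ‖u‖ₑ * ‖v‖ₑ := by
  have h : ‖M u v‖₊ ≤ K * ‖u‖₊ * ‖v‖₊ := hM u v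
  simp only [enorm]
  exact_mod_cast h

/-- The estimate of the paraproduct, uniform in `a ≥ 0`. Its terms are `e^{-aΛ₁} M(V_j, G_j)`, where
`V_j` is the sum of the `F_n` with `n ≤ j - 2`. -/
theorem exists_paraproduct_estimate (hχ : IsCutoff χ) {r r₁ r₂ : ℝ≥0∞} (hp : 1 < p ∧ p < ∞)
    (hp₁ : 1 < p₁ ∧ p₁ < ∞) (hp₂ : 1 < p₂ ∧ p₂ < ∞) [ENNReal.HolderTriple p₁ p₂ p]
    (hr : 1 ≤ r) (hr₁ : 1 ≤ r₁) (hr₂ : 1 ≤ r₂) (s σ : ℝ)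
    (h : (0 < σ ∧ r⁻¹ = r₁⁻¹ + r₂⁻¹) ∨ (σ = 0 ∧ r₁ = 1 ∧ r = r₂)) :
    ∃ C : ℝ≥0, ∀ a : ℝ, 0 ≤ a →
      ∀ f ∈ GevreyBesov χ a (-σ) p₁ r₁, ∀ g ∈ GevreyBesov χ a s p₂ r₂,
        ∃ W : ℤ → TempDist d, IsParaproductTerms χ f g W ∧
          SeriesEstimate χ a (s - σ) p r W
            (C * expLambdaBesovNorm χ a (-σ) p₁ r₁ f * expLambdaBesovNorm χ a s p₂ r₂ g) := by
  obtain ⟨θ, hθ, hθ1, hθ2⟩ := exists_isTestFunction_annulus (d := d)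
  obtain ⟨ψ, hψ, hψ1, hψ2⟩ := exists_isTestFunction_ball (d := d) (r := 68 / 100) (R := 7 / 10)
    (by norm_num) (by norm_num)
  obtain ⟨C₁, T₁, hT₁, hTn₁⟩ := hθ.exists_isMultiplier hp₁.2.ne
  obtain ⟨C₂, T₂, hT₂, hTn₂⟩ := hθ.exists_isMultiplier hp₂.2.ne
  obtain ⟨C', L, hL, hLn⟩ := hψ.exists_isMultiplier hp₁.2.ne
  obtain ⟨C₃, D, hD, hDn⟩ := hχ.isTestFunction_block.exists_isMultiplier hp.2.ne
  obtain ⟨K, hK⟩ := exists_twistedProduct (d := d) hp hp₁ hp₂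
  obtain ⟨ρ, C₄, hρ, hρr, hlow⟩ := exists_eLpNorm_lowFreq_le hr₁ h
  have hN : ∑' n : ℤ, (if n ∈ Finset.Icc (-7 : ℤ) 7 then dyadicWeight (-σ + s) n else 0) ≠ ∞ := by
    rw [tsum_eq_sum (s := Finset.Icc (-7 : ℤ) 7) fun n hn => if_neg hn]
    exact ENNReal.sum_ne_top.2 fun n hn => by rw [if_pos hn]; exact dyadicWeight_ne_top _ n
  obtain ⟨S, hS⟩ := WithTop.ne_top_iff_exists.1 hN
  refine ⟨C₃ * (S * (K * ((C₄ * (2 * C₁)) * (2 * C₂)))), fun a ha f hf g hg => ?_⟩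
  obtain ⟨M, hM, ⟨m, hMm⟩, hME⟩ := hK a ha
  obtain ⟨F, hFf, hFn, hFT⟩ := exists_localized_blocks hχ hp₁.1 hp₁.2.ne hθ hθ1 hT₁ hTn₁ ha
    (GevreyBesov.expLambdaLpNorm_lt_top hr₁ hf)
  obtain ⟨G, hGg, hGn, hGT⟩ := exists_localized_blocks hχ hp₂.1 hp₂.2.ne hθ hθ1 hT₂ hTn₂ ha
    (GevreyBesov.expLambdaLpNorm_lt_top hr₂ hg)
  have hxn : eLpNorm (fun j => dyadicWeight (-σ) j * ‖F j‖ₑ) r₁ Measure.count ≤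
      (2 * C₁ : ℝ≥0) * expLambdaBesovNorm χ a (-σ) p₁ r₁ f := eLpNorm_dyadicWeight_mul_enorm_le hFn
  have hyn : eLpNorm (fun j => dyadicWeight s j * ‖G j‖ₑ) r₂ Measure.count ≤
      (2 * C₂ : ℝ≥0) * expLambdaBesovNorm χ a s p₂ r₂ g := eLpNorm_dyadicWeight_mul_enorm_le hGn
  have hx_top := hxn.trans_lt (ENNReal.mul_lt_top ENNReal.coe_lt_top hf.2)
  have hy_top := hyn.trans_lt (ENNReal.mul_lt_top ENNReal.coe_lt_top hg.2)
  obtain ⟨hsumm, hVn⟩ := exists_summable_lowFreq hρ hlow hx_top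
  obtain ⟨V, hV⟩ : ∃ V : ℤ → Lp ℂ p₁ (volume : Measure (Rd d)),
      ∀ j, V j = ∑' n : ℕ, F (j - 2 - n) := ⟨_, fun _ => rfl⟩
  simp only [← hV] at hVn
  -- the spectrum of `V j` lies in a ball, on which the symbol of `L j` equals one
  have hLV : ∀ j, L j (V j) = V j := fun j => by
    rw [hV j, (L j).map_tsum (hsumm j)]
    refine tsum_congr fun n => ?_
    obtain ⟨F₀, hF₀⟩ := hFT (j - 2 - n)
    rw [hF₀]
    exact (hL j).apply_apply_eq_self hp₁.2.ne (hT₁ _)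
      (low_eq_one_of_block θ ψ hθ2 hψ1 (by omega)) _
  refine ⟨fun j => lpDist p (expNegLambda hp.2.ne a (M (V j) (G j))), fun j => ?_, ?_⟩
  · beta_reduce
    rw [lowFreq_eq_lpDist_tsum hχ hp₁.2.ne hf.1 hFf j (hsumm j), ← hV, hGg j, ← hME]
    exact isProduct_lpDist _ _
  rw [sub_eq_neg_add]
  refine seriesEstimate_of_localized hχ hp.1 hp.2.ne ha hD hDn
    (N := fun n => n ∈ Finset.Icc (-7 : ℤ) 7) hN hr (fun j k hjk => ?_)
    (ENNReal.mul_ne_top (ENNReal.mul_ne_top ENNReal.coe_ne_top hf.2.ne) hg.2.ne) ?_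
  · obtain ⟨G₀, hG₀⟩ := hGT j
    rw [← hLV j, hG₀]
    exact multiplier_lpMul_eq_zero hp₁.2.ne hp₂.2.ne (hL j) (hT₂ j) (hD k) hMm
      (block_lowFreq_mul_eq_zero hχ hθ2 hψ2 hjk) _ _
  · have h1 := eLpNorm_dyadicWeight_mul_le (K := K) (z := fun j => ‖M (V j) (G j)‖ₑ) hρ hr₂ hρr
      (hVn.trans_lt (ENNReal.mul_lt_top ENNReal.coe_lt_top hx_top)) hy_top
      (fun j => (enorm_bilinear_apply_le hM _ _).trans_eq (mul_assoc _ _ _))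
    rw [← hS]
    calc (C₃ : ℝ≥0∞) * (S * eLpNorm (fun j => dyadicWeight (-σ + s) j * ‖M (V j) (G j)‖ₑ) r
          Measure.count)
        ≤ C₃ * (S * (K * ((C₄ * ((2 * C₁ : ℝ≥0) * expLambdaBesovNorm χ a (-σ) p₁ r₁ f)) *
            ((2 * C₂ : ℝ≥0) * expLambdaBesovNorm χ a s p₂ r₂ g)))) := by
          gcongr
          refine h1.trans ?_
          gcongr
          exact hVn.trans (by gcongr)
      _ = _ := by push_cast; ring

/-- The estimate of the remainder, uniform in `a ≥ 0`. The condition `s₁ + s₂ > 0` makes the sum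
over the frequencies above that of a given block a convergent geometric series. -/
theorem exists_remainder_estimate (hχ : IsCutoff χ) {r r₁ r₂ : ℝ≥0∞} (hp : 1 < p ∧ p < ∞)
    (hp₁ : 1 < p₁ ∧ p₁ < ∞) (hp₂ : 1 < p₂ ∧ p₂ < ∞) [ENNReal.HolderTriple p₁ p₂ p]
    (hr : 1 ≤ r) (hr₁ : 1 ≤ r₁) (hr₂ : 1 ≤ r₂) {s₁ s₂ : ℝ} (hs : 0 < s₁ + s₂)
    (h : r⁻¹ = r₁⁻¹ + r₂⁻¹) :
    ∃ C : ℝ≥0, ∀ a : ℝ, 0 ≤ a →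
      ∀ f ∈ GevreyBesov χ a s₁ p₁ r₁, ∀ g ∈ GevreyBesov χ a s₂ p₂ r₂,
        ∃ W : ℤ → TempDist d, IsRemainderTerms χ f g W ∧
          SeriesEstimate χ a (s₁ + s₂) p r W
            (C * expLambdaBesovNorm χ a s₁ p₁ r₁ f * expLambdaBesovNorm χ a s₂ p₂ r₂ g) := by
  obtain ⟨θ, hθ, hθ1, hθ2⟩ := exists_isTestFunction_annulus (d := d)
  obtain ⟨C₁, T₁, hT₁, hTn₁⟩ := hθ.exists_isMultiplier hp₁.2.ne
  obtain ⟨C₂, T₂, hT₂, hTn₂⟩ := hθ.exists_isMultiplier hp₂.2.ne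
  obtain ⟨C₃, D, hD, hDn⟩ := hχ.isTestFunction_block.exists_isMultiplier hp.2.ne
  obtain ⟨K, hK⟩ := exists_twistedProduct (d := d) hp hp₁ hp₂
  have hN := tsum_dyadicWeight_ne_top hs 3
  obtain ⟨S, hS⟩ := WithTop.ne_top_iff_exists.1 hN
  obtain ⟨C₄, hC₄⟩ := exists_eLpNorm_neighbours_le hr₂ s₂
  refine ⟨C₃ * (S * (K * ((2 * C₁) * (C₄ * (2 * C₂))))), fun a ha f hf g hg => ?_⟩
  obtain ⟨M, hM, ⟨m, hMm⟩, hME⟩ := hK a ha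
  obtain ⟨F, hFf, hFn, hFT⟩ := exists_localized_blocks hχ hp₁.1 hp₁.2.ne hθ hθ1 hT₁ hTn₁ ha
    (GevreyBesov.expLambdaLpNorm_lt_top hr₁ hf)
  obtain ⟨G, hGg, hGn, hGT⟩ := exists_localized_blocks hχ hp₂.1 hp₂.2.ne hθ hθ1 hT₂ hTn₂ ha
    (GevreyBesov.expLambdaLpNorm_lt_top hr₂ hg)
  have hxn : eLpNorm (fun j => dyadicWeight s₁ j * ‖F j‖ₑ) r₁ Measure.count ≤
      (2 * C₁ : ℝ≥0) * expLambdaBesovNorm χ a s₁ p₁ r₁ f := eLpNorm_dyadicWeight_mul_enorm_le hFn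
  have hyn : eLpNorm (fun j => dyadicWeight s₂ j * ‖G j‖ₑ) r₂ Measure.count ≤
      (2 * C₂ : ℝ≥0) * expLambdaBesovNorm χ a s₂ p₂ r₂ g := eLpNorm_dyadicWeight_mul_enorm_le hGn
  have hzn := hC₄ fun j => ‖G j‖ₑ
  have hx_top := hxn.trans_lt (ENNReal.mul_lt_top ENNReal.coe_lt_top hf.2)
  have hy_top := hyn.trans_lt (ENNReal.mul_lt_top ENNReal.coe_lt_top hg.2)
  refine ⟨fun j => lpDist p (expNegLambda hp.2.ne a
      (∑ j' ∈ Finset.Icc (j - 1) (j + 1), M (F j) (G j'))),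
    ⟨fun j j' => lpDist p (expNegLambda hp.2.ne a (M (F j) (G j'))), fun j j' _ => ?_, fun j => ?_⟩,
    seriesEstimate_of_localized hχ hp.1 hp.2.ne ha hD hDn (N := fun n => n ≤ 3)
      hN hr (fun j k hjk => ?_)
      (ENNReal.mul_ne_top (ENNReal.mul_ne_top ENNReal.coe_ne_top hf.2.ne) hg.2.ne) ?_⟩
  · beta_reduce
    rw [hFf j, hGg j', ← hME]
    exact isProduct_lpDist _ _
  · simp only [map_sum]
  · rw [map_sum]
    refine Finset.sum_eq_zero fun j' hj' => ?_
    obtain ⟨F₀, hF₀⟩ := hFT j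
    obtain ⟨G₀, hG₀⟩ := hGT j'
    rw [hF₀, hG₀]
    exact multiplier_lpMul_eq_zero hp₁.2.ne hp₂.2.ne (hT₁ j) (hT₂ j') (hD k) hMm
      (block_block_mul_eq_zero hχ hθ2 (Finset.mem_Icc.1 hj').2 hjk) _ _
  · have h1 := eLpNorm_dyadicWeight_mul_le (K := K)
      (z := fun j => ‖∑ j' ∈ Finset.Icc (j - 1) (j + 1), M (F j) (G j')‖ₑ) hr₁ hr₂ h hx_top
      (hzn.trans_lt (ENNReal.mul_lt_top ENNReal.coe_lt_top hy_top)) (fun j => by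
        rw [Finset.mul_sum, Finset.mul_sum]
        exact (enorm_sum_le _ _).trans (Finset.sum_le_sum fun j' _ =>
          (enorm_bilinear_apply_le hM _ _).trans_eq (mul_assoc _ _ _)))
    rw [← hS]
    calc (C₃ : ℝ≥0∞) * (S * eLpNorm (fun j => dyadicWeight (s₁ + s₂) j *
          ‖∑ j' ∈ Finset.Icc (j - 1) (j + 1), M (F j) (G j')‖ₑ) r Measure.count)
        ≤ C₃ * (S * (K * (((2 * C₁ : ℝ≥0) * expLambdaBesovNorm χ a s₁ p₁ r₁ f) *
            (C₄ * ((2 * C₂ : ℝ≥0) * expLambdaBesovNorm χ a s₂ p₂ r₂ g))))) := by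
          gcongr
          refine h1.trans ?_
          gcongr
          exact hzn.trans (by gcongr)
      _ = _ := by push_cast; ring

end Products

end

theorem proposition2p1 {d : ℕ} (hd : 1 ≤ d) (χ : Rd d → ℝ) (hχ : IsCutoff χ)
    (c₀ : ℝ) (hc₀ : 0 < c₀) (p p₁ p₂ r r₁ r₂ : ℝ≥0∞)
    (hp : 1 < p ∧ p < ∞) (hp₁ : 1 < p₁ ∧ p₁ < ∞) (hp₂ : 1 < p₂ ∧ p₂ < ∞)
    (hr : 1 ≤ r) (hr₁ : 1 ≤ r₁) (hr₂ : 1 ≤ r₂) (hpp : p⁻¹ = p₁⁻¹ + p₂⁻¹) :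
    (∀ s σ : ℝ, (0 < σ ∧ r⁻¹ = r₁⁻¹ + r₂⁻¹) ∨ (σ = 0 ∧ r₁ = 1 ∧ r = r₂) →
      ∃ C : ℝ≥0, ∀ t : ℝ, 0 ≤ t →
        ∀ f ∈ GevreyBesov χ (√(c₀ * t)) (-σ) p₁ r₁, ∀ g ∈ GevreyBesov χ (√(c₀ * t)) s p₂ r₂,
          ∃ W : ℤ → TempDist d, IsParaproductTerms χ f g W ∧
            SeriesEstimate χ (√(c₀ * t)) (s - σ) p r W
              (C * expLambdaBesovNorm χ (√(c₀ * t)) (-σ) p₁ r₁ f *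
                expLambdaBesovNorm χ (√(c₀ * t)) s p₂ r₂ g)) ∧
    (∀ s₁ s₂ : ℝ, 0 < s₁ + s₂ → r⁻¹ = r₁⁻¹ + r₂⁻¹ →
      ∃ C : ℝ≥0, ∀ t : ℝ, 0 ≤ t →
        ∀ f ∈ GevreyBesov χ (√(c₀ * t)) s₁ p₁ r₁, ∀ g ∈ GevreyBesov χ (√(c₀ * t)) s₂ p₂ r₂,
          ∃ W : ℤ → TempDist d, IsRemainderTerms χ f g W ∧
            SeriesEstimate χ (√(c₀ * t)) (s₁ + s₂) p r W
              (C * expLambdaBesovNorm χ (√(c₀ * t)) s₁ p₁ r₁ f *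
                expLambdaBesovNorm χ (√(c₀ * t)) s₂ p₂ r₂ g)) := by
  have : Fact (1 ≤ p) := ⟨hp.1.le⟩
  have : Fact (1 ≤ p₁) := ⟨hp₁.1.le⟩
  have : Fact (1 ≤ p₂) := ⟨hp₂.1.le⟩
  have : ENNReal.HolderTriple p₁ p₂ p := ⟨hpp.symm⟩
  refine ⟨fun s σ h => ?_, fun s₁ s₂ hs h => ?_⟩
  · obtain ⟨C, hC⟩ := exists_paraproduct_estimate hχ hp hp₁ hp₂ hr hr₁ hr₂ s σ h
    exact ⟨C, fun t _ => hC _ (Real.sqrt_nonneg _)⟩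
  · obtain ⟨C, hC⟩ := exists_remainder_estimate hχ hp hp₁ hp₂ hr hr₁ hr₂ hs h
    exact ⟨C, fun t _ => hC _ (Real.sqrt_nonneg _)⟩
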